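/- **Conventions.** Rings are associative with $1$. A ring $R$ is *left arithmetical* if (a) every simple left $R$-module is finite, (b) every simple left $R$-module is finitely presented, and (c) for every positive integer $n$ there are, up to isomorphism, only finitely many simple left $R$-modules with $n$ elements. Let $\mathcal S(R)$ be the set of isomorphism classes of simple left $R$-modules, $G(R)$ the free commutative monoid on $\mathcal S(R)$, written multiplicatively, and $\mathscr N:G(R)\to\mathbb N$ the monoid homomorphism that sends the class of a simple module $S$ to $|S|$. A finite length left $R$-module $B$ has a class $[B]\in G(R)$, the product of the classes of its composition factors with multiplicity. The *Dirichlet algebra* $\mathrm{Dir}(R)$ is the algebra of all functions $G(R)\to\mathbb C$, written as formal sums $\sum_{g\in G(R)}c_g\,g$, with the convolution product and the topology in which the sets $\{f: f(g)=0 \text{ whenever } \mathscr N(g)\le n\}$, $n\ge 0$, form a basis of neighbourhoods of $0$; infinite sums and products are taken in this topology. For finitely generated left $R$-modules $M,N$, put $$Z(M)=\sum_{X}[M/X],\qquad Z(M,N)=\sum_{X\simeq N}[M/X]\qquad\text{in }\mathrm{Dir}(R),$$ where $X$ runs over the finite colength submodules of $M$ (those with $M/X$ of finite length), respectively over those isomorphic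 to $N$. A two-sided ideal $I$ of $R$ is *invertible* if $I\otimes_R-$ is an auto-equivalence of the category of left $R$-modules. **Theorem.** Let $R$ be a left arithmetical ring, let $M$ be a finitely generated projective left $R$-module, and let $I$ be an invertible ideal of $R$, contained in the Jacobson radical of $R$, such that all finite colength submodules of $M/IM$ are projective over $R/I$. Let $\mathcal P$ be the set of sequences $P=(P_j)_{j\ge0}$ of isomorphism classes of finitely generated projective left $R/I$-modules of the form $([Y_j])_{j\ge 0}$, where $Y_0\subseteq Y_1\subseteq\cdots$ is a chain of finite colength submodules of $M/IM$ with $Y_j=M/IM$ for all large $j$. For $P\in\mathcal P$, $j\ge0$ and a finite length left $R/I$-module $B$, put $$\langle P,B\rangle^I_j=|\mathrm{Hom}(P_j,B)|^{-1}\prod_{k=0}^{j}|\mathrm{Hom}(P_{j-k},I^k\otimes_R B)|\,[I^k\otimes_R B]\in\mathrm{Dir}(R).$$ Then $\langle P,B\rangle_j^I$ depends only on $[B]\in G(R/I)$ and is multiplicative in $[B]$, so that it defines a change of variable $f=\sum_g c_g\,g\mapsto f(\langle P,-\rangle_j^I)=\sum_g c_g\,\langle P,g\rangle_j^I$ from $\mathrm{Dir}(R/I)$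 to $\mathrm{Dir}(R)$; all the series and products involved converge; and $$Z(M)=\sum_{P\in\mathcal P}\ \prod_{j=0}^{\infty}Z\bigl(P_{j+1},P_j;\langle P,-\rangle^I_j\bigr)\qquad\text{in }\mathrm{Dir}(R),$$ where $Z(P_{j+1},P_j;\langle P,-\rangle^I_j)$ is the image of the partial zeta function $Z(P_{j+1},P_j)\in\mathrm{Dir}(R/I)$ under this change of variable. -/

import Mathlib

open CategoryTheory TensorProduct

universe u v w

noncomputable section

/-! ### Simple modules, the monoid `G(R)`, and left arithmetical rings -/

/-- Maximal left ideals `m`, `m'` are related when the simple left modules `R ⧸ m` and `R ⧸ m'`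
are isomorphic. -/
def simpleSetoid (R : Type u) [Ring R] : Setoid {m : Ideal R // m.IsMaximal} where
  r m m' := Nonempty ((R ⧸ m.1) ≃ₗ[R] (R ⧸ m'.1))
  iseqv := ⟨fun _ => ⟨LinearEquiv.refl R _⟩, fun ⟨e⟩ => ⟨e.symm⟩, fun ⟨e⟩ ⟨e'⟩ => ⟨e.trans e'⟩⟩

/-- The set `𝒮(R)` of isomorphism classes of simple left `R`-modules. Every simple left module is
isomorphic to `R ⧸ m` for a maximal left ideal `m`, so the classes are represented by these. -/
def SimpleClass (R : Type u) [Ring R] : Type u := Quotient (simpleSetoid R)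

namespace SimpleClass

variable {R : Type u} [Ring R]

/-- The isomorphism class of a simple left `R`-module. -/
def of (S : Type v) [AddCommGroup S] [Module R S] (h : IsSimpleModule R S) : SimpleClass R :=
  Quotient.mk (simpleSetoid R)
    ⟨(isSimpleModule_iff_quot_maximal.mp h).choose,
      (isSimpleModule_iff_quot_maximal.mp h).choose_spec.1⟩

/-- A simple left module in the given class. -/
abbrev Rep (i : SimpleClass R) : Type u := R ⧸ (Quotient.out i).1

/-- The number of elements of any simple module in the class (`0` if it is infinite). -/
def card (i : SimpleClass R) : ℕ :=
  Quotient.lift (s := simpleSetoid R) (fun m => Nat.card (R ⧸ m.1))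
    (fun _ _ ⟨e⟩ => Nat.card_congr e.toEquiv) i

end SimpleClass

/-- Left arithmetical rings. -/
structure IsLeftArithmetical (R : Type u) [Ring R] : Prop where
  finite_of_simple : ∀ (S : Type u) [AddCommGroup S] [Module R S], IsSimpleModule R S → Finite S
  finitePresentation_of_simple : ∀ (S : Type u) [AddCommGroup S] [Module R S],
    IsSimpleModule R S → Module.FinitePresentation R S
  finite_card_eq : ∀ n : ℕ, 0 < n → {i : SimpleClass R | i.card = n}.Finite

/-- The free commutative monoid `G(R)` on the isomorphism classes of simple left `R`-modules,
written additively. -/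
abbrev GMonoid (R : Type u) [Ring R] : Type u := SimpleClass R →₀ ℕ

/-- The norm of an element of `G(R)`: the multiplicative extension of `i ↦ |S|`, `S ∈ i`. -/
def GMonoid.norm {R : Type u} [Ring R] (g : GMonoid R) : ℕ := g.prod fun i n => i.card ^ n

/-- The simple class of the `i`-th factor of a composition series. -/
def factorClass {R : Type u} [Ring R] {B : Type v} [AddCommGroup B] [Module R B]
    (s : CompositionSeries (Submodule R B)) (i : Fin s.length) : SimpleClass R :=
  SimpleClass.of (↥(s i.succ) ⧸ Submodule.comap (s i.succ).subtype (s i.castSucc))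
    ((covBy_iff_quot_is_simple (s.step i).le).mp (s.step i))

open Classical in
/-- The class `[B] ∈ G(R)` of a finite length left `R`-module `B`: the composition factors of `B`,
with multiplicity. The value at modules of infinite length is irrelevant. -/
def moduleClass (R : Type u) [Ring R] (B : Type v) [AddCommGroup B] [Module R B] : GMonoid R :=
  if h : ∃ s : CompositionSeries (Submodule R B), s.head = ⊥ ∧ s.last = ⊤ then
    ∑ i : Fin h.choose.length, Finsupp.single (factorClass h.choose i) 1
  else 0

/-! ### The Dirichlet algebra -/

/-- The Dirichlet algebra `Dir(R)`: all functions `G(R) → ℂ`, with the convolution product. -/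
def Dir (R : Type u) [Ring R] : Type u := MvPowerSeries (SimpleClass R) ℂ

namespace Dir

variable {R : Type u} [Ring R]

instance : CommRing (Dir R) := inferInstanceAs (CommRing (MvPowerSeries (SimpleClass R) ℂ))

instance : Algebra ℂ (Dir R) := inferInstanceAs (Algebra ℂ (MvPowerSeries (SimpleClass R) ℂ))

/-- The coefficient of `f` at `g ∈ G(R)`. -/
def coeff (g : GMonoid R) (f : Dir R) : ℂ := MvPowerSeries.coeff g f

/-- An element of `G(R)` as an element of `Dir(R)`. -/
def of (g : GMonoid R) : Dir R := MvPowerSeries.monomial g (1 : ℂ)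

/-- The topology of the nonarchimedean valuation induced by the norm: two elements are close when
their coefficients agree at all `g` of norm at most `n`, for a large `n`. Convergence of series and
products in this topology is pseudo-convergence. -/
instance : TopologicalSpace (Dir R) :=
  ⨅ n : ℕ, TopologicalSpace.induced
    (fun (f : Dir R) (g : {g : GMonoid R // g.norm ≤ n}) => coeff g.1 f) ⊥

/-- The `g`-th term of the series obtained from `f = ∑ f(g) g` by the change of variable `φ`. -/
def substTerm {A : Type v} [Ring A] (φ : GMonoid A → Dir R) (f : Dir A) (g : GMonoid A) : Dir R :=
  coeff g f • φ g

/-- The change of variable `φ` applied to `f`. -/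
def subst {A : Type v} [Ring A] (φ : GMonoid A → Dir R) (f : Dir A) : Dir R :=
  ∑' g : GMonoid A, substTerm φ f g

end Dir

/-! ### Bushnell–Reiner zeta functions -/

section Zeta

variable (R : Type u) [Ring R] (M : Type v) [AddCommGroup M] [Module R M]
  (N : Type w) [AddCommGroup N] [Module R N]

/-- The terms `[M/X]` of `Z(M)`, `X` a finite colength submodule of `M`. -/
def zetaTerm (X : {X : Submodule R M // IsFiniteLength R (M ⧸ X)}) : Dir R :=
  Dir.of (moduleClass R (M ⧸ X.1))

/-- The Bushnell–Reiner zeta function `Z(M)`. -/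
def zeta : Dir R := ∑' X, zetaTerm R M X

/-- The terms `[M/X]` of `Z(M,N)`, `X` a finite colength submodule of `M` isomorphic to `N`. -/
def partialZetaTerm
    (X : {X : Submodule R M // IsFiniteLength R (M ⧸ X) ∧ Nonempty (X ≃ₗ[R] N)}) : Dir R :=
  Dir.of (moduleClass R (M ⧸ X.1))

/-- The partial Bushnell–Reiner zeta function `Z(M,N)`. -/
def partialZeta : Dir R := ∑' X, partialZetaTerm R M N X

end Zeta

/-! ### Tensor products with two-sided ideals, invertible ideals -/

section Tensor

variable {R : Type u} [Ring R] (I : Ideal R) [I.IsTwoSided]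

/-- The relations `(i r) ⊗ n = i ⊗ (r n)`, spanning a left `R`-submodule of `I ⊗_ℤ N`, on which
`R` acts through `I`. -/
def tensorRel (N : Type v) [AddCommGroup N] [Module R N] : Submodule R (I ⊗[ℤ] N) :=
  Submodule.span R {x | ∃ (i : I) (r : R) (n : N),
    x = (⟨i.1 * r, I.mul_mem_right r i.2⟩ : I) ⊗ₜ[ℤ] n - i ⊗ₜ[ℤ] (r • n)}

/-- The left `R`-module `I ⊗_R N` for a two-sided ideal `I` and a left `R`-module `N`. -/
abbrev IdealTensor (N : Type v) [AddCommGroup N] [Module R N] : Type (max u v) :=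
  (I ⊗[ℤ] N) ⧸ tensorRel I N

/-- The map `I ⊗_R f`. -/
def IdealTensor.map {N : Type v} [AddCommGroup N] [Module R N] {N' : Type w} [AddCommGroup N']
    [Module R N'] (f : N →ₗ[R] N') : IdealTensor I N →ₗ[R] IdealTensor I N' :=
  Submodule.mapQ (tensorRel I N) (tensorRel I N')
    (TensorProduct.AlgebraTensorModule.lTensor R I f.toAddMonoidHom.toIntLinearMap) (by
      rw [tensorRel, Submodule.span_le]
      rintro x ⟨i, r, n, rfl⟩
      exact Submodule.subset_span ⟨i, r, f n, by simp⟩)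

/-- The functor `I ⊗_R -` on left `R`-modules. -/
def tensorFunctor : ModuleCat.{u} R ⥤ ModuleCat.{u} R where
  obj N := ModuleCat.of R (IdealTensor I N)
  map f := ModuleCat.ofHom (IdealTensor.map I f.hom)
  map_id N := by
    refine ModuleCat.hom_ext (LinearMap.ext fun x => ?_)
    obtain ⟨x, rfl⟩ := Submodule.Quotient.mk_surjective _ x
    induction x using TensorProduct.induction_on with
    | zero => simp
    | tmul i n => simp [IdealTensor.map]
    | add x y hx hy => rw [Submodule.Quotient.mk_add, map_add, map_add, hx, hy]
  map_comp f g := by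
    refine ModuleCat.hom_ext (LinearMap.ext fun x => ?_)
    obtain ⟨x, rfl⟩ := Submodule.Quotient.mk_surjective _ x
    induction x using TensorProduct.induction_on with
    | zero => simp
    | tmul i n => simp [IdealTensor.map]
    | add x y hx hy => rw [Submodule.Quotient.mk_add, map_add, map_add, hx, hy]

/-- A two-sided ideal `I` is invertible if `I ⊗_R -` is an auto-equivalence of the category of left
`R`-modules. -/
def IsInvertibleIdeal : Prop := (tensorFunctor I).IsEquivalence

end Tensor

/-! ### The proliferation -/

section Prolif

variable {R : Type u} [Ring R] (I : Ideal R) [I.IsTwoSided]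

/-- An `R ⧸ I`-module viewed as an `R`-module. -/
abbrev resMod (B : ModuleCat.{u} (R ⧸ I)) : ModuleCat.{u} R :=
  (ModuleCat.restrictScalars (Ideal.Quotient.mk I)).obj B

/-- `⟨P, B⟩_j^I = |Hom(P_j, B)|⁻¹ ∏_{k=0}^j |Hom(P_{j-k}, I^k ⊗ B)| [I^k ⊗ B]`, for a sequence `P`
of left `R ⧸ I`-modules and a finite length left `R ⧸ I`-module `B`. -/
def bracket (P : ℕ → ModuleCat.{u} (R ⧸ I)) (j : ℕ) (B : ModuleCat.{u} (R ⧸ I)) : Dir R :=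
  ((Nat.card (P j →ₗ[R ⧸ I] B) : ℂ)⁻¹) •
    ∏ k ∈ Finset.range (j + 1),
      (Nat.card (resMod I (P (j - k)) →ₗ[R] IdealTensor (I ^ k) (resMod I B)) : ℂ) •
        Dir.of (moduleClass R (IdealTensor (I ^ k) (resMod I B)))

/-- The change of variable `⟨P, -⟩_j^I` on `G(R ⧸ I)`: the multiplicative map with the value
`⟨P, S⟩_j^I` at the class of each simple module `S`. -/
def bracketG (P : ℕ → ModuleCat.{u} (R ⧸ I)) (j : ℕ) (g : GMonoid (R ⧸ I)) : Dir R :=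
  g.prod fun i n => bracket I P j (ModuleCat.of (R ⧸ I) i.Rep) ^ n

variable (M : Type u) [AddCommGroup M] [Module R M]

/-- The left `R ⧸ I`-module `M/IM`. -/
abbrev ModI : Type u := M ⧸ (I • ⊤ : Submodule R M)

/-- Chains `Y_0 ⊆ Y_1 ⊆ ⋯` of finite colength submodules of `M/IM` that eventually stabilise to
`M/IM`. -/
structure IsStableChain (Y : ℕ → Submodule (R ⧸ I) (ModI I M)) : Prop where
  mono : Monotone Y
  finiteColength : ∀ j, IsFiniteLength (R ⧸ I) (ModI I M ⧸ Y j)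
  eventually_top : ∃ n, ∀ j, n ≤ j → Y j = ⊤

/-- Isomorphism classes of left `A`-modules. -/
abbrev IsoClass (A : Type u) [Ring A] : Type (u + 1) :=
  Quotient (isIsomorphicSetoid (ModuleCat.{u} A))

/-- The set `𝒫` of sequences of isomorphism classes `([Y_j])`, for chains `Y_0 ⊆ Y_1 ⊆ ⋯` of finite
colength submodules of `M/IM` eventually stabilising to `M/IM`. -/
def ChainClasses : Set (ℕ → IsoClass (R ⧸ I)) :=
  {P | ∃ Y : ℕ → Submodule (R ⧸ I) (ModI I M), IsStableChain I M Y ∧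
    ∀ j, P j = Quotient.mk _ (ModuleCat.of (R ⧸ I) (Y j))}

variable {I}

/-- Modules representing a sequence of isomorphism classes. -/
def reps (P : ℕ → IsoClass (R ⧸ I)) (j : ℕ) : ModuleCat.{u} (R ⧸ I) := Quotient.out (P j)

variable (I)

/-- The factor `Z(P_{j+1}, P_j; ⟨P, -⟩_j^I)`. -/
def prolifFactor (P : ℕ → IsoClass (R ⧸ I)) (j : ℕ) : Dir R :=
  Dir.subst (bracketG I (reps P) j) (partialZeta (R ⧸ I) (reps P (j + 1)) (reps P j))

/-- The proliferation `∑_{P ∈ 𝒫} ∏_{j=0}^∞ Z(P_{j+1}, P_j; ⟨P, -⟩_j^I)` of `M/IM` by `I ⊗ -`. -/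
def prolif : Dir R := ∑' P : ChainClasses I M, ∏' j : ℕ, prolifFactor I P.1 j

end Prolif

end

/-! ### Simple classes and the class of a finite length module -/

section ModuleClass

variable {R : Type u} [Ring R]

namespace SimpleClass

/-! For a submodule `X` of finite colength put `(X : I) = {m | I m ⊆ X}`, which is `colon I X`. The
images `Y_j` in `M/IM` of the iterates `(X : I^j)` form an increasing chain. Since `I` kills every
simple module and `M/X` has finite length, the iterates reach `M`, so the chain is one of those
defining `𝒫`. Hence `Z(M)` splits as a sum over chains, and the contribution of each chain has to be
computed.

Because `I` is invertible and `M` is projective, `U ↦ IU` and `colon I` are inverse bijections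
between the submodules of `M` and those of `IM`. Moreover `IV/IU ≅ I ⊗ (V/U)` and `I (X : I) = X ∩
IM` (`smul_colon_eq_inf`). Two consequences carry the proof. - `(X : I)/X` has a filtration with
factors `I^k ⊗ (Y_{k+1}/Y_k)` (`exact_colon_quot`, `IsMultInvariant.colon_quot_eq_prod`). - Once `V
= (X : I)` and `Y_0` are fixed, `X` amounts to a lift of the inclusion `Y_0 ⊆ M/IM` to `M/IV`. Lifts
exist because `Y_0` is projective and contained in `Y_1`, and they form a torsor under `Hom(Y_0, I ⊗
(V : I)/V)` (`card_fibre`).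

As `|Hom(Y_0, -)|` is multiplicative, the number of `X` over a given `V` is a product of the
`|Hom(Y_0, I^{k+1} ⊗ Y_{k+2}/Y_{k+1})|` and depends only on the chain. Induction along the chain
evaluates its contribution as `∏_j ⟨Y, Y_{j+1}/Y_j⟩_j` (`hasSum_chainFibre`). The factor `|Hom(P_j,
B)|⁻¹` of the bracket removes the term `k = 0`, to which no choice of `X` corresponds.

This weight involves only the isomorphism classes of the `Y_j` and the classes of the subquotients.
Choosing the `Y_j` downwards from `M/IM`, the chains of type `P` that equal `M/IM` from index `n` on
sum to the product of the first `n` factors (`hasSum_prod_chainWeight`), and `n → ∞` gives the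
infinite product. Convergence is always a coefficientwise finiteness: `G(R)` has finitely many
elements of bounded norm, a finitely generated module has finitely many submodules of bounded finite
index (`finite_submodules`), and the change of variable does not lower norms. -/

theorem exists_quot_equiv (S : Type v) [AddCommGroup S] [Module R S] (h : IsSimpleModule R S) :
    Nonempty (S ≃ₗ[R] R ⧸ (isSimpleModule_iff_quot_maximal.mp h).choose) :=
  (isSimpleModule_iff_quot_maximal.mp h).choose_spec.2

theorem of_eq_of_equiv {S : Type v} [AddCommGroup S] [Module R S] {S' : Type w} [AddCommGroup S']
    [Module R S'] (h : IsSimpleModule R S) (h' : IsSimpleModule R S') (e : S ≃ₗ[R] S') :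
    of S h = of S' h' :=
  Quotient.sound
    ⟨((exists_quot_equiv S h).some.symm.trans e).trans (exists_quot_equiv S' h').some⟩

instance (i : SimpleClass R) : IsSimpleModule R i.Rep :=
  isSimpleModule_iff_isCoatom.mpr (Ideal.isMaximal_def.mp (Quotient.out i).2)

theorem card_eq_natCard_rep (i : SimpleClass R) : i.card = Nat.card i.Rep := by
  conv_lhs => rw [← Quotient.out_eq i]
  rfl

theorem card_of (S : Type v) [AddCommGroup S] [Module R S] (h : IsSimpleModule R S) :
    (of S h).card = Nat.card S :=
  (Nat.card_congr (exists_quot_equiv S h).some.toEquiv).symm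

theorem exists_equiv_rep (S : Type v) [AddCommGroup S] [Module R S] (h : IsSimpleModule R S) :
    Nonempty (S ≃ₗ[R] (of S h).Rep) := by
  obtain ⟨e⟩ : (simpleSetoid R).r _ _ := Quotient.exact (Quotient.out_eq (of S h))
  exact ⟨(exists_quot_equiv S h).some.trans e.symm⟩

theorem of_rep (i : SimpleClass R) : of i.Rep inferInstance = i := by
  conv_rhs => rw [← Quotient.out_eq i]
  exact Quotient.sound ⟨(exists_quot_equiv i.Rep inferInstance).some.symm⟩

end SimpleClass

variable {M : Type v} [AddCommGroup M] [Module R M] {N : Type w} [AddCommGroup N] [Module R N]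

open Classical in
/-- The class of the simple factor of a covering pair `A ⋖ B`, as an element of `G(R)`. -/
noncomputable def covClass (A B : Submodule R M) : GMonoid R :=
  if h : A ⋖ B then
    Finsupp.single (SimpleClass.of (B ⧸ Submodule.comap B.subtype A)
      ((covBy_iff_quot_is_simple h.le).mp h)) 1
  else 0

theorem covClass_eq_single {A B : Submodule R M} (h : A ⋖ B) {S : Type w} [AddCommGroup S]
    [Module R S] (hS : IsSimpleModule R S) (e : (B ⧸ Submodule.comap B.subtype A) ≃ₗ[R] S) :
    covClass A B = Finsupp.single (SimpleClass.of S hS) 1 := by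
  rw [covClass, dif_pos h]
  congr 1
  exact SimpleClass.of_eq_of_equiv _ _ e

theorem covClass_eq_of_equiv {A B : Submodule R M} {A' B' : Submodule R N} (h : A ⋖ B)
    (h' : A' ⋖ B')
    (e : (B ⧸ Submodule.comap B.subtype A) ≃ₗ[R] (B' ⧸ Submodule.comap B'.subtype A')) :
    covClass A B = covClass A' B' := by
  rw [covClass_eq_single h ((covBy_iff_quot_is_simple h'.le).mp h') e, covClass, dif_pos h']

/-- The sum in `G(R)` of the classes of the factors of a composition series. -/
noncomputable def seriesClass (s : CompositionSeries (Submodule R M)) : GMonoid R :=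
  ∑ i : Fin s.length, covClass (s i.castSucc) (s i.succ)

theorem single_factorClass (s : CompositionSeries (Submodule R M)) (i : Fin s.length) :
    Finsupp.single (factorClass s i) 1 = covClass (s i.castSucc) (s i.succ) := by
  have h : s i.castSucc ⋖ s i.succ := s.step i
  rw [covClass, dif_pos h]
  rfl

theorem seriesClass_eq_of_equivalent {s t : CompositionSeries (Submodule R M)}
    (h : s.Equivalent t) : seriesClass s = seriesClass t := by
  obtain ⟨f, hf⟩ := h
  exact Fintype.sum_equiv f _ _ fun i =>
    covClass_eq_of_equiv (s.step i) (t.step (f i)) (hf i).linearEquiv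

/-- Jordan–Hölder: the series chosen in the definition of `moduleClass` may be replaced by any
other. -/
theorem moduleClass_eq_seriesClass (s : CompositionSeries (Submodule R M)) (h₀ : s.head = ⊥)
    (h₁ : s.last = ⊤) : moduleClass R M = seriesClass s := by
  have h : ∃ s : CompositionSeries (Submodule R M), s.head = ⊥ ∧ s.last = ⊤ := ⟨s, h₀, h₁⟩
  rw [moduleClass, dif_pos h]
  simp only [single_factorClass]
  exact seriesClass_eq_of_equivalent (CompositionSeries.jordan_holder _ _
    (h.choose_spec.1.trans h₀.symm) (h.choose_spec.2.trans h₁.symm))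

/-- Pushing a subquotient forward along an injective linear map. -/
noncomputable def subquotientMapEquiv (f : N →ₗ[R] M) (hf : Function.Injective f)
    (A B : Submodule R N) :
    (B ⧸ Submodule.comap B.subtype A) ≃ₗ[R]
      (B.map f ⧸ Submodule.comap (B.map f).subtype (A.map f)) :=
  Submodule.Quotient.equiv _ _ (Submodule.equivMapOfInjective f hf B) (by
    ext ⟨x, b, hb, rfl⟩
    simp only [Submodule.mem_map, Submodule.mem_comap]
    constructor
    · rintro ⟨⟨c, hc⟩, hcA, h⟩
      exact ⟨c, hcA, congrArg Subtype.val h⟩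
    · rintro ⟨c, hcA, h⟩
      obtain rfl := hf h
      exact ⟨⟨c, hb⟩, hcA, rfl⟩)

theorem map_covBy_map_of_injective (f : N →ₗ[R] M) (hf : Function.Injective f)
    {A B : Submodule R N} (h : A ⋖ B) : A.map f ⋖ B.map f := by
  rw [covBy_iff_quot_is_simple (Submodule.map_mono h.le)]
  have := (covBy_iff_quot_is_simple h.le).mp h
  exact IsSimpleModule.congr (subquotientMapEquiv f hf A B).symm

/-- The image of a composition series under an injective linear map. -/
def mapSeries (f : N →ₗ[R] M) (hf : Function.Injective f)
    (s : CompositionSeries (Submodule R N)) : CompositionSeries (Submodule R M) where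
  length := s.length
  toFun i := (s i).map f
  step i := map_covBy_map_of_injective f hf (s.step i)

theorem seriesClass_mapSeries (f : N →ₗ[R] M) (hf : Function.Injective f)
    (s : CompositionSeries (Submodule R N)) : seriesClass (mapSeries f hf s) = seriesClass s :=
  Finset.sum_congr rfl fun i _ => (covClass_eq_of_equiv (s.step i)
    (map_covBy_map_of_injective f hf (s.step i)) (subquotientMapEquiv f hf _ _)).symm

theorem seriesClass_snoc (s : CompositionSeries (Submodule R M)) (A : Submodule R M)
    (h : s.last ⋖ A) : seriesClass (s.snoc A h) = seriesClass s + covClass s.last A := by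
  have key := Fin.sum_univ_castSucc (n := s.length) (fun i : Fin (s.length + 1) =>
    covClass ((s.snoc A h) (Fin.castSucc i : Fin (s.length + 1 + 1)))
      ((s.snoc A h) (Fin.succ i : Fin (s.length + 1 + 1))))
  refine (show seriesClass (s.snoc A h) = _ from key).trans ?_
  congr 1
  · refine Finset.sum_congr rfl fun i _ => ?_
    rw [← Fin.castSucc_succ]
    erw [RelSeries.snoc_castSucc, RelSeries.snoc_castSucc]
  · erw [RelSeries.snoc_castSucc]
    rw [Fin.succ_last]
    erw [RelSeries.last_snoc']
    rfl

theorem moduleClass_eq_of_equiv (e : M ≃ₗ[R] N) (hM : IsFiniteLength R M) :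
    moduleClass R M = moduleClass R N := by
  obtain ⟨s, h₀, h₁⟩ := isFiniteLength_iff_exists_compositionSeries.mp hM
  rw [moduleClass_eq_seriesClass s h₀ h₁,
    moduleClass_eq_seriesClass (mapSeries (e : M →ₗ[R] N) e.injective s), seriesClass_mapSeries]
  · change s.head.map _ = ⊥
    rw [h₀, Submodule.map_bot]
  · change s.last.map _ = ⊤
    rw [h₁, Submodule.map_top, LinearEquiv.range]

theorem moduleClass_of_subsingleton [Subsingleton M] : moduleClass R M = 0 := by
  rw [moduleClass_eq_seriesClass (RelSeries.singleton _ (⊥ : Submodule R M)) rfl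
    (Subsingleton.elim _ _)]
  rfl

/-- A composition series of `A` is prolonged by `⊤`. The shape matches the constructor of
`IsFiniteLength`, so later statements on classes follow by induction on it. -/
theorem moduleClass_of_simple_quotient (A : Submodule R M) (hA : IsFiniteLength R A)
    {S : Type w} [AddCommGroup S] [Module R S] (hS : IsSimpleModule R S) (e : (M ⧸ A) ≃ₗ[R] S) :
    moduleClass R M = moduleClass R A + Finsupp.single (SimpleClass.of S hS) 1 := by
  obtain ⟨s, h₀, h₁⟩ := isFiniteLength_iff_exists_compositionSeries.mp hA
  have hq : IsSimpleModule R (M ⧸ A) := IsSimpleModule.congr e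
  let t := mapSeries A.subtype A.injective_subtype s
  have hlast : t.last = A := by
    change s.last.map _ = A
    rw [h₁, Submodule.map_subtype_top]
  have hcov : t.last ⋖ ⊤ := hlast ▸ (isSimpleModule_iff_isCoatom.mp hq).covBy_top
  rw [moduleClass_eq_seriesClass (t.snoc ⊤ hcov), seriesClass_snoc, seriesClass_mapSeries,
    moduleClass_eq_seriesClass s h₀ h₁, covClass_eq_single hcov hS]
  · refine (Submodule.Quotient.equiv _ _ Submodule.topEquiv ?_).trans e
    rw [hlast]
    ext x
    simp [Submodule.topEquiv]
  · rw [RelSeries.head_snoc]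
    change s.head.map _ = ⊥
    rw [h₀, Submodule.map_bot]
  · rw [RelSeries.last_snoc]

theorem isFiniteLength_of_exact {A : Type*} [AddCommGroup A] [Module R A] {B : Type*}
    [AddCommGroup B] [Module R B] {C : Type*} [AddCommGroup C] [Module R C] {f : A →ₗ[R] B}
    {g : B →ₗ[R] C} (hfg : Function.Exact f g) (hA : IsFiniteLength R A)
    (hC : IsFiniteLength R C) : IsFiniteLength R B := by
  rw [isFiniteLength_iff_isNoetherian_isArtinian] at *
  obtain ⟨_, _⟩ := hA
  obtain ⟨_, _⟩ := hC
  exact ⟨isNoetherian_of_range_eq_ker f g hfg.linearMap_ker_eq.symm,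
    isArtinian_of_range_eq_ker f g hfg.linearMap_ker_eq.symm⟩

theorem isFiniteLength_of_simple (h : IsSimpleModule R M) : IsFiniteLength R M := by
  have : IsSimpleModule R (M ⧸ (⊥ : Submodule R M)) :=
    IsSimpleModule.congr (Submodule.quotEquivOfEqBot ⊥ rfl)
  exact .of_simple_quotient (N := (⊥ : Submodule R M)) .of_subsingleton

/-- Induction on the length of `C`: for `N ≤ C` with simple quotient, the preimage `B'` of `N` is an
extension of `N` by `A`, and `B ⧸ B' ≃ C ⧸ N`. -/
theorem moduleClass_eq_add_of_exact {A : Type w} [AddCommGroup A] [Module R A] {B : Type w}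
    [AddCommGroup B] [Module R B] {C : Type w} [AddCommGroup C] [Module R C] {f : A →ₗ[R] B}
    {g : B →ₗ[R] C} (hf : Function.Injective f) (hg : Function.Surjective g)
    (hfg : Function.Exact f g) (hB : IsFiniteLength R B) :
    moduleClass R B = moduleClass R A + moduleClass R C := by
  have hC : IsFiniteLength R C := hB.of_surjective hg
  induction hC generalizing B with
  | @of_subsingleton C =>
    rw [moduleClass_of_subsingleton (M := C), add_zero]
    refine (moduleClass_eq_of_equiv (LinearEquiv.ofBijective f ⟨hf, fun b => ?_⟩)
      (hB.of_injective hf)).symm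
    exact (hfg b).mp (Subsingleton.elim _ _)
  | @of_simple_quotient C _ _ N hS hN ih =>
    let B' : Submodule R B := N.comap g
    have hB' : IsFiniteLength R B' := hB.of_injective B'.injective_subtype
    have hfB : ∀ a, f a ∈ B' := fun a => by
      change g (f a) ∈ N
      rw [hfg.apply_apply_eq_zero]
      exact N.zero_mem
    let f' : A →ₗ[R] B' := f.codRestrict B' hfB
    let g' : B' →ₗ[R] N := (g.comp B'.subtype).codRestrict N fun b => b.2
    have h1 := ih (f := f') (g := g') (fun a b h => hf (congrArg Subtype.val h))
      (fun ⟨n, hn⟩ => by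
        obtain ⟨b, rfl⟩ := hg n
        exact ⟨⟨b, hn⟩, rfl⟩)
      (fun b => by
        constructor
        · intro h
          obtain ⟨a, ha⟩ := (hfg b.1).mp (congrArg Subtype.val h)
          exact ⟨a, Subtype.ext ha⟩
        · rintro ⟨a, rfl⟩
          exact Subtype.ext (hfg.apply_apply_eq_zero a)) hB'
    have hker : LinearMap.ker (N.mkQ.comp g) = B' := by
      rw [LinearMap.ker_comp, Submodule.ker_mkQ]
    have e : (B ⧸ B') ≃ₗ[R] C ⧸ N := (Submodule.quotEquivOfEq _ _ hker.symm).trans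
      ((N.mkQ.comp g).quotKerEquivOfSurjective (N.mkQ_surjective.comp hg))
    rw [moduleClass_of_simple_quotient B' hB' hS e, h1,
      moduleClass_of_simple_quotient N hN hS (LinearEquiv.refl R _), add_assoc]

theorem GMonoid.norm_zero : (0 : GMonoid R).norm = 1 := Finsupp.prod_zero_index

theorem GMonoid.norm_add (g h : GMonoid R) : (g + h).norm = g.norm * h.norm :=
  Finsupp.prod_add_index' (fun _ => pow_zero _) fun _ _ _ => pow_add _ _ _

theorem GMonoid.norm_single (i : SimpleClass R) (n : ℕ) :
    GMonoid.norm (Finsupp.single i n) = i.card ^ n :=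
  Finsupp.prod_single_index (pow_zero _)

theorem norm_moduleClass (h : IsFiniteLength R M) : (moduleClass R M).norm = Nat.card M := by
  induction h with
  | of_subsingleton => rw [moduleClass_of_subsingleton, GMonoid.norm_zero, Nat.card_unique]
  | @of_simple_quotient C _ _ N hS hN ih =>
    rw [moduleClass_of_simple_quotient N hN hS (LinearEquiv.refl R _), GMonoid.norm_add, ih,
      GMonoid.norm_single, SimpleClass.card_of, pow_one,
      Submodule.card_eq_card_quotient_mul_card N, mul_comm]

end ModuleClass

/-! ### Tensor products with two-sided ideals -/

section Subquot

variable {R : Type u} [Ring R] {N : Type v} [AddCommGroup N] [Module R N]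

/-- The subquotient `V / U` for submodules `U ≤ V` of `N`, as a submodule of `N / U`. -/
abbrev subquot (U V : Submodule R N) :
    Submodule R (N ⧸ U) := V.map U.mkQ

/-- The quotient map `V → V / U`. -/
def toSubquot (U V : Submodule R N) : V →ₗ[R] subquot U V :=
  (U.mkQ.comp V.subtype).codRestrict _ fun v => ⟨v, v.2, rfl⟩

theorem toSubquot_surjective (U V : Submodule R N) : Function.Surjective (toSubquot U V) := by
  rintro ⟨_, v, hv, rfl⟩
  exact ⟨⟨v, hv⟩, rfl⟩

end Subquot

section IdealTensor

variable {R : Type u} [Ring R] (L : Ideal R) [L.IsTwoSided]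

namespace IdealTensor

variable {N : Type v} [AddCommGroup N] [Module R N] {N' : Type w} [AddCommGroup N'] [Module R N']
  {P : Type*} [AddCommGroup P] [Module R P]

/-- The pure tensor `l ⊗ n`. -/
def tmul (l : L) (n : N) : IdealTensor L N := Submodule.Quotient.mk (l ⊗ₜ[ℤ] n)

variable {L}

theorem induction {p : IdealTensor L N → Prop} (x : IdealTensor L N) (zero : p 0)
    (tmul : ∀ l n, p (tmul L l n)) (add : ∀ x y, p x → p y → p (x + y)) : p x := by
  obtain ⟨x, rfl⟩ := Submodule.Quotient.mk_surjective _ x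
  induction x using TensorProduct.induction_on with
  | zero => exact zero
  | tmul l n => exact tmul l n
  | add x y hx hy => exact add _ _ hx hy

theorem tmul_add (l : L) (n n' : N) : tmul L l (n + n') = tmul L l n + tmul L l n' := by
  simp [tmul, TensorProduct.tmul_add]

theorem add_tmul (l l' : L) (n : N) : tmul L (l + l') n = tmul L l n + tmul L l' n := by
  simp [tmul, TensorProduct.add_tmul]

theorem tmul_zero (l : L) : tmul L l (0 : N) = 0 := by simp [tmul]

theorem zero_tmul (n : N) : tmul L 0 n = 0 := by simp [tmul]

theorem smul_tmul (r : R) (l : L) (n : N) : r • tmul L l n = tmul L (r • l) n := rfl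

theorem tmul_smul (l : L) (r : R) (n : N) :
    tmul L l (r • n) = tmul L ⟨l.1 * r, L.mul_mem_right r l.2⟩ n :=
  ((Submodule.Quotient.eq (tensorRel L N)).mpr (Submodule.subset_span ⟨l, r, n, rfl⟩)).symm

theorem map_tmul (f : N →ₗ[R] N') (l : L) (n : N) : map L f (tmul L l n) = tmul L l (f n) := rfl

theorem map_map (f : N →ₗ[R] N') (g : N' →ₗ[R] P) (x : IdealTensor L N) :
    map L g (map L f x) = map L (g.comp f) x := by
  induction x using induction with
  | zero => simp
  | tmul l n => rfl
  | add x y hx hy => simp only [map_add, hx, hy]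

theorem map_eq_zero {f : N →ₗ[R] N'} (hf : f = 0) (x : IdealTensor L N) : map L f x = 0 := by
  subst hf
  induction x using induction with
  | zero => simp
  | tmul l n => rw [map_tmul, LinearMap.zero_apply, tmul_zero]
  | add x y hx hy => rw [map_add, hx, hy, add_zero]

theorem map_surjective {f : N →ₗ[R] N'} (hf : Function.Surjective f) :
    Function.Surjective (map L f) := fun y => by
  induction y using induction with
  | zero => exact ⟨0, map_zero _⟩
  | tmul l n =>
    obtain ⟨n, rfl⟩ := hf n
    exact ⟨tmul L l n, rfl⟩
  | add x y hx hy =>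
    obtain ⟨x, rfl⟩ := hx
    obtain ⟨y, rfl⟩ := hy
    exact ⟨x + y, map_add _ _ _⟩

theorem map_id (x : IdealTensor L N) : map L (LinearMap.id : N →ₗ[R] N) x = x := by
  induction x using induction with
  | zero => simp
  | tmul l n => rfl
  | add x y hx hy => rw [map_add, hx, hy]

variable (L) in
/-- The isomorphism `L ⊗ N ≃ L ⊗ N'` induced by an isomorphism `N ≃ N'`. -/
noncomputable def congr (e : N ≃ₗ[R] N') : IdealTensor L N ≃ₗ[R] IdealTensor L N' :=
  LinearEquiv.ofBijective (map L (e : N →ₗ[R] N'))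
    ⟨Function.LeftInverse.injective (g := map L (e.symm : N' →ₗ[R] N)) fun x => by
      rw [map_map]
      simp [map_id], map_surjective e.surjective⟩

/-- The linear map out of `L ⊗ N` given by a balanced biadditive map. -/
def lift (b : L →ₗ[R] N →ₗ[ℤ] P)
    (hb : ∀ (l : L) (r : R) (n : N), b ⟨l.1 * r, L.mul_mem_right r l.2⟩ n = b l (r • n)) :
    IdealTensor L N →ₗ[R] P :=
  (tensorRel L N).liftQ (TensorProduct.AlgebraTensorModule.lift b) (by
    rw [tensorRel, Submodule.span_le]
    rintro x ⟨l, r, n, rfl⟩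
    simp [hb])

variable (L N) in
/-- The multiplication map `L ⊗ N → N`. -/
def mulMap : IdealTensor L N →ₗ[R] N :=
  lift (LinearMap.mk₂' R ℤ (fun (l : L) (n : N) => l.1 • n) (fun _ _ _ => add_smul _ _ _)
    (fun _ _ _ => mul_smul _ _ _) (fun _ _ _ => smul_add _ _ _)
    (fun _ _ _ => smul_comm _ _ _)) fun _ _ _ => mul_smul _ _ _

theorem mulMap_tmul (l : L) (n : N) : mulMap L N (tmul L l n) = l.1 • n := rfl

theorem mulMap_map (f : N →ₗ[R] N') (x : IdealTensor L N) :
    mulMap L N' (map L f x) = f (mulMap L N x) := by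
  induction x using induction with
  | zero => simp
  | tmul l n => rw [map_tmul, mulMap_tmul, mulMap_tmul, map_smul]
  | add x y hx hy => simp only [map_add, hx, hy]

theorem mulMap_mem (x : IdealTensor L N) : mulMap L N x ∈ L • (⊤ : Submodule R N) := by
  induction x using induction with
  | zero => simp
  | tmul l n => exact Submodule.smul_mem_smul l.2 trivial
  | add x y hx hy => rw [map_add]; exact add_mem hx hy

theorem exists_mulMap_eq (V : Submodule R N) {n : N} (hn : n ∈ L • V) :
    ∃ x : IdealTensor L V, (mulMap L V x : N) = n := by
  induction hn using Submodule.smul_induction_on' with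
  | smul l hl n hn => exact ⟨tmul L ⟨l, hl⟩ ⟨n, hn⟩, rfl⟩
  | add x _ y _ hx hy =>
    obtain ⟨x, rfl⟩ := hx
    obtain ⟨y, rfl⟩ := hy
    exact ⟨x + y, by rw [map_add]; rfl⟩

theorem mulMap_mem_smul (V : Submodule R N) (x : IdealTensor L V) :
    (mulMap L V x : N) ∈ L • V := by
  induction x using induction with
  | zero => simp
  | tmul l n => exact Submodule.smul_mem_smul l.2 n.2
  | add x y hx hy => rw [map_add]; exact add_mem hx hy

/-- Every tensor in `L ⊗ R^(ι)` comes from some `h : ι →₀ L` through `ψ`, and multiplication sends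
`ψ h` to `h` read coordinatewise in `R`. So the product determines the tensor. -/
theorem mulMap_finsupp_injective (ι : Type*) :
    Function.Injective (mulMap L (ι →₀ R)) := by
  classical
  let ψ : (ι →₀ L) →+ IdealTensor L (ι →₀ R) :=
    Finsupp.liftAddHom fun i =>
      { toFun := fun l => tmul L l (Finsupp.single i 1)
        map_zero' := zero_tmul _
        map_add' := fun _ _ => add_tmul _ _ _ }
  have hψ : ∀ i l, ψ (Finsupp.single i l) = tmul L l (Finsupp.single i 1) := fun i l => by
    exact (Finsupp.liftAddHom_apply_single _ _ _)
  have hsurj : Function.Surjective ψ := by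
    intro x
    induction x using induction with
    | zero => exact ⟨0, map_zero _⟩
    | tmul l n =>
      induction n using Finsupp.induction_linear with
      | zero => exact ⟨0, by rw [map_zero, tmul_zero]⟩
      | add f g hf hg =>
        obtain ⟨x, hx⟩ := hf
        obtain ⟨y, hy⟩ := hg
        exact ⟨x + y, by rw [map_add, hx, hy, tmul_add]⟩
      | single i r =>
        refine ⟨Finsupp.single i ⟨l.1 * r, L.mul_mem_right r l.2⟩, ?_⟩
        rw [hψ, ← tmul_smul, Finsupp.smul_single, smul_eq_mul, mul_one]
    | add x y hx hy =>
      obtain ⟨x, rfl⟩ := hx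
      obtain ⟨y, rfl⟩ := hy
      exact ⟨x + y, map_add _ _ _⟩
  have hμ : ∀ (h : ι →₀ L) (i : ι), mulMap L (ι →₀ R) (ψ h) i = (h i : R) := by
    intro h i
    induction h using Finsupp.induction_linear with
    | zero => simp
    | add f g hf hg => simp [hf, hg]
    | single j l =>
      rw [hψ, mulMap_tmul]
      by_cases hij : j = i
      · subst hij; simp
      · simp [Finsupp.single_eq_of_ne (Ne.symm hij)]
  rw [injective_iff_map_eq_zero]
  intro x hx
  obtain ⟨h, rfl⟩ := hsurj x
  have : h = 0 := Finsupp.ext fun i => Subtype.ext (by rw [← hμ, hx]; rfl)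
  rw [this, map_zero]

/-- A projective module is a retract of a free one, and multiplication is natural. -/
theorem mulMap_injective_of_projective [Module.Projective R N] :
    Function.Injective (mulMap L N) := by
  obtain ⟨s, hs⟩ := Module.projective_def'.mp (inferInstance : Module.Projective R N)
  have hs' : Function.Injective (map L s) :=
    Function.LeftInverse.injective (g := map L (Finsupp.linearCombination R id)) fun x => by
      rw [map_map, hs, map_id]
  have h := (mulMap_finsupp_injective (L := L) N).comp hs'
  intro x y hxy
  exact h (by simp only [Function.comp, mulMap_map, hxy])

variable (L) in
/-- The map `L ⊗ (N / U) → N / L U`. -/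
def quotMap (U : Submodule R N) : IdealTensor L (N ⧸ U) →ₗ[R] N ⧸ (L • U) :=
  lift (LinearMap.mk₂' R ℤ
    (fun (l : L) (n : N ⧸ U) => QuotientAddGroup.map U.toAddSubgroup (L • U).toAddSubgroup
      (DistribSMul.toAddMonoidHom N l.1) (fun _ hu => Submodule.smul_mem_smul l.2 hu) n)
    (fun l l' n => by
      obtain ⟨n, rfl⟩ := Submodule.Quotient.mk_surjective _ n
      exact congrArg (Submodule.Quotient.mk) (add_smul l.1 l'.1 n))
    (fun r l n => by
      obtain ⟨n, rfl⟩ := Submodule.Quotient.mk_surjective _ n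
      exact congrArg (Submodule.Quotient.mk) (mul_smul r l.1 n))
    (fun _ _ _ => map_add _ _ _)
    (fun _ _ _ => map_zsmul _ _ _)) fun l r n => by
      obtain ⟨n, rfl⟩ := Submodule.Quotient.mk_surjective _ n
      exact congrArg (Submodule.Quotient.mk) (mul_smul l.1 r n)

theorem quotMap_map_mkQ (U : Submodule R N) (x : IdealTensor L N) :
    quotMap L U (map L U.mkQ x) = (L • U).mkQ (mulMap L N x) := by
  induction x using induction with
  | zero => simp
  | tmul l n => rfl
  | add x y hx hy => simp only [map_add, hx, hy]

theorem quotMap_subquot (U V : Submodule R N) (x : IdealTensor L V) :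
    quotMap L U (map L (subquot U V).subtype (map L (toSubquot U V) x)) =
      (L • U).mkQ (mulMap L V x : N) := by
  rw [map_map]
  have : (subquot U V).subtype.comp (toSubquot U V) = U.mkQ.comp V.subtype := rfl
  rw [this, ← map_map, quotMap_map_mkQ, mulMap_map]
  rfl

/-- `L ⊗ (V / U) ≃ L V / L U`, if the multiplication map `L ⊗ V → V` is injective. -/
theorem nonempty_subquot_equiv {U V : Submodule R N} (hUV : U ≤ V)
    (hV : Function.Injective (mulMap L V)) :
    Nonempty (IdealTensor L (subquot U V) ≃ₗ[R] subquot (L • U) (L • V)) := by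
  let θ : IdealTensor L (subquot U V) →ₗ[R] subquot (L • U) (L • V) :=
    ((quotMap L U).comp (map L (subquot U V).subtype)).codRestrict _ fun x => by
      obtain ⟨x, rfl⟩ := map_surjective (L := L) (toSubquot_surjective U V) x
      exact ⟨_, mulMap_mem_smul V x, (quotMap_subquot U V x).symm⟩
  refine ⟨LinearEquiv.ofBijective θ ⟨?_, ?_⟩⟩
  · rw [injective_iff_map_eq_zero]
    intro x hx
    obtain ⟨x, rfl⟩ := map_surjective (L := L) (toSubquot_surjective U V) x
    have h0 : (L • U).mkQ (mulMap L V x : N) = 0 :=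
      (quotMap_subquot U V x).symm.trans (congrArg Subtype.val hx)
    rw [Submodule.mkQ_apply, Submodule.Quotient.mk_eq_zero] at h0
    -- The product of `x` lies in `L U`, so it is also the product of some `y ∈ L ⊗ U`. Injectivity
    -- over `V` makes `x` the image of `y`, which dies in `L ⊗ (V / U)`.
    obtain ⟨y, hy⟩ := exists_mulMap_eq U h0
    have hxy : x = map L (Submodule.inclusion hUV) y :=
      hV (Subtype.ext (by rw [mulMap_map, ← hy]; rfl))
    rw [hxy, map_map]
    refine map_eq_zero (LinearMap.ext fun u => Subtype.ext ?_) y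
    exact (Submodule.Quotient.mk_eq_zero U).mpr u.2
  · rintro ⟨_, v, hv, rfl⟩
    obtain ⟨y, rfl⟩ := exists_mulMap_eq V hv
    exact ⟨map L (toSubquot U V) y, Subtype.ext (quotMap_subquot U V y)⟩

end IdealTensor

end IdealTensor

/-! ### Invertible ideals -/

section Colon

variable {R : Type u} [Ring R] (I : Ideal R) [I.IsTwoSided] {M : Type v} [AddCommGroup M]
  [Module R M]

/-- The submodule `{m | I m ⊆ X}`. -/
def colon (X : Submodule R M) : Submodule R M where
  carrier := {m | ∀ i ∈ I, i • m ∈ X}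
  add_mem' ha hb i hi := by
    rw [smul_add]
    exact add_mem (ha i hi) (hb i hi)
  zero_mem' i _ := by
    rw [smul_zero]
    exact X.zero_mem
  smul_mem' r m hm i hi := by
    rw [smul_smul]
    exact hm _ (I.mul_mem_right r hi)

variable {I}

theorem le_colon (X : Submodule R M) : X ≤ colon I X := fun _ hm i _ => X.smul_mem i hm

theorem smul_le_iff_le_colon {U X : Submodule R M} : I • U ≤ X ↔ U ≤ colon I X := by
  rw [Submodule.smul_le]
  exact ⟨fun h m hm i hi => h i hi m hm, fun h i hi m hm => h hm i hi⟩

theorem colon_mono {X Y : Submodule R M} (h : X ≤ Y) : colon I X ≤ colon I Y :=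
  fun _ hm i hi => h (hm i hi)

theorem smul_colon_le (X : Submodule R M) : I • colon I X ≤ X := smul_le_iff_le_colon.mpr le_rfl

theorem colon_inf_smul_top (X : Submodule R M) :
    colon I (X ⊓ I • (⊤ : Submodule R M)) = colon I X :=
  le_antisymm (colon_mono inf_le_left) fun _ hm i hi =>
    ⟨hm i hi, Submodule.smul_mem_smul hi trivial⟩

end Colon

namespace IsInvertibleIdeal

variable {R : Type u} [Ring R] {I : Ideal R} [I.IsTwoSided] (hI : IsInvertibleIdeal I)
  {A B C : Type u} [AddCommGroup A] [Module R A] [AddCommGroup B] [Module R B]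
  [AddCommGroup C] [Module R C]

include hI

/-- An equivalence of abelian categories is exact; this replaces flatness of `I`. -/
theorem exact_map {f : A →ₗ[R] B} {g : B →ₗ[R] C} (hf : Function.Injective f)
    (hg : Function.Surjective g) (hfg : Function.Exact f g) :
    Function.Injective (IdealTensor.map I f) ∧
      Function.Exact (IdealTensor.map I f) (IdealTensor.map I g) := by
  have : (tensorFunctor I).IsEquivalence := hI
  let S : ShortComplex (ModuleCat.{u} R) :=
    ShortComplex.mk (ModuleCat.ofHom f) (ModuleCat.ofHom g)
      (by rw [← ModuleCat.ofHom_comp, hfg.linearMap_comp_eq_zero]; rfl)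
  have hS : S.ShortExact := ModuleCat.shortComplex_shortExact S hfg hf hg
  have hT := hS.map_of_exact (tensorFunctor I)
  exact ⟨hT.moduleCat_injective_f,
    (ShortComplex.ShortExact.moduleCat_exact_iff_function_exact _).mp hT.exact⟩

theorem map_injective {f : A →ₗ[R] B} (hf : Function.Injective f) :
    Function.Injective (IdealTensor.map I f) :=
  (hI.exact_map hf (LinearMap.range f).mkQ_surjective (LinearMap.exact_map_mkQ_range f)).1

/-- Faithfulness, applied to the identity and zero maps of `A`. -/
theorem subsingleton (h : Subsingleton (IdealTensor I A)) : Subsingleton A := by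
  have : (tensorFunctor I).IsEquivalence := hI
  have h0 : ModuleCat.ofHom (LinearMap.id : A →ₗ[R] A) = ModuleCat.ofHom 0 := by
    apply (tensorFunctor I).map_injective
    exact ModuleCat.hom_ext (LinearMap.ext fun x => h.elim _ _)
  refine ⟨fun a b => ?_⟩
  have h1 : ∀ a : A, a = 0 := fun a => LinearMap.congr_fun (congrArg ModuleCat.Hom.hom h0) a
  rw [h1 a, h1 b]

/-- Every map into `I ⊗ A` comes from a map into `A`. -/
theorem exists_map_eq (j : B →ₗ[R] IdealTensor I A) :
    ∃ (U : Type u) (_ : AddCommGroup U) (_ : Module R U) (f : U →ₗ[R] A)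
      (e : IdealTensor I U ≃ₗ[R] B), ∀ x, j (e x) = IdealTensor.map I f x := by
  have : (tensorFunctor I).IsEquivalence := hI
  let e := (tensorFunctor I).objObjPreimageIso (ModuleCat.of R B)
  obtain ⟨f, hf⟩ := (tensorFunctor I).map_surjective (Y := ModuleCat.of R A)
    (e.hom ≫ ModuleCat.ofHom j)
  refine ⟨(tensorFunctor I).objPreimage (ModuleCat.of R B), inferInstance, inferInstance, f.hom,
    e.toLinearEquiv, fun x => ?_⟩
  exact (LinearMap.congr_fun (congrArg ModuleCat.Hom.hom hf) x).symm

/-- A submodule of `I ⊗ A` is the image of `I ⊗ f` for some `f : U → A`. As `A` is simple, `f` is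
surjective or zero, so the submodule is everything or zero. -/
theorem isSimpleModule (h : IsSimpleModule R A) : IsSimpleModule R (IdealTensor I A) := by
  have hn : Nontrivial (IdealTensor I A) := by
    by_contra hc
    rw [not_nontrivial_iff_subsingleton] at hc
    have := hI.subsingleton hc
    have := IsSimpleModule.nontrivial R A
    exact not_subsingleton A ‹_›
  refine { eq_bot_or_eq_top := fun W => ?_ }
  obtain ⟨U, _, _, f, e, he⟩ := hI.exists_map_eq W.subtype
  rcases f.surjective_or_eq_zero with hf | hf
  · right
    rw [eq_top_iff]
    intro y _
    obtain ⟨x, rfl⟩ := IdealTensor.map_surjective (L := I) hf y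
    rw [← he]
    exact (e x).2
  · left
    rw [eq_bot_iff]
    intro y hy
    have := he (e.symm ⟨y, hy⟩)
    rw [IdealTensor.map_eq_zero hf, e.apply_symm_apply] at this
    exact this

theorem isFiniteLength (h : IsFiniteLength R A) : IsFiniteLength R (IdealTensor I A) := by
  induction h with
  | @of_subsingleton A _ _ _ =>
    have : Subsingleton (IdealTensor I A) := subsingleton_of_forall_eq 0 fun x => by
      rw [← IdealTensor.map_id x]
      exact IdealTensor.map_eq_zero (Subsingleton.elim _ _) x
    exact .of_subsingleton
  | @of_simple_quotient A _ _ N hS _ ih =>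
    exact isFiniteLength_of_exact
      (hI.exact_map N.injective_subtype N.mkQ_surjective (LinearMap.exact_subtype_mkQ N)).2 ih
      (isFiniteLength_of_simple (hI.isSimpleModule hS))

theorem mulMap_injective [Module.Projective R A] (V : Submodule R A) :
    Function.Injective (IdealTensor.mulMap I V) := by
  have h := (IdealTensor.mulMap_injective_of_projective (L := I) (N := A)).comp
    (hI.map_injective V.injective_subtype)
  intro x y hxy
  exact h (by simp only [Function.comp, IdealTensor.mulMap_map, hxy])

theorem nonempty_subquot_equiv [Module.Projective R A] {U V : Submodule R A} (h : U ≤ V) :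
    Nonempty (IdealTensor I (subquot U V) ≃ₗ[R] subquot (I • U) (I • V)) :=
  IdealTensor.nonempty_subquot_equiv h (hI.mulMap_injective V)

/-- With `U' = (IU : I)` one has `IU' = IU`, so `I ⊗ (U'/U) ≃ IU'/IU = 0`, and `I ⊗ -` reflects zero
modules. -/
theorem colon_smul [Module.Projective R A] (U : Submodule R A) : colon I (I • U) = U := by
  have hle : U ≤ colon I (I • U) := smul_le_iff_le_colon.mp le_rfl
  have heq : I • colon I (I • U) = I • U :=
    le_antisymm (smul_colon_le _) (Submodule.smul_mono le_rfl hle)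
  obtain ⟨e⟩ := hI.nonempty_subquot_equiv hle
  have hs : Subsingleton (subquot (I • U) (I • colon I (I • U))) := by
    rw [heq]
    refine subsingleton_of_forall_eq 0 ?_
    rintro ⟨_, u, hu, rfl⟩
    exact Subtype.ext ((Submodule.Quotient.mk_eq_zero _).mpr hu)
  have := hI.subsingleton e.toEquiv.subsingleton
  refine le_antisymm (fun m hm => ?_) hle
  have h0 : (⟨U.mkQ m, m, hm, rfl⟩ : subquot U (colon I (I • U))) = 0 := Subsingleton.elim _ _
  exact (Submodule.Quotient.mk_eq_zero U).mp (congrArg Subtype.val h0)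

/-- As `W ⊆ IA ≅ I ⊗ A`, the inclusion of `W` is, up to isomorphism, `I ⊗ f` for some `f : U → A`.
Then `W` consists of elements of `I f(U)`, and `I f(U) ⊆ W` puts `f(U)` inside `(W : I)`. -/
theorem smul_colon [Module.Projective R A] {W : Submodule R A}
    (hW : W ≤ I • (⊤ : Submodule R A)) : I • colon I W = W := by
  refine le_antisymm (smul_colon_le W) ?_
  have hinj := IdealTensor.mulMap_injective_of_projective (L := I) (N := A)
  have hex : ∀ w : W, ∃ x, IdealTensor.mulMap I A x = w := fun w => by
    obtain ⟨x, hx⟩ := IdealTensor.exists_mulMap_eq _ (hW w.2)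
    exact ⟨IdealTensor.map I (Submodule.subtype ⊤) x, by rw [IdealTensor.mulMap_map, ← hx]; rfl⟩
  choose j hj using hex
  let j' : W →ₗ[R] IdealTensor I A :=
    { toFun := j
      map_add' := fun x y => hinj (by rw [map_add, hj, hj, hj]; rfl)
      map_smul' := fun r x => hinj (by rw [map_smul, hj, hj]; rfl) }
  obtain ⟨U, _, _, f, e, he⟩ := hI.exists_map_eq j'
  have hmem : ∀ x : IdealTensor I U, f (IdealTensor.mulMap I U x) ∈ W := fun x => by
    rw [← IdealTensor.mulMap_map, ← he, show j' (e x) = j (e x) from rfl, hj]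
    exact (e x).2
  intro w hw
  have h1 : f (IdealTensor.mulMap I U (e.symm ⟨w, hw⟩)) = w := by
    rw [← IdealTensor.mulMap_map, ← he, e.apply_symm_apply]
    exact hj _
  rw [← h1]
  have h2 : f (IdealTensor.mulMap I U (e.symm ⟨w, hw⟩)) ∈ I • LinearMap.range f := by
    rw [LinearMap.range_eq_map, ← Submodule.map_smul'']
    exact Submodule.mem_map_of_mem (IdealTensor.mulMap_mem _)
  refine Submodule.smul_mono le_rfl ?_ h2
  rintro _ ⟨u, rfl⟩ i hi
  rw [← map_smul]
  exact hmem (IdealTensor.tmul I ⟨i, hi⟩ u)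

theorem smul_colon_eq_inf [Module.Projective R A] (X : Submodule R A) :
    I • colon I X = X ⊓ I • (⊤ : Submodule R A) := by
  rw [← colon_inf_smul_top, hI.smul_colon inf_le_right]

end IsInvertibleIdeal

/-! ### Powers of `I` versus iterated tensor products -/

section Iterate

variable {R : Type u} [Ring R] (I : Ideal R) [I.IsTwoSided]

/-- The module `I ⊗ (I ⊗ ⋯ (I ⊗ A))`, with `k` factors `I`. -/
noncomputable def iterTensor : ℕ → ModuleCat.{u} R → ModuleCat.{u} R
  | 0, A => A
  | k + 1, A => ModuleCat.of R (IdealTensor I (iterTensor k A))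

variable {I}

/-- Presenting a module as a subquotient of a free module. -/
theorem exists_equiv_subquot_finsupp (A : Type u) [AddCommGroup A] [Module R A] :
    ∃ K : Submodule R (A →₀ R), Nonempty (A ≃ₗ[R] subquot K ⊤) := by
  let q : (A →₀ R) →ₗ[R] A := Finsupp.linearCombination R id
  have hq : Function.Surjective q := Finsupp.linearCombination_id_surjective R A
  have h : subquot (LinearMap.ker q) ⊤ = ⊤ := by
    rw [subquot, Submodule.map_top, Submodule.range_mkQ]
  exact ⟨LinearMap.ker q, ⟨(q.quotKerEquivOfSurjective hq).symm.trans
    (LinearEquiv.ofTop _ h).symm⟩⟩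

/-- Write `A = F/K` with `F` free; both sides are then `I^k F / I^k K`. The brackets are stated with
`I ^ k`, while inductions need one copy of `I` at a time. -/
theorem nonempty_pow_tensor_equiv (hI : IsInvertibleIdeal I) (k : ℕ) (A : ModuleCat.{u} R) :
    Nonempty (IdealTensor (I ^ k) A ≃ₗ[R] iterTensor I k A) := by
  obtain ⟨K, ⟨e⟩⟩ := exists_equiv_subquot_finsupp (R := R) A
  have hpow : ∀ k : ℕ, Nonempty (IdealTensor (I ^ k) A ≃ₗ[R]
      subquot ((I ^ k) • K) ((I ^ k) • (⊤ : Submodule R (A →₀ R)))) := fun k => by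
    have : Module.Projective R (⊤ : Submodule R (A →₀ R)) :=
      Module.Projective.of_equiv Submodule.topEquiv.symm
    obtain ⟨e'⟩ := IdealTensor.nonempty_subquot_equiv (L := I ^ k) (le_top : K ≤ ⊤)
      IdealTensor.mulMap_injective_of_projective
    exact ⟨(IdealTensor.congr (I ^ k) e).trans e'⟩
  have hiter : ∀ k : ℕ, Nonempty (iterTensor I k A ≃ₗ[R]
      subquot ((I ^ k) • K) ((I ^ k) • (⊤ : Submodule R (A →₀ R)))) := fun k => by
    induction k with
    | zero =>
      rw [Submodule.pow_zero, Ideal.one_eq_top, Submodule.top_smul, Submodule.top_smul]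
      exact ⟨e⟩
    | succ k ih =>
      obtain ⟨e'⟩ := ih
      rw [Ideal.IsTwoSided.pow_succ, Submodule.mul_smul, Submodule.mul_smul]
      obtain ⟨e''⟩ := hI.nonempty_subquot_equiv
        (Submodule.smul_mono (le_refl (I ^ k)) (le_top : K ≤ ⊤))
      exact ⟨(IdealTensor.congr I e').trans e''⟩
  exact ⟨(hpow k).some.trans (hiter k).some.symm⟩

end Iterate

/-! ### The topology of the Dirichlet algebra -/

section Dirichlet

variable {A : Type u} [Ring A]

/-- Every simple module is finite, and there are finitely many of each cardinality. -/
structure FiniteSimpleCounts (A : Type u) [Ring A] : Prop where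
  two_le_card : ∀ i : SimpleClass A, 2 ≤ i.card
  finite_card_eq : ∀ n : ℕ, {i : SimpleClass A | i.card = n}.Finite

namespace FiniteSimpleCounts

variable (hA : FiniteSimpleCounts A)
include hA

theorem norm_pos (g : GMonoid A) : 0 < g.norm :=
  Finset.prod_pos fun i _ => pow_pos (by have := hA.two_le_card i; omega) _

theorem norm_le_norm_add (g h : GMonoid A) : g.norm ≤ (g + h).norm := by
  rw [GMonoid.norm_add]
  exact Nat.le_mul_of_pos_right _ (hA.norm_pos h)

theorem card_pow_le_norm (g : GMonoid A) (i : SimpleClass A) : i.card ^ g i ≤ g.norm := by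
  by_cases hi : i ∈ g.support
  · exact Nat.le_of_dvd (hA.norm_pos g) (Finset.dvd_prod_of_mem (fun i => i.card ^ g i) hi)
  · rw [Finsupp.notMem_support_iff.mp hi, pow_zero]
    exact hA.norm_pos g

/-- A class occurring in `g` has cardinality at most `n`, which leaves finitely many classes. Its
exponent is below `n` because each cardinality is at least `2`. So all such `g` lie in one interval
`[0, b]`. -/
theorem finite_norm_le (n : ℕ) : {g : GMonoid A | g.norm ≤ n}.Finite := by
  classical
  have hS : {i : SimpleClass A | i.card ≤ n}.Finite := by
    refine ((Set.finite_Iic n).biUnion fun m _ => hA.finite_card_eq m).subset fun i hi => ?_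
    exact Set.mem_biUnion (show i.card ∈ Set.Iic n from hi) rfl
  let b : GMonoid A := Finsupp.onFinset hS.toFinset (fun i => if i.card ≤ n then n else 0)
    fun i hi => by
      rw [Set.Finite.mem_toFinset]
      by_contra h
      exact hi (if_neg h)
  refine (Set.finite_Icc 0 b).subset fun g hg => ⟨zero_le, fun i => ?_⟩
  have hle : i.card ^ g i ≤ n := (hA.card_pow_le_norm g i).trans hg
  have hlt : g i < i.card ^ g i := Nat.lt_pow_self (by have := hA.two_le_card i; omega)
  by_cases h0 : g i = 0
  · rw [h0]
    exact zero_le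
  · have hc : i.card ≤ n := (Nat.le_self_pow h0 _).trans hle
    change g i ≤ if i.card ≤ n then n else 0
    rw [if_pos hc]
    exact (hlt.trans_le hle).le

end FiniteSimpleCounts

namespace Dir

open Filter Topology

/-- The series with given coefficients. -/
def mk (c : GMonoid A → ℂ) : Dir A := fun g => c g

theorem coeff_add (g : GMonoid A) (f f' : Dir A) : coeff g (f + f') = coeff g f + coeff g f' :=
  map_add (MvPowerSeries.coeff g) f f'

theorem coeff_sub (g : GMonoid A) (f f' : Dir A) : coeff g (f - f') = coeff g f - coeff g f' :=
  map_sub (MvPowerSeries.coeff g) f f'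

theorem coeff_zero (g : GMonoid A) : coeff g (0 : Dir A) = 0 := map_zero (MvPowerSeries.coeff g)

theorem coeff_smul (g : GMonoid A) (c : ℂ) (f : Dir A) : coeff g (c • f) = c * coeff g f := rfl

theorem coeff_sum {ι : Type*} (g : GMonoid A) (s : Finset ι) (f : ι → Dir A) :
    coeff g (∑ i ∈ s, f i) = ∑ i ∈ s, coeff g (f i) := map_sum (MvPowerSeries.coeff g) f s

open Classical in
theorem coeff_of (g h : GMonoid A) : coeff g (of h) = if g = h then 1 else 0 :=
  MvPowerSeries.coeff_monomial _ _ _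

theorem of_zero : of (0 : GMonoid A) = 1 := rfl

theorem of_add (g h : GMonoid A) : of (g + h) = of g * of h := by
  refine Eq.symm ((MvPowerSeries.monomial_mul_monomial g h (1 : ℂ) 1).trans ?_)
  rw [one_mul]
  rfl

theorem of_sum {ι : Type*} (s : Finset ι) (g : ι → GMonoid A) :
    of (∑ i ∈ s, g i) = ∏ i ∈ s, of (g i) := by
  classical
  induction s using Finset.induction_on with
  | empty => rw [Finset.sum_empty, Finset.prod_empty, of_zero]
  | insert a s ha ih => rw [Finset.sum_insert ha, Finset.prod_insert ha, of_add, ih]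

theorem tendsto_iff {ι : Type*} {l : Filter ι} {f : ι → Dir A} {a : Dir A} :
    Tendsto f l (𝓝 a) ↔
      ∀ n : ℕ, ∀ᶠ i in l, ∀ g : GMonoid A, g.norm ≤ n → coeff g (f i) = coeff g a := by
  have h : 𝓝 a = ⨅ n : ℕ, comap
      (fun (f : Dir A) (g : {g : GMonoid A // g.norm ≤ n}) => coeff g.1 f)
      (pure fun g => coeff g.1 a) := by
    rw [nhds_iInf]
    refine iInf_congr fun n => ?_
    let _ : TopologicalSpace ({g : GMonoid A // g.norm ≤ n} → ℂ) := ⊥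
    refine (@nhds_induced _ _ ⊥ _ a).trans (congrArg _ ?_)
    exact congrFun (@nhds_discrete _ ⊥ ⟨rfl⟩) _
  rw [h, tendsto_iInf]
  refine forall_congr' fun n => ?_
  rw [tendsto_comap_iff, tendsto_pure]
  refine eventually_congr (Eventually.of_forall fun i => ?_)
  rw [funext_iff]
  exact ⟨fun h g hg => h ⟨g, hg⟩, fun h g => h g.1 g.2⟩

section

variable (hA : FiniteSimpleCounts A)
include hA

/-- Only finitely many coefficients have norm at most `n`, so the uniform condition defining the
topology reduces to eventual equality of each coefficient. -/
theorem tendsto_iff_coeff {ι : Type*} {l : Filter ι} {f : ι → Dir A} {a : Dir A} :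
    Tendsto f l (𝓝 a) ↔ ∀ g : GMonoid A, ∀ᶠ i in l, coeff g (f i) = coeff g a := by
  rw [tendsto_iff]
  refine ⟨fun h g => (h g.norm).mono fun i hi => hi g le_rfl, fun h n => ?_⟩
  exact ((hA.finite_norm_le n).eventually_all (p := fun g i => coeff g (f i) = coeff g a)).mpr
    fun g _ => h g

theorem hasSum_iff {ι : Type*} {f : ι → Dir A} {a : Dir A} :
    HasSum f a ↔ ∀ g : GMonoid A, ∀ᶠ s : Finset ι in atTop,
      ∑ i ∈ s, coeff g (f i) = coeff g a := by
  simp only [HasSum, SummationFilter.unconditional_filter, tendsto_iff_coeff hA, coeff_sum]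

/-- The topology is that of pointwise convergence of coefficients with `ℂ` discrete. It provides the
topological ring and Hausdorff properties known for power series. -/
theorem topology_eq : (inferInstance : TopologicalSpace (Dir A)) =
    @MvPowerSeries.WithPiTopology.instTopologicalSpace (SimpleClass A) ℂ ⊥ := by
  let _ : TopologicalSpace ℂ := ⊥
  have : DiscreteTopology ℂ := ⟨rfl⟩
  refine TopologicalSpace.ext_nhds fun a => ?_
  refine le_antisymm ?_ ?_
  · refine Filter.tendsto_id'.mp ?_
    refine (MvPowerSeries.WithPiTopology.tendsto_iff_coeff_tendsto (R := ℂ) _ _ a).mpr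
      fun d => ?_
    exact (tendsto_pure.mpr ((tendsto_iff_coeff hA).mp tendsto_id d)).mono_right (pure_le_nhds _)
  · refine Filter.tendsto_id'.mp ?_
    refine (tendsto_iff_coeff hA).mpr fun d => ?_
    have h := (MvPowerSeries.WithPiTopology.tendsto_iff_coeff_tendsto (R := ℂ) id _ a).mp
      tendsto_id d
    rw [nhds_discrete ℂ, tendsto_pure] at h
    exact h

theorem isTopologicalRing : IsTopologicalRing (Dir A) := by
  let _ : TopologicalSpace ℂ := ⊥
  have : DiscreteTopology ℂ := ⟨rfl⟩
  have h := MvPowerSeries.WithPiTopology.instIsTopologicalRing (σ := SimpleClass A) ℂ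
  rw [← topology_eq hA] at h
  exact h

theorem t2Space : T2Space (Dir A) := by
  let _ : TopologicalSpace ℂ := ⊥
  have : DiscreteTopology ℂ := ⟨rfl⟩
  have h := MvPowerSeries.WithPiTopology.instT2Space (σ := SimpleClass A) (R := ℂ)
  rw [← topology_eq hA] at h
  exact h

theorem summable_of_finite {ι : Type*} {f : ι → Dir A}
    (hf : ∀ g : GMonoid A, {i | coeff g (f i) ≠ 0}.Finite) : Summable f := by
  refine ⟨mk fun g => ∑ i ∈ (hf g).toFinset, coeff g (f i), ?_⟩
  rw [hasSum_iff hA]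
  intro g
  filter_upwards [eventually_ge_atTop (hf g).toFinset] with s hs
  refine (Finset.sum_subset hs fun i _ hi => ?_).symm
  by_contra h
  exact hi ((hf g).mem_toFinset.mpr h)

/-- A coefficient of the partial sums is constant beyond some finite `s`. Inserting one more index
into `s` does not change it, so that term has coefficient zero. -/
theorem finite_of_summable {ι : Type*} {f : ι → Dir A} (hf : Summable f) (g : GMonoid A) :
    {i | coeff g (f i) ≠ 0}.Finite := by
  classical
  obtain ⟨a, ha⟩ := hf
  obtain ⟨s, hs⟩ := eventually_atTop.mp ((hasSum_iff hA).mp ha g)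
  refine s.finite_toSet.subset fun i hi => ?_
  by_contra h
  have h1 := hs s le_rfl
  have h2 := hs (insert i s) (Finset.subset_insert i s)
  rw [Finset.sum_insert (show i ∉ s from h), h1] at h2
  exact hi (by simpa using h2)

/-- The series with vanishing coefficients in norm at most `n` form an ideal. -/
theorem exists_ideal (n : ℕ) :
    ∃ F : Ideal (Dir A), ∀ f, f ∈ F ↔ ∀ g : GMonoid A, g.norm ≤ n → coeff g f = 0 := by
  classical
  refine ⟨{ carrier := {f | ∀ g : GMonoid A, g.norm ≤ n → coeff g f = 0}
            add_mem' := fun {a b} ha hb g hg => by rw [coeff_add, ha g hg, hb g hg, add_zero]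
            zero_mem' := fun g _ => coeff_zero g
            smul_mem' := fun c f hf g hg => ?_ }, fun f => Iff.rfl⟩
  refine (MvPowerSeries.coeff_mul g c f).trans (Finset.sum_eq_zero fun p hp => ?_)
  have hp' : p.2 + p.1 = g := by rw [add_comm]; exact Finset.HasAntidiagonal.mem_antidiagonal.mp hp
  have : coeff p.2 f = 0 := hf _ (((hA.norm_le_norm_add p.2 p.1).trans (by rw [hp'])).trans hg)
  exact mul_eq_zero_of_right _ this

/-- Modulo the ideal of series vanishing in norm at most `n`, all factors with index at least `N n`
are `1`, so the partial products stabilise there. -/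
theorem multipliable_of_coeff_sub_one {f : ℕ → Dir A}
    (hf : ∀ n : ℕ, ∃ N, ∀ j, N ≤ j → ∀ g : GMonoid A, g.norm ≤ n → coeff g (f j - 1) = 0) :
    Multipliable f := by
  classical
  choose N hN using hf
  have key : ∀ (g : GMonoid A) (s : Finset ℕ), Finset.range (N g.norm) ⊆ s →
      coeff g (∏ j ∈ s, f j) = coeff g (∏ j ∈ Finset.range (N g.norm), f j) := by
    intro g s hs
    obtain ⟨F, hF⟩ := exists_ideal hA g.norm
    have h1 : Ideal.Quotient.mk F (∏ j ∈ s, f j) =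
        Ideal.Quotient.mk F (∏ j ∈ Finset.range (N g.norm), f j) := by
      rw [map_prod, map_prod]
      refine (Finset.prod_subset hs fun j _ hj => ?_).symm
      rw [← map_one (Ideal.Quotient.mk F), Ideal.Quotient.eq, hF]
      exact hN _ j (by simpa using hj)
    rw [Ideal.Quotient.eq, hF] at h1
    have h2 := h1 g le_rfl
    rwa [coeff_sub, sub_eq_zero] at h2
  refine ⟨mk fun g => coeff g (∏ j ∈ Finset.range (N g.norm), f j), ?_⟩
  simp only [HasProd, SummationFilter.unconditional_filter]
  rw [tendsto_iff_coeff hA]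
  intro g
  filter_upwards [eventually_ge_atTop (Finset.range (N g.norm))] with s hs
  exact key g s hs

end

end Dir

end Dirichlet

/-! ### Finiteness over left arithmetical rings -/

section Semilinear

theorem isFiniteLength_iff_of_bijective {R S : Type*} [Ring R] [Ring S] {σ : R →+* S}
    [RingHomSurjective σ] {M N : Type*} [AddCommGroup M] [Module R M] [AddCommGroup N] [Module S N]
    (f : M →ₛₗ[σ] N) (hf : Function.Bijective f) : IsFiniteLength R M ↔ IsFiniteLength S N := by
  rw [isFiniteLength_iff_isNoetherian_isArtinian, isFiniteLength_iff_isNoetherian_isArtinian,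
    f.isNoetherian_iff_of_bijective hf, f.isArtinian_iff_of_bijective hf]

variable {R : Type u} [Ring R] {I : Ideal R} [I.IsTwoSided]

/-- The identity of an `R ⧸ I`-module, as a semilinear map. -/
def resSemilinear (B : ModuleCat.{u} (R ⧸ I)) : resMod I B →ₛₗ[Ideal.Quotient.mk I] B where
  toFun b := b
  map_add' _ _ := rfl
  map_smul' _ _ := rfl

theorem resSemilinear_bijective (B : ModuleCat.{u} (R ⧸ I)) :
    Function.Bijective (resSemilinear B) := Function.bijective_id

theorem isFiniteLength_resMod {B : ModuleCat.{u} (R ⧸ I)} :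
    IsFiniteLength R (resMod I B) ↔ IsFiniteLength (R ⧸ I) B :=
  isFiniteLength_iff_of_bijective (resSemilinear B) (resSemilinear_bijective B)

theorem smul_resMod_eq_zero (B : ModuleCat.{u} (R ⧸ I)) {r : R} (hr : r ∈ I) (b : resMod I B) :
    r • b = 0 := by
  change Ideal.Quotient.mk I r • (b : B) = 0
  rw [Ideal.Quotient.eq_zero_iff_mem.mpr hr, zero_smul]

/-- Restriction of scalars of a linear map. -/
noncomputable def resMap {B C : ModuleCat.{u} (R ⧸ I)} (f : B →ₗ[R ⧸ I] C) :
    resMod I B →ₗ[R] resMod I C where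
  toFun b := f b
  map_add' := f.map_add
  map_smul' r b := f.map_smul (Ideal.Quotient.mk I r) b

/-- `R`-linear maps between `R ⧸ I`-modules are `R ⧸ I`-linear. -/
noncomputable def unresMap {B C : ModuleCat.{u} (R ⧸ I)} (f : resMod I B →ₗ[R] resMod I C) :
    B →ₗ[R ⧸ I] C where
  toFun b := f b
  map_add' := f.map_add
  map_smul' r b := by
    obtain ⟨r, rfl⟩ := Ideal.Quotient.mk_surjective r
    exact f.map_smul r b

end Semilinear

theorem finite_linearMap (R M N : Type*) [Ring R] [AddCommGroup M] [Module R M] [AddCommGroup N]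
    [Module R N] [Module.Finite R M] [Finite N] : Finite (M →ₗ[R] N) := by
  obtain ⟨s, hs⟩ := Module.Finite.fg_top (R := R) (M := M)
  refine Finite.of_injective (fun (f : M →ₗ[R] N) (x : s) => f x) fun f g hfg => ?_
  exact LinearMap.ext_on hs fun x hx => congrFun hfg ⟨x, hx⟩

namespace IsLeftArithmetical

variable {R : Type u} [Ring R] (hR : IsLeftArithmetical R)
include hR

theorem finite_of_isFiniteLength {B : Type u} [AddCommGroup B] [Module R B]
    (h : IsFiniteLength R B) : Finite B := by
  induction h with
  | of_subsingleton => infer_instance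
  | @of_simple_quotient B _ _ N hS _ ih =>
    have := hR.finite_of_simple _ hS
    have : Finite (B ⧸ N.toAddSubgroup) := this
    have : Finite N.toAddSubgroup := ih
    exact Finite.of_addSubgroup_quotient N.toAddSubgroup

theorem finitePresentation_of_isFiniteLength {B : Type u} [AddCommGroup B] [Module R B]
    (h : IsFiniteLength R B) : Module.FinitePresentation R B := by
  induction h with
  | of_subsingleton => exact Module.finitePresentation_of_projective R _
  | @of_simple_quotient B _ _ N hS _ ih =>
    have := hR.finitePresentation_of_simple _ hS
    have h : Module.FinitePresentation R (LinearMap.ker N.mkQ) := by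
      rw [Submodule.ker_mkQ]
      exact ih
    exact Module.finitePresentation_of_ker N.mkQ N.mkQ_surjective

/-- Condition (b) enters here: the kernel of a map from a finitely generated module onto a finitely
presented one is finitely generated. -/
theorem finite_of_finiteColength {M : Type u} [AddCommGroup M] [Module R M] [Module.Finite R M]
    (X : Submodule R M) (h : IsFiniteLength R (M ⧸ X)) : Module.Finite R X := by
  have := hR.finitePresentation_of_isFiniteLength h
  have hfg := Module.FinitePresentation.fg_ker X.mkQ X.mkQ_surjective
  rw [Submodule.ker_mkQ] at hfg
  exact Module.Finite.iff_fg.mpr hfg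

theorem finiteSimpleCounts : FiniteSimpleCounts R := by
  have h2 : ∀ i : SimpleClass R, 2 ≤ i.card := fun i => by
    have := hR.finite_of_simple i.Rep inferInstance
    have := IsSimpleModule.nontrivial R i.Rep
    rw [SimpleClass.card_eq_natCard_rep]
    exact Finite.one_lt_card
  refine ⟨h2, fun n => ?_⟩
  -- `card` takes the value `0` on infinite simple modules, which condition (a) excludes; condition
  -- (c) speaks only of positive `n`.
  rcases Nat.eq_zero_or_pos n with rfl | hn
  · refine Set.finite_empty.subset fun i hi => ?_
    have := h2 i
    rw [show i.card = 0 from hi] at this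
    omega
  · exact hR.finite_card_eq n hn

/-- Restriction of scalars embeds the simple classes of `R ⧸ I` into those of `R` and preserves
cardinality. -/
theorem finiteSimpleCounts_quotient (I : Ideal R) [I.IsTwoSided] :
    FiniteSimpleCounts (R ⧸ I) := by
  have hs : ∀ i : SimpleClass (R ⧸ I),
      IsSimpleModule R (resMod I (ModuleCat.of (R ⧸ I) i.Rep)) := fun i =>
    ((resSemilinear (ModuleCat.of (R ⧸ I) i.Rep)).isSimpleModule_iff_of_bijective
      (resSemilinear_bijective _)).mpr (inferInstanceAs (IsSimpleModule (R ⧸ I) i.Rep))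
  let φ : SimpleClass (R ⧸ I) → SimpleClass R := fun i => SimpleClass.of _ (hs i)
  have hcard : ∀ i, (φ i).card = i.card := fun i => by
    rw [SimpleClass.card_of, SimpleClass.card_eq_natCard_rep]
    rfl
  have hinj : Function.Injective φ := fun i j hij => by
    obtain ⟨e⟩ := SimpleClass.exists_equiv_rep _ (hs i)
    obtain ⟨e'⟩ := SimpleClass.exists_equiv_rep _ (hs j)
    have hij' : SimpleClass.of _ (hs i) = SimpleClass.of _ (hs j) := hij
    rw [hij'] at e
    let k := e.trans e'.symm
    have k' : i.Rep ≃ₗ[R ⧸ I] j.Rep :=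
      LinearEquiv.ofBijective (unresMap (B := ModuleCat.of (R ⧸ I) i.Rep)
        (C := ModuleCat.of (R ⧸ I) j.Rep) k.toLinearMap) k.bijective
    rw [← SimpleClass.of_rep i, ← SimpleClass.of_rep j]
    exact SimpleClass.of_eq_of_equiv _ _ k'
  exact ⟨fun i => hcard i ▸ hR.finiteSimpleCounts.two_le_card (φ i), fun n =>
    ((hR.finiteSimpleCounts.finite_card_eq n).preimage hinj.injOn).subset
      fun i hi => (hcard i).trans hi⟩

/-- Such a submodule is the kernel of a map from `M` to a simple representative of bounded
cardinality. There are finitely many representatives, and finitely many maps to each because `M` is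
finitely generated. -/
theorem finite_coatoms (M : Type u) [AddCommGroup M] [Module R M] [Module.Finite R M] (n : ℕ) :
    {N : Submodule R M | IsCoatom N ∧ Nat.card (M ⧸ N) ≤ n}.Finite := by
  have hS : {i : SimpleClass R | i.card ≤ n}.Finite := by
    refine ((Set.finite_Iic n).biUnion fun m _ =>
      hR.finiteSimpleCounts.finite_card_eq m).subset fun i hi => ?_
    exact Set.mem_biUnion (show i.card ∈ Set.Iic n from hi) rfl
  have hfin : ∀ i : SimpleClass R, Finite (M →ₗ[R] i.Rep) := fun i => by
    have := hR.finite_of_simple i.Rep inferInstance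
    exact finite_linearMap R M i.Rep
  refine (hS.biUnion fun i _ =>
    Set.finite_range fun f : M →ₗ[R] i.Rep => LinearMap.ker f).subset ?_
  rintro N ⟨hN, hc⟩
  have hs : IsSimpleModule R (M ⧸ N) := isSimpleModule_iff_isCoatom.mpr hN
  obtain ⟨e⟩ := SimpleClass.exists_equiv_rep _ hs
  refine Set.mem_biUnion (x := SimpleClass.of _ hs) ?_ ⟨(e : _ →ₗ[R] _).comp N.mkQ, ?_⟩
  · change (SimpleClass.of _ hs).card ≤ n
    rwa [SimpleClass.card_of]
  · exact (LinearEquiv.ker_comp _ _).trans N.ker_mkQ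

/-- A proper `X` lies in a maximal `N` of index at most `n + 1`, and there are finitely many of
those. `N` is again finitely generated, and the index of `X` in `N` is smaller by a factor of at
least `2`, so the induction hypothesis applies to `N`. -/
theorem finite_submodules (n : ℕ) (M : Type u) [AddCommGroup M] [Module R M]
    [Module.Finite R M] :
    {X : Submodule R M | IsFiniteLength R (M ⧸ X) ∧ Nat.card (M ⧸ X) ≤ n}.Finite := by
  induction n generalizing M with
  | zero =>
    refine Set.finite_empty.subset fun X ⟨hX, hc⟩ => ?_
    have := hR.finite_of_isFiniteLength hX
    have : 0 < Nat.card (M ⧸ X) := Nat.card_pos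
    omega
  | succ n ih =>
    have hN : ∀ N ∈ {N : Submodule R M | IsCoatom N ∧ Nat.card (M ⧸ N) ≤ n + 1},
        ((fun X : Submodule R N => X.map N.subtype) ''
          {X | IsFiniteLength R (N ⧸ X) ∧ Nat.card (N ⧸ X) ≤ n}).Finite := fun N hN => by
      have hs : IsSimpleModule R (M ⧸ N) := isSimpleModule_iff_isCoatom.mpr hN.1
      have := hR.finite_of_finiteColength N (isFiniteLength_of_simple hs)
      exact (ih N).image _
    refine (((hR.finite_coatoms M (n + 1)).biUnion hN).union (Set.finite_singleton ⊤)).subset ?_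
    rintro X ⟨hX, hc⟩
    rcases eq_top_or_exists_le_coatom X with rfl | ⟨N, hN, hXN⟩
    · exact Or.inr rfl
    left
    have hfin := hR.finite_of_isFiniteLength hX
    have hs : IsSimpleModule R (M ⧸ N) := isSimpleModule_iff_isCoatom.mpr hN
    have hpos : 0 < Nat.card (M ⧸ X) := Nat.card_pos
    have hmul : Nat.card (N ⧸ X.comap N.subtype) * Nat.card (M ⧸ N) = Nat.card (M ⧸ X) :=
      AddSubgroup.relIndex_mul_index (H := X.toAddSubgroup) (K := N.toAddSubgroup) hXN
    have h2 : 1 < Nat.card (M ⧸ N) := by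
      have := hR.finite_of_simple _ hs
      have := IsSimpleModule.nontrivial R (M ⧸ N)
      exact Finite.one_lt_card
    have h1 : 0 < Nat.card (N ⧸ X.comap N.subtype) :=
      Nat.pos_of_mul_pos_right (hmul ▸ hpos)
    refine Set.mem_biUnion (x := N) ⟨hN, ?_⟩ ⟨X.comap N.subtype, ⟨?_, ?_⟩, ?_⟩
    · nlinarith
    · exact hX.of_injective (f := Submodule.mapQ _ X N.subtype le_rfl) (by
        rw [← LinearMap.ker_eq_bot, Submodule.ker_mapQ, Submodule.mkQ_map_self])
    · nlinarith
    · change (X.comap N.subtype).map N.subtype = X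
      rw [Submodule.map_comap_subtype, inf_eq_right.mpr hXN]

end IsLeftArithmetical

/-! ### Submodules and their chains modulo `I` -/

section Reduction

variable {R : Type u} [Ring R] (I : Ideal R) [I.IsTwoSided] {M : Type u} [AddCommGroup M]
  [Module R M]

/-- The reduction map `M → M/IM`, as a semilinear map. -/
def redMap : M →ₛₗ[Ideal.Quotient.mk I] ModI I M where
  toFun m := Submodule.Quotient.mk m
  map_add' _ _ := rfl
  map_smul' _ _ := rfl

variable {I}

theorem redMap_surjective : Function.Surjective (redMap I (M := M)) :=
  Submodule.Quotient.mk_surjective _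

theorem redMap_eq_zero {m : M} : redMap I m = 0 ↔ m ∈ I • (⊤ : Submodule R M) :=
  Submodule.Quotient.mk_eq_zero _

/-- The image in `M/IM` of a submodule of `M`. -/
def redSub (X : Submodule R M) : Submodule (R ⧸ I) (ModI I M) := X.map (redMap I)

/-- The preimage in `M` of a submodule of `M/IM`. -/
def preSub (Y : Submodule (R ⧸ I) (ModI I M)) : Submodule R M := Y.comap (redMap I)

theorem mem_preSub {Y : Submodule (R ⧸ I) (ModI I M)} {m : M} :
    m ∈ preSub Y ↔ redMap I m ∈ Y := Iff.rfl

theorem redSub_preSub (Y : Submodule (R ⧸ I) (ModI I M)) : redSub (preSub Y) = Y :=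
  Submodule.map_comap_eq_of_surjective redMap_surjective Y

theorem preSub_redSub (X : Submodule R M) :
    preSub (redSub X : Submodule (R ⧸ I) _) = X ⊔ I • (⊤ : Submodule R M) := by
  ext m
  rw [mem_preSub, redSub, Submodule.mem_map, Submodule.mem_sup]
  constructor
  · rintro ⟨x, hx, h⟩
    refine ⟨x, hx, m - x, ?_, add_sub_cancel _ _⟩
    rw [← redMap_eq_zero, map_sub, h, sub_self]
  · rintro ⟨x, hx, y, hy, rfl⟩
    exact ⟨x, hx, by rw [map_add, redMap_eq_zero.mpr hy, add_zero]⟩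

theorem preSub_top : preSub (⊤ : Submodule (R ⧸ I) (ModI I M)) = ⊤ := rfl

theorem redSub_mono {X X' : Submodule R M} (h : X ≤ X') :
    (redSub X : Submodule (R ⧸ I) (ModI I M)) ≤ redSub X' := Submodule.map_mono h

theorem redSub_top : (redSub (⊤ : Submodule R M) : Submodule (R ⧸ I) (ModI I M)) = ⊤ :=
  redSub_preSub ⊤

/-- The subquotient `preSub Y' / preSub Y` of `M` is `Y' / Y`. -/
def subquotSemilinear (Y Y' : Submodule (R ⧸ I) (ModI I M)) :
    subquot (preSub Y) (preSub Y') →ₛₗ[Ideal.Quotient.mk I] subquot Y Y' :=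
  ((Submodule.mapQ (preSub Y) Y (redMap I) le_rfl).comp
    (subquot (preSub Y) (preSub Y')).subtype).codRestrict (subquot Y Y') (by
      rintro ⟨_, m, hm, rfl⟩
      exact ⟨redMap I m, hm, rfl⟩)

theorem subquotSemilinear_bijective (Y Y' : Submodule (R ⧸ I) (ModI I M)) :
    Function.Bijective (subquotSemilinear Y Y') := by
  constructor
  · rw [injective_iff_map_eq_zero]
    rintro ⟨_, m, hm, rfl⟩ h
    have h' : Submodule.Quotient.mk (redMap I m) = (0 : ModI I M ⧸ Y) := congrArg Subtype.val h
    exact Subtype.ext ((Submodule.Quotient.mk_eq_zero _).mpr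
      ((Submodule.Quotient.mk_eq_zero Y).mp h'))
  · rintro ⟨_, y, hy, rfl⟩
    obtain ⟨m, rfl⟩ := redMap_surjective y
    exact ⟨⟨_, m, hy, rfl⟩, rfl⟩

/-- `preSub Y' / preSub Y ≃ Y' / Y` as `R`-modules. -/
noncomputable def subquotResEquiv (Y Y' : Submodule (R ⧸ I) (ModI I M)) :
    subquot (preSub Y) (preSub Y') ≃ₗ[R] resMod I (ModuleCat.of (R ⧸ I) (subquot Y Y')) :=
  let f : subquot (preSub Y) (preSub Y') →ₗ[R]
      resMod I (ModuleCat.of (R ⧸ I) (subquot Y Y')) :=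
    { toFun := fun x => subquotSemilinear Y Y' x
      map_add' := fun x y => map_add (subquotSemilinear Y Y') x y
      map_smul' := fun r x => (subquotSemilinear Y Y').map_smulₛₗ r x }
  LinearEquiv.ofBijective f (subquotSemilinear_bijective Y Y')

theorem isFiniteLength_quot_preSub {Y : Submodule (R ⧸ I) (ModI I M)} :
    IsFiniteLength R (M ⧸ preSub Y) ↔ IsFiniteLength (R ⧸ I) (ModI I M ⧸ Y) := by
  refine isFiniteLength_iff_of_bijective (Submodule.mapQ (preSub Y) Y (redMap I) le_rfl) ⟨?_, ?_⟩
  · rw [injective_iff_map_eq_zero]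
    intro m h
    obtain ⟨m, rfl⟩ := Submodule.Quotient.mk_surjective _ m
    exact (Submodule.Quotient.mk_eq_zero _).mpr ((Submodule.Quotient.mk_eq_zero Y).mp h)
  · intro y
    obtain ⟨y, rfl⟩ := Submodule.Quotient.mk_surjective _ y
    obtain ⟨m, rfl⟩ := redMap_surjective y
    exact ⟨Submodule.Quotient.mk m, rfl⟩

/-- The chain of submodules of `M/IM` attached to a submodule of `M`. -/
def chainOf (I : Ideal R) [I.IsTwoSided] (X : Submodule R M) (j : ℕ) :
    Submodule (R ⧸ I) (ModI I M) := redSub ((colon I)^[j] X)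

theorem chainOf_zero (X : Submodule R M) : chainOf I X 0 = redSub X := rfl

theorem le_iterate_colon (X : Submodule R M) (j : ℕ) : X ≤ (colon I)^[j] X := by
  induction j with
  | zero => exact le_rfl
  | succ j ih => exact ih.trans (by rw [Function.iterate_succ_apply']; exact le_colon _)

theorem iterate_colon_mono (X : Submodule R M) : Monotone fun j => (colon I)^[j] X :=
  monotone_nat_of_le_succ fun j => by
    rw [Function.iterate_succ_apply']
    exact le_colon _

theorem isFiniteLength_quot_of_le {X X' : Submodule R M} (h : X ≤ X')
    (hX : IsFiniteLength R (M ⧸ X)) : IsFiniteLength R (M ⧸ X') :=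
  hX.of_surjective (f := Submodule.factor h) (Submodule.factor_surjective h)

/-- Nakayama: a maximal submodule above `X` also contains `rad(R) M ⊇ IM`, hence `X + IM = M`. -/
theorem eq_top_of_redSub_eq_top [Module.Finite R M] (hIJ : I ≤ Ring.jacobson R)
    {X : Submodule R M} (h : (redSub X : Submodule (R ⧸ I) (ModI I M)) = ⊤) : X = ⊤ := by
  by_contra hne
  have hsup : X ⊔ I • (⊤ : Submodule R M) = ⊤ := by rw [← preSub_redSub, h, preSub_top]
  obtain ⟨N, hN, hXN⟩ := (eq_top_or_exists_le_coatom X).resolve_left hne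
  refine hN.1 (top_le_iff.mp (hsup ▸ sup_le hXN ?_))
  refine (Submodule.smul_mono hIJ le_rfl).trans ((Ring.jacobson_smul_top_le R M).trans ?_)
  exact sInf_le hN

/-- If `M/V` is nonzero it contains a simple submodule. Being killed by `I ⊆ rad(R)`, this lies in
`(V : I)/V`, which is zero. -/
theorem eq_top_of_colon_le (hIJ : I ≤ Ring.jacobson R) {V : Submodule R M}
    (hV : IsFiniteLength R (M ⧸ V)) (h : colon I V ≤ V) : V = ⊤ := by
  by_contra hne
  have hnt : Nontrivial (M ⧸ V) := Submodule.Quotient.nontrivial_iff.mpr hne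
  obtain ⟨_, _⟩ := isFiniteLength_iff_isNoetherian_isArtinian.mp hV
  obtain ⟨S, hS⟩ := IsAtomic.exists_atom (Submodule R (M ⧸ V))
  have hs : IsSimpleModule R S := isSimpleModule_iff_isAtom.mpr hS
  have hker : ∀ i ∈ I, ∀ s : S, i • s = 0 := fun i hi s => by
    have h1 : i • s ∈ Ring.jacobson R • (⊤ : Submodule R S) :=
      Submodule.smul_mem_smul (hIJ hi) trivial
    have h2 := Ring.jacobson_smul_top_le R S h1
    rwa [IsSimpleModule.jacobson_eq_bot, Submodule.mem_bot] at h2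
  refine hS.1 (eq_bot_iff.mpr fun s hs => ?_)
  obtain ⟨m, rfl⟩ := Submodule.Quotient.mk_surjective _ s
  refine (Submodule.Quotient.mk_eq_zero V).mpr (h fun i hi => ?_)
  exact (Submodule.Quotient.mk_eq_zero V).mp (congrArg Subtype.val (hker i hi ⟨_, hs⟩))

theorem isStableChain_chainOf (hIJ : I ≤ Ring.jacobson R) {X : Submodule R M}
    (hX : IsFiniteLength R (M ⧸ X)) : IsStableChain I M (chainOf I X) where
  mono := fun i j hij => redSub_mono (iterate_colon_mono X hij)
  finiteColength j := by
    rw [← isFiniteLength_quot_preSub, chainOf, preSub_redSub]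
    exact isFiniteLength_quot_of_le ((le_iterate_colon X j).trans le_sup_left) hX
  eventually_top := by
    obtain ⟨_, _⟩ := isFiniteLength_iff_isNoetherian_isArtinian.mp hX
    let f : ℕ →o Submodule R (M ⧸ X) :=
      ⟨fun j => ((colon I)^[j] X).map X.mkQ,
        fun i j hij => Submodule.map_mono (iterate_colon_mono X hij)⟩
    -- The iterates of `colon I` become stationary by the ascending chain condition in `M/X`; a
    -- stationary value `V` satisfies `(V : I) ⊆ V`, so it is `M`.
    obtain ⟨n, hn⟩ := monotone_stabilizes_iff_noetherian.mpr ‹IsNoetherian R (M ⧸ X)› f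
    have hfl : IsFiniteLength R (M ⧸ (colon I)^[n] X) :=
      isFiniteLength_quot_of_le (le_iterate_colon X n) hX
    have htop : (colon I)^[n] X = ⊤ := by
      refine eq_top_of_colon_le hIJ hfl fun m hm => ?_
      have h1 : X.mkQ m ∈ f (n + 1) := by
        refine Submodule.mem_map_of_mem ?_
        rw [Function.iterate_succ_apply']
        exact hm
      rw [← hn (n + 1) (Nat.le_succ n)] at h1
      obtain ⟨m', hm', h2⟩ := h1
      have h3 : m - m' ∈ X := (Submodule.Quotient.eq X).mp h2.symm
      have := add_mem (le_iterate_colon X n h3) hm'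
      rwa [sub_add_cancel] at this
    refine ⟨n, fun j hj => ?_⟩
    have h1 : (colon I)^[n] X ≤ (colon I)^[j] X := iterate_colon_mono X hj
    rw [htop, top_le_iff] at h1
    rw [chainOf, h1, redSub_top]

end Reduction

/-! ### Multiplicative invariants of modules annihilated by `I` -/

section MultInvariant

variable {R : Type u} [Ring R]

/-- A function on left `R`-modules that is multiplicative in short exact sequences of finite length
modules annihilated by `I`. -/
structure IsMultInvariant (I : Ideal R) {C : Type v} [CommMonoid C]
    (F : ModuleCat.{u} R → C) : Prop where
  eq_one : ∀ B : ModuleCat.{u} R, Subsingleton B → F B = 1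
  eq_mul : ∀ {A B D : ModuleCat.{u} R} (f : A →ₗ[R] B) (g : B →ₗ[R] D), Function.Injective f →
    Function.Surjective g → Function.Exact f g → IsFiniteLength R B →
    (∀ i ∈ I, ∀ b : B, i • b = 0) → F B = F A * F D

variable {I : Ideal R} {C : Type v} [CommMonoid C] {F : ModuleCat.{u} R → C}

theorem IsMultInvariant.congr (hF : IsMultInvariant I F) {A B : ModuleCat.{u} R} (e : A ≃ₗ[R] B)
    (hB : IsFiniteLength R B) (hIB : ∀ i ∈ I, ∀ b : B, i • b = 0) : F A = F B := by
  rw [hF.eq_mul (D := ModuleCat.of R PUnit) e.toLinearMap 0 e.injective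
    (Function.surjective_to_subsingleton _)
    (fun b => ⟨fun _ => ⟨e.symm b, e.apply_symm_apply b⟩, fun _ => rfl⟩) hB hIB,
    hF.eq_one (ModuleCat.of R PUnit) (inferInstanceAs (Subsingleton PUnit)), mul_one]

theorem isMultInvariant_of_moduleClass (I : Ideal R) :
    IsMultInvariant I fun B : ModuleCat.{u} R => Dir.of (moduleClass R B) where
  eq_one B _ := by rw [moduleClass_of_subsingleton, Dir.of_zero]
  eq_mul f g hf hg hfg hB _ := by rw [moduleClass_eq_add_of_exact hf hg hfg hB, Dir.of_add]

/-- `i (l ⊗ n) = (i l) ⊗ n = i ⊗ (l n) = 0`. -/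
theorem smul_idealTensor_eq_zero [I.IsTwoSided] {A : Type u} [AddCommGroup A] [Module R A]
    (h : ∀ i ∈ I, ∀ a : A, i • a = 0) : ∀ i ∈ I, ∀ x : IdealTensor I A, i • x = 0 := by
  intro i hi x
  induction x using IdealTensor.induction with
  | zero => exact smul_zero i
  | tmul l n =>
    rw [IdealTensor.smul_tmul]
    have := IdealTensor.tmul_smul (⟨i, hi⟩ : I) l.1 n
    rw [h l.1 l.2, IdealTensor.tmul_zero] at this
    exact this.symm
  | add x y hx hy => rw [smul_add, hx, hy, add_zero]

theorem subsingleton_idealTensor [I.IsTwoSided] (A : Type u) [AddCommGroup A] [Module R A]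
    [Subsingleton A] : Subsingleton (IdealTensor I A) :=
  subsingleton_of_forall_eq 0 fun x => by
    rw [← IdealTensor.map_id x]
    exact IdealTensor.map_eq_zero (Subsingleton.elim _ _) x

/-- Lets inductions over powers of `I` keep the module fixed in shape and replace the invariant `F`
by `F(I ⊗ -)`. -/
theorem IsMultInvariant.tensor [I.IsTwoSided] (hI : IsInvertibleIdeal I)
    (hF : IsMultInvariant I F) :
    IsMultInvariant I fun A => F (ModuleCat.of R (IdealTensor I A)) where
  eq_one B _ := hF.eq_one _ (subsingleton_idealTensor B)
  eq_mul f g hf hg hfg hB hIB := by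
    obtain ⟨h1, h2⟩ := hI.exact_map hf hg hfg
    exact hF.eq_mul (IdealTensor.map I f) (IdealTensor.map I g) h1
      (IdealTensor.map_surjective hg) h2 (hI.isFiniteLength hB) (smul_idealTensor_eq_zero hIB)

theorem IsMultInvariant.iterTensor [I.IsTwoSided] (hI : IsInvertibleIdeal I)
    (hF : IsMultInvariant I F) (k : ℕ) : IsMultInvariant I fun A => F (iterTensor I k A) := by
  induction k generalizing F with
  | zero => exact hF
  | succ k ih => exact ih (hF.tensor hI)

theorem isFiniteLength_iterTensor [I.IsTwoSided] (hI : IsInvertibleIdeal I) (k : ℕ)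
    {A : ModuleCat.{u} R} (hA : IsFiniteLength R A) : IsFiniteLength R (iterTensor I k A) := by
  induction k with
  | zero => exact hA
  | succ k ih => exact hI.isFiniteLength ih

theorem IsMultInvariant.prod {ι : Type*} {s : Finset ι} {F : ι → ModuleCat.{u} R → C}
    (hF : ∀ k ∈ s, IsMultInvariant I (F k)) : IsMultInvariant I fun A => ∏ k ∈ s, F k A where
  eq_one B hB := Finset.prod_eq_one fun k hk => (hF k hk).eq_one B hB
  eq_mul f g hf hg hfg hB hIB := by
    rw [← Finset.prod_mul_distrib]
    exact Finset.prod_congr rfl fun k hk => (hF k hk).eq_mul f g hf hg hfg hB hIB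

/-- Projective `R ⧸ I`-modules lift along surjections of `R`-modules annihilated by `I`. -/
theorem exists_lift_of_projective [I.IsTwoSided] (Q : ModuleCat.{u} (R ⧸ I))
    (hQ : Module.Projective (R ⧸ I) Q) {A B : Type u} [AddCommGroup A] [Module R A]
    [AddCommGroup B] [Module R B] (g : A →ₗ[R] B) (hg : Function.Surjective g)
    (hA : ∀ i ∈ I, ∀ a : A, i • a = 0) (h : resMod I Q →ₗ[R] B) :
    ∃ h' : resMod I Q →ₗ[R] A, g.comp h' = h := by
  have hB : ∀ i ∈ I, ∀ b : B, i • b = 0 := fun i hi b => by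
    obtain ⟨a, rfl⟩ := hg b
    rw [← map_smul, hA i hi, map_zero]
  have tA : Module.IsTorsionBySet R A I := fun a i => hA i.1 i.2 a
  have tB : Module.IsTorsionBySet R B I := fun b i => hB i.1 i.2 b
  let _ : Module (R ⧸ I) A := tA.module
  let _ : Module (R ⧸ I) B := tB.module
  let g₁ : A →ₗ[R ⧸ I] B :=
    { toFun := g
      map_add' := map_add g
      map_smul' := fun r a => by
        obtain ⟨r, rfl⟩ := Ideal.Quotient.mk_surjective r
        exact g.map_smul r a }
  let h₁ : Q →ₗ[R ⧸ I] B :=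
    { toFun := fun q => h q
      map_add' := fun x y => h.map_add x y
      map_smul' := fun r a => by
        obtain ⟨r, rfl⟩ := Ideal.Quotient.mk_surjective r
        exact h.map_smul r a }
  obtain ⟨k, hk⟩ := Module.projective_lifting_property g₁ h₁ hg
  refine ⟨{ toFun := fun q => k q
            map_add' := fun x y => k.map_add x y
            map_smul' := fun r a => k.map_smul (Ideal.Quotient.mk I r) a }, ?_⟩
  exact LinearMap.ext fun q => LinearMap.congr_fun hk q

/-- `Hom(Q, -)` is exact on modules killed by `I`, since `Q` is projective over `R ⧸ I`. Lagrange's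
formula for `Nat.card` holds without finiteness. -/
theorem isMultInvariant_card_hom [I.IsTwoSided] (Q : ModuleCat.{u} (R ⧸ I))
    (hQ : Module.Projective (R ⧸ I) Q) :
    IsMultInvariant I fun B : ModuleCat.{u} R => Nat.card (resMod I Q →ₗ[R] B) where
  eq_one B _ := by
    have : Unique (resMod I Q →ₗ[R] B) := LinearMap.uniqueOfRight
    exact Nat.card_unique
  eq_mul {A B C} f g hf hg hfg _ hIB := by
    let φ : (resMod I Q →ₗ[R] B) →+ (resMod I Q →ₗ[R] C) :=
      { toFun := fun h => g.comp h
        map_zero' := g.comp_zero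
        map_add' := fun _ _ => LinearMap.comp_add _ _ _ }
    have hφ : Function.Surjective φ := exists_lift_of_projective Q hQ g hg hIB
    have hker : Nat.card φ.ker = Nat.card (resMod I Q →ₗ[R] A) := by
      refine (Nat.card_congr (Equiv.ofBijective (fun h : resMod I Q →ₗ[R] A =>
        (⟨f.comp h, LinearMap.ext fun q => hfg.apply_apply_eq_zero (h q)⟩ : φ.ker))
        ⟨fun h h' hh => ?_, fun ⟨h, hh⟩ => ?_⟩)).symm
      · exact LinearMap.ext fun q => hf (LinearMap.congr_fun (congrArg Subtype.val hh) q)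
      · have hr : ∀ q, h q ∈ LinearMap.range f := fun q =>
          (hfg (h q)).mp (LinearMap.congr_fun hh q)
        refine ⟨(LinearEquiv.ofInjective f hf).symm.toLinearMap.comp (h.codRestrict _ hr), ?_⟩
        refine Subtype.ext (LinearMap.ext fun q => ?_)
        exact congrArg Subtype.val
          ((LinearEquiv.ofInjective f hf).apply_symm_apply ⟨h q, hr q⟩)
    rw [AddSubgroup.card_eq_card_quotient_mul_card_addSubgroup φ.ker, hker, mul_comm,
      Nat.card_congr (QuotientAddGroup.quotientKerEquivOfSurjective φ hφ).toEquiv]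

end MultInvariant

/-! ### The subquotient `(X : I) / X` -/

section ColonQuotient

variable {R : Type u} [Ring R] {M : Type u} [AddCommGroup M] [Module R M]

/-- The map `V / U → V' / U'` for `U ≤ U'` and `V ≤ V'`. -/
def subquotMap {U V U' V' : Submodule R M} (hU : U ≤ U') (hV : V ≤ V') :
    subquot U V →ₗ[R] subquot U' V' :=
  ((Submodule.factor hU).comp (subquot U V).subtype).codRestrict _ (by
    rintro ⟨_, v, hv, rfl⟩
    exact ⟨v, hV hv, rfl⟩)

theorem subquotMap_eq_zero {U V U' V' : Submodule R M} (hU : U ≤ U') (hV : V ≤ V') {v : M}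
    (hv : v ∈ V) : subquotMap hU hV ⟨U.mkQ v, v, hv, rfl⟩ = 0 ↔ v ∈ U' :=
  Subtype.ext_iff.trans (Submodule.Quotient.mk_eq_zero U')

theorem subquotMap_injective {U V U' V' : Submodule R M} (hU : U ≤ U') (hV : V ≤ V')
    (h : U' ⊓ V ≤ U) : Function.Injective (subquotMap hU hV) := by
  rw [injective_iff_map_eq_zero]
  rintro ⟨_, v, hv, rfl⟩ h0
  rw [subquotMap_eq_zero hU hV hv] at h0
  exact Subtype.ext ((Submodule.Quotient.mk_eq_zero U).mpr (h ⟨h0, hv⟩))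

theorem subquotMap_surjective {U V U' V' : Submodule R M} (hU : U ≤ U') (hV : V ≤ V')
    (h : V' ≤ V ⊔ U') : Function.Surjective (subquotMap hU hV) := by
  rintro ⟨_, v', hv', rfl⟩
  obtain ⟨v, hv, u, hu, rfl⟩ := Submodule.mem_sup.mp (h hv')
  refine ⟨⟨U.mkQ v, v, hv, rfl⟩, Subtype.ext ((Submodule.Quotient.eq U').mpr ?_)⟩
  change v - (v + u) ∈ U'
  rw [sub_add_cancel_left]
  exact neg_mem hu

theorem isFiniteLength_subquot {U : Submodule R M} (V : Submodule R M)
    (h : IsFiniteLength R (M ⧸ U)) : IsFiniteLength R (subquot U V) :=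
  h.of_injective (subquot U V).injective_subtype

theorem exact_subquot_quot {U V : Submodule R M} (h : U ≤ V) :
    Function.Exact (subquot U V).subtype (Submodule.factor h) := by
  intro x
  obtain ⟨m, rfl⟩ := Submodule.Quotient.mk_surjective _ x
  constructor
  · intro hm
    exact ⟨⟨_, m, (Submodule.Quotient.mk_eq_zero V).mp hm, rfl⟩, rfl⟩
  · rintro ⟨⟨_, v, hv, rfl⟩, hv'⟩
    rw [← hv']
    exact (Submodule.Quotient.mk_eq_zero V).mpr hv

theorem moduleClass_quot_eq_add {U V : Submodule R M} (h : U ≤ V)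
    (hU : IsFiniteLength R (M ⧸ U)) :
    moduleClass R (M ⧸ U) = moduleClass R (subquot U V) + moduleClass R (M ⧸ V) :=
  moduleClass_eq_add_of_exact (subquot U V).injective_subtype (Submodule.factor_surjective h)
    (exact_subquot_quot h) hU

theorem smul_subquot_eq_zero {I : Ideal R} {U V : Submodule R M} (h : I • V ≤ U) :
    ∀ i ∈ I, ∀ x : subquot U V, i • x = 0 := by
  rintro i hi ⟨_, v, hv, rfl⟩
  exact Subtype.ext ((Submodule.Quotient.mk_eq_zero U).mpr (h (Submodule.smul_mem_smul hi hv)))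

variable {I : Ideal R} [I.IsTwoSided]

/-- The exact sequence `0 → I (X : I²) / I (X : I) → (X : I) / X → ((X : I) + IM) / (X + IM) → 0`. -/
theorem exact_colon_quot [Module.Projective R M] (hI : IsInvertibleIdeal I) (X : Submodule R M) :
    ∃ (f : subquot (I • colon I X) (I • colon I (colon I X)) →ₗ[R] subquot X (colon I X))
      (g : subquot X (colon I X) →ₗ[R]
        subquot (preSub (redSub X : Submodule (R ⧸ I) (ModI I M)))
          (preSub (redSub (colon I X) : Submodule (R ⧸ I) (ModI I M)))),
      Function.Injective f ∧ Function.Surjective g ∧ Function.Exact f g := by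
  rw [preSub_redSub, preSub_redSub]
  refine ⟨subquotMap (smul_colon_le X) (smul_colon_le (colon I X)),
    subquotMap le_sup_left le_sup_left, subquotMap_injective _ _ ?_,
    subquotMap_surjective _ _ ?_, ?_⟩
  -- The kernel of `f` comes from `X ∩ (X : I) ∩ IM`, which lies in `X ∩ IM = I (X : I)`.
  · rw [hI.smul_colon_eq_inf, hI.smul_colon_eq_inf]
    exact inf_le_inf_left X inf_le_right
  · exact sup_le_sup_left le_sup_right _
  · rintro ⟨_, v, hv, rfl⟩
    rw [subquotMap_eq_zero _ _ hv]
    constructor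
    · intro h
      obtain ⟨x, hx, y, hy, rfl⟩ := Submodule.mem_sup.mp h
      -- Modular law: `y = v - x` lies in `(X : I) ∩ IM = I (X : I²)`.
      have hy' : y ∈ I • colon I (colon I X) := by
        rw [hI.smul_colon_eq_inf]
        refine ⟨?_, hy⟩
        have := sub_mem hv (le_colon X hx)
        rwa [add_sub_cancel_left] at this
      refine ⟨⟨_, y, hy', rfl⟩, Subtype.ext ((Submodule.Quotient.eq X).mpr ?_)⟩
      change y - (x + y) ∈ X
      rw [sub_add_cancel_right]
      exact neg_mem hx
    · rintro ⟨⟨_, y, hy, rfl⟩, h⟩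
      have h1 : y - v ∈ X := (Submodule.Quotient.eq X).mp (congrArg Subtype.val h)
      have h2 : y ∈ I • (⊤ : Submodule R M) := Submodule.smul_mono le_rfl le_top hy
      have := sub_mem (Submodule.mem_sup_right (S := X) h2) (Submodule.mem_sup_left h1)
      rwa [sub_sub_cancel] at this

/-- Ensures that recovering `X` from `(X : I)` and its image in `M/IM` stays within finite colength.
-/
theorem isFiniteLength_quot_of_colon [Module.Projective R M] (hI : IsInvertibleIdeal I)
    {X : Submodule R M} (h₁ : IsFiniteLength R (M ⧸ colon I X))
    (h₀ : IsFiniteLength (R ⧸ I) (ModI I M ⧸ (redSub X : Submodule (R ⧸ I) (ModI I M)))) :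
    IsFiniteLength R (M ⧸ X) := by
  obtain ⟨f, g, -, -, hfg⟩ := exact_colon_quot hI X
  obtain ⟨e⟩ := hI.nonempty_subquot_equiv (le_colon (I := I) (colon I X))
  refine isFiniteLength_of_exact (exact_subquot_quot (le_colon X))
    (isFiniteLength_of_exact hfg ?_ ?_) h₁
  · exact e.isFiniteLength (hI.isFiniteLength (isFiniteLength_subquot _ h₁))
  · exact isFiniteLength_subquot _ (isFiniteLength_quot_preSub.mpr h₀)

/-- In `exact_colon_quot` the right term is `Y_1/Y_0` and the left one is `I ⊗ ((X : I²)/(X : I))`.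
So induct on `n`, passing to `(X : I)`, whose chain is shifted by one, and to the invariant `F(I ⊗
-)`. -/
theorem IsMultInvariant.colon_quot_eq_prod [Module.Finite R M] [Module.Projective R M]
    (hI : IsInvertibleIdeal I) (hIJ : I ≤ Ring.jacobson R) {C : Type v} [CommMonoid C]
    {F : ModuleCat.{u} R → C} (hF : IsMultInvariant I F) {X : Submodule R M}
    (hX : IsFiniteLength R (M ⧸ X)) (n : ℕ) (hn : ∀ j, n ≤ j → chainOf I X j = ⊤) :
    F (ModuleCat.of R (subquot X (colon I X))) =
      ∏ k ∈ Finset.range n, F (_root_.iterTensor I k (ModuleCat.of R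
        (subquot (preSub (chainOf I X k)) (preSub (chainOf I X (k + 1)))))) := by
  induction n generalizing F X with
  | zero =>
    rw [Finset.prod_range_zero]
    refine hF.eq_one _ (subsingleton_of_forall_eq 0 ?_)
    rintro ⟨_, v, hv, rfl⟩
    have hXtop : X = ⊤ := eq_top_of_redSub_eq_top hIJ (hn 0 le_rfl)
    exact Subtype.ext ((Submodule.Quotient.mk_eq_zero X).mpr (hXtop ▸ Submodule.mem_top))
  | succ n ih =>
    obtain ⟨f, g, hf, hg, hfg⟩ := exact_colon_quot hI X
    obtain ⟨e⟩ := hI.nonempty_subquot_equiv (le_colon (I := I) (colon I X))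
    have hX₁ : IsFiniteLength R (M ⧸ colon I X) := isFiniteLength_quot_of_le (le_colon X) hX
    rw [Finset.prod_range_succ',
      hF.eq_mul (A := ModuleCat.of R (subquot (I • colon I X) (I • colon I (colon I X))))
        (B := ModuleCat.of R (subquot X (colon I X)))
        (D := ModuleCat.of R (subquot (preSub (redSub X : Submodule (R ⧸ I) (ModI I M)))
          (preSub (redSub (colon I X) : Submodule (R ⧸ I) (ModI I M)))))
        f g hf hg hfg (isFiniteLength_subquot _ hX) (smul_subquot_eq_zero (smul_colon_le X))]
    congr 1
    rw [← hF.congr (A := ModuleCat.of R (IdealTensor I (subquot (colon I X)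
        (colon I (colon I X)))))
      (B := ModuleCat.of R (subquot (I • colon I X) (I • colon I (colon I X)))) e
      (e.isFiniteLength (hI.isFiniteLength (isFiniteLength_subquot _ hX₁)))
      (smul_subquot_eq_zero (Submodule.smul_mono le_rfl (smul_colon_le _)))]
    exact ih (hF.tensor hI) hX₁ fun j hj => hn (j + 1) (Nat.succ_le_succ hj)

end ColonQuotient

/-! ### Counting submodules with a given chain -/

theorem card_linearMap_congr {R A A' B B' : Type*} [Ring R] [AddCommGroup A] [Module R A]
    [AddCommGroup A'] [Module R A'] [AddCommGroup B] [Module R B] [AddCommGroup B'] [Module R B']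
    (e : A ≃ₗ[R] A') (e' : B ≃ₗ[R] B') : Nat.card (A →ₗ[R] B) = Nat.card (A' →ₗ[R] B') :=
  Nat.card_congr (LinearEquiv.arrowCongrAddEquiv e e').toEquiv

section Fibre

variable {R : Type u} [Ring R] {I : Ideal R} [I.IsTwoSided] {M : Type u} [AddCommGroup M]
  [Module R M]

/-- The inclusion of a submodule of `M/IM`, as an `R`-linear map. -/
noncomputable def resIncl (Y : Submodule (R ⧸ I) (ModI I M)) :
    resMod I (ModuleCat.of (R ⧸ I) Y) →ₗ[R] ModI I M where
  toFun y := (show Y from y).1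
  map_add' _ _ := rfl
  map_smul' _ _ := rfl

/-- The `R`-linear lifts of the inclusion `Y ⊆ M/IM` to `M/IV`. -/
def Lifts (Y : Submodule (R ⧸ I) (ModI I M)) (V : Submodule R M) : Type u :=
  {s : resMod I (ModuleCat.of (R ⧸ I) Y) →ₗ[R] M ⧸ (I • V) //
    (Submodule.factor (Submodule.smul_mono le_rfl le_top : I • V ≤ I • ⊤)).comp s = resIncl Y}

variable [Module.Projective R M] (hI : IsInvertibleIdeal I)
include hI

/-- The condition `(X : I) = V` means `X ∩ IM = IV`. So `X/IV` maps isomorphically onto `Y`, and the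
inverse isomorphism is a lift `s`; conversely `X` is the preimage in `M` of the image of `s`. -/
theorem card_fibre_eq_card_lifts (Y : Submodule (R ⧸ I) (ModI I M)) (V : Submodule R M) :
    Nat.card {X : Submodule R M // colon I X = V ∧ redSub X = Y} = Nat.card (Lifts Y V) := by
  let Φ : Lifts Y V → {X : Submodule R M // colon I X = V ∧ redSub X = Y} := fun s => by
    have hs : ∀ y : Y, ∃ m, s.1 y = Submodule.Quotient.mk m ∧ redMap I m = y.1 := fun y => by
      obtain ⟨m, hm⟩ := Submodule.Quotient.mk_surjective _ (s.1 y)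
      refine ⟨m, hm.symm, ?_⟩
      have h : Submodule.factor (Submodule.smul_mono le_rfl le_top : I • V ≤ I • ⊤) (s.1 y) =
        resIncl Y y := LinearMap.congr_fun s.2 y
      rw [← hm] at h
      exact h
    let X : Submodule R M :=
      { carrier := {m | ∃ y : Y, redMap I m = y.1 ∧ s.1 y = Submodule.Quotient.mk m}
        add_mem' := by
          rintro m m' ⟨y, h1, h2⟩ ⟨y', h1', h2'⟩
          refine ⟨y + y', ?_, ?_⟩
          · rw [map_add, h1, h1']
            rfl
          · rw [Submodule.Quotient.mk_add, ← h2, ← h2']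
            exact map_add s.1 y y'
        zero_mem' := ⟨0, map_zero _, map_zero s.1⟩
        smul_mem' := by
          rintro r m ⟨y, h1, h2⟩
          refine ⟨Ideal.Quotient.mk I r • y, ?_, ?_⟩
          · rw [map_smulₛₗ, h1]
            rfl
          · rw [Submodule.Quotient.mk_smul, ← h2]
            exact map_smul s.1 r y }
    have hinf : X ⊓ I • (⊤ : Submodule R M) = I • V := by
      ext m
      constructor
      · rintro ⟨⟨y, h1, h2⟩, hm⟩
        have hy : y = 0 := Subtype.ext (h1.symm.trans (redMap_eq_zero.mpr hm))
        rw [← Submodule.Quotient.mk_eq_zero (I • V), ← h2, hy]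
        exact map_zero s.1
      · intro hm
        have hm' : m ∈ I • (⊤ : Submodule R M) := Submodule.smul_mono le_rfl le_top hm
        refine ⟨⟨0, redMap_eq_zero.mpr hm', ?_⟩, hm'⟩
        rw [(Submodule.Quotient.mk_eq_zero (I • V)).mpr hm]
        exact map_zero s.1
    refine ⟨X, ?_, ?_⟩
    · rw [← colon_inf_smul_top, hinf, hI.colon_smul]
    · refine le_antisymm ?_ ?_
      · rintro _ ⟨m, ⟨y, h1, -⟩, rfl⟩
        rw [h1]
        exact y.2
      · intro y hy
        obtain ⟨m, h1, h2⟩ := hs ⟨y, hy⟩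
        exact ⟨m, ⟨⟨y, hy⟩, h2, h1⟩, h2⟩
  have hΦ : ∀ (s : Lifts Y V) (m : M),
      m ∈ (Φ s).1 ↔ ∃ y : Y, redMap I m = y.1 ∧ s.1 y = Submodule.Quotient.mk m :=
    fun s m => Iff.rfl
  refine (Nat.card_congr (Equiv.ofBijective Φ ⟨fun s t hst => ?_, fun X => ?_⟩)).symm
  · refine Subtype.ext (LinearMap.ext fun y => ?_)
    obtain ⟨m, hm⟩ := Submodule.Quotient.mk_surjective _ (s.1 y)
    have h1 : redMap I m = (show Y from y).1 := by
      have := LinearMap.congr_fun s.2 y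
      rw [LinearMap.comp_apply, ← hm] at this
      exact this
    have h2 : m ∈ (Φ s).1 := ⟨y, h1, hm.symm⟩
    rw [hst, hΦ] at h2
    obtain ⟨y', h3, h4⟩ := h2
    have : y' = y := Subtype.ext (h3.symm.trans h1)
    rw [this] at h4
    rw [← hm, ← h4]
  · obtain ⟨X, hX, hXY⟩ := X
    have hinf : X ⊓ I • (⊤ : Submodule R M) = I • V := by rw [← hI.smul_colon_eq_inf, hX]
    have hmem : ∀ x : X, redMap I x.1 ∈ Y := fun x => hXY ▸ ⟨x.1, x.2, rfl⟩
    have hex : ∀ y : Y, ∃ x : X, redMap I x.1 = y.1 := fun ⟨y, hy⟩ => by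
      rw [← hXY] at hy
      obtain ⟨x, hx, h⟩ := hy
      exact ⟨⟨x, hx⟩, h⟩
    have heq : ∀ x x' : X, redMap I x.1 = redMap I x'.1 →
        (Submodule.Quotient.mk x.1 : M ⧸ I • V) = Submodule.Quotient.mk x'.1 := fun x x' h => by
      rw [Submodule.Quotient.eq, ← hinf]
      exact ⟨sub_mem x.2 x'.2, redMap_eq_zero.mp (by rw [map_sub, h, sub_self])⟩
    choose σ hσ using hex
    let s : resMod I (ModuleCat.of (R ⧸ I) Y) →ₗ[R] M ⧸ (I • V) :=
      { toFun := fun y => Submodule.Quotient.mk (σ y).1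
        map_add' := fun y y' => heq (σ (y + y')) (σ y + σ y') (by
          refine (hσ _).trans ?_
          change _ = redMap I ((σ y).1 + (σ y').1)
          rw [map_add]
          exact (congrArg₂ (· + ·) (hσ y) (hσ y')).symm)
        map_smul' := fun r y => heq (σ (r • y)) (r • σ y) (by
          refine (hσ _).trans ?_
          change _ = redMap I (r • (σ y).1)
          rw [map_smulₛₗ]
          exact (congrArg (Ideal.Quotient.mk I r • ·) (hσ y)).symm) }
    refine ⟨⟨s, LinearMap.ext fun y => hσ y⟩, Subtype.ext (Submodule.ext fun m => ?_)⟩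
    refine (hΦ _ m).trans ⟨?_, ?_⟩
    · rintro ⟨y, h1, h2⟩
      have h3 : (σ y).1 - m ∈ I • V := (Submodule.Quotient.eq (I • V)).mp h2
      rw [← hinf] at h3
      have := sub_mem (σ y).2 h3.1
      rwa [sub_sub_cancel] at this
    · intro hm
      refine ⟨⟨redMap I m, hmem ⟨m, hm⟩⟩, rfl, heq _ ⟨m, hm⟩ (hσ _)⟩

/-- A lift exists: `V/IV` is killed by `I` and maps onto the image of `V` in `M/IM`, which contains
`Y`. The remaining lifts differ from it by homomorphisms. -/
theorem card_lifts (Y : Submodule (R ⧸ I) (ModI I M)) (hY : Module.Projective (R ⧸ I) Y)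
    (V : Submodule R M) (hYV : Y ≤ redSub V) :
    Nat.card (Lifts Y V) = Nat.card (resMod I (ModuleCat.of (R ⧸ I) Y) →ₗ[R]
      subquot (I • V) (I • colon I V)) := by
  let π : (M ⧸ I • V) →ₗ[R] ModI I M :=
    Submodule.factor (Submodule.smul_mono le_rfl le_top : I • V ≤ I • ⊤)
  let g : subquot (I • V) V →ₗ[R] (V.map (I • (⊤ : Submodule R M)).mkQ) :=
    subquotMap (Submodule.smul_mono le_rfl le_top) le_rfl
  have hmem : ∀ y : resMod I (ModuleCat.of (R ⧸ I) Y),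
      resIncl Y y ∈ V.map (I • (⊤ : Submodule R M)).mkQ := fun y => by
    obtain ⟨v, hv, h⟩ := hYV (show Y from y).2
    exact ⟨v, hv, h⟩
  obtain ⟨s', hs'⟩ := exists_lift_of_projective (ModuleCat.of (R ⧸ I) Y) hY g
    (subquotMap_surjective _ _ le_sup_left) (smul_subquot_eq_zero le_rfl)
    ((resIncl Y).codRestrict _ hmem)
  let s₀ : resMod I (ModuleCat.of (R ⧸ I) Y) →ₗ[R] M ⧸ (I • V) :=
    (subquot (I • V) V).subtype.comp s'
  have hs₀ : π.comp s₀ = resIncl Y := LinearMap.ext fun y =>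
    congrArg Subtype.val (LinearMap.congr_fun hs' y)
  have hK : ∀ x ∈ subquot (I • V) (I • colon I V), π x = 0 := by
    rintro _ ⟨m, hm, rfl⟩
    exact (Submodule.Quotient.mk_eq_zero _).mpr (Submodule.smul_mono le_rfl le_top hm)
  refine (Nat.card_congr (Equiv.ofBijective (fun t => (⟨s₀ + (Submodule.subtype _).comp t, ?_⟩ :
    Lifts Y V)) ⟨fun t t' h => ?_, fun s => ?_⟩)).symm
  · refine LinearMap.ext fun y => ?_
    have h1 := LinearMap.congr_fun hs₀ y
    have h2 := hK _ (t y).2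
    change π (s₀ y + (t y).1) = _
    rw [map_add, h2, add_zero]
    exact h1
  · refine LinearMap.ext fun y => Subtype.ext ?_
    exact add_left_cancel (LinearMap.congr_fun (congrArg Subtype.val h) y)
  -- A difference of lifts takes values in the part of `IM/IV` killed by `I`, which comes from `IM ∩
  -- (IV : I) = IM ∩ V = I (V : I)`.
  · have hd : ∀ y, s.1 y - s₀ y ∈ subquot (I • V) (I • colon I V) := fun y => by
      have h0 : π (s.1 y - s₀ y) = 0 := by
        rw [map_sub]
        have h1 := LinearMap.congr_fun s.2 y
        have h2 := LinearMap.congr_fun hs₀ y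
        exact sub_eq_zero.mpr (h1.trans h2.symm)
      have hkill : ∀ i ∈ I, i • (s.1 y - s₀ y) = 0 := fun i hi => by
        rw [smul_sub, ← map_smul, ← map_smul, smul_resMod_eq_zero _ hi, map_zero, map_zero,
          sub_zero]
      obtain ⟨m, hm⟩ := Submodule.Quotient.mk_surjective _ (s.1 y - s₀ y)
      rw [← hm] at h0 hkill ⊢
      refine ⟨m, ?_, rfl⟩
      rw [hI.smul_colon_eq_inf]
      refine ⟨?_, (Submodule.Quotient.mk_eq_zero _).mp h0⟩
      rw [← hI.colon_smul V]
      exact fun i hi => (Submodule.Quotient.mk_eq_zero _).mp (hkill i hi)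
    refine ⟨(s.1 - s₀).codRestrict _ hd, Subtype.ext (LinearMap.ext fun y => ?_)⟩
    exact add_sub_cancel (s₀ y) (s.1 y)

theorem card_fibre (Y : Submodule (R ⧸ I) (ModI I M)) (hY : Module.Projective (R ⧸ I) Y)
    (V : Submodule R M) (hYV : Y ≤ redSub V) :
    Nat.card {X : Submodule R M // colon I X = V ∧ redSub X = Y} =
      Nat.card (resMod I (ModuleCat.of (R ⧸ I) Y) →ₗ[R]
        IdealTensor I (subquot V (colon I V))) := by
  obtain ⟨e⟩ := hI.nonempty_subquot_equiv (le_colon (I := I) V)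
  rw [card_fibre_eq_card_lifts hI, card_lifts hI Y hY V hYV]
  exact card_linearMap_congr (LinearEquiv.refl R _) e.symm

end Fibre

/-! ### The change of variable -/

section Bracket

variable {R : Type u} [Ring R] {I : Ideal R}

theorem IsMultInvariant.smul {c : ModuleCat.{u} R → ℂ} {F : ModuleCat.{u} R → Dir R}
    (hc : IsMultInvariant I c) (hF : IsMultInvariant I F) :
    IsMultInvariant I fun A => c A • F A where
  eq_one B hB := by rw [hc.eq_one B hB, hF.eq_one B hB, one_smul]
  eq_mul f g hf hg hfg hB hIB := by
    rw [hc.eq_mul f g hf hg hfg hB hIB, hF.eq_mul f g hf hg hfg hB hIB, smul_mul_smul_comm]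

theorem IsMultInvariant.inv {c : ModuleCat.{u} R → ℂ} (hc : IsMultInvariant I c) :
    IsMultInvariant I fun A => (c A)⁻¹ where
  eq_one B hB := by rw [hc.eq_one B hB, inv_one]
  eq_mul f g hf hg hfg hB hIB := by rw [hc.eq_mul f g hf hg hfg hB hIB, mul_inv]

theorem IsMultInvariant.natCast {c : ModuleCat.{u} R → ℕ} (hc : IsMultInvariant I c) :
    IsMultInvariant I fun A => (c A : ℂ) where
  eq_one B hB := by rw [hc.eq_one B hB, Nat.cast_one]
  eq_mul f g hf hg hfg hB hIB := by rw [hc.eq_mul f g hf hg hfg hB hIB, Nat.cast_mul]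

variable [I.IsTwoSided]

/-- The factor `|Hom(Q, I^k ⊗ A)| [I^k ⊗ A]`, in terms of iterated tensor products. -/
noncomputable def homFactor (Q : ModuleCat.{u} (R ⧸ I)) (k : ℕ) (A : ModuleCat.{u} R) : Dir R :=
  (Nat.card (resMod I Q →ₗ[R] iterTensor I k A) : ℂ) • Dir.of (moduleClass R (iterTensor I k A))

/-- `⟨P, -⟩_j^I` as a function of `R`-modules, in terms of iterated tensor products. -/
noncomputable def bracketRes (P : ℕ → ModuleCat.{u} (R ⧸ I)) (j : ℕ) (A : ModuleCat.{u} R) :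
    Dir R :=
  ((Nat.card (resMod I (P j) →ₗ[R] A) : ℂ)⁻¹) •
    ∏ k ∈ Finset.range (j + 1), homFactor (P (j - k)) k A

theorem isMultInvariant_homFactor (hI : IsInvertibleIdeal I) {Q : ModuleCat.{u} (R ⧸ I)}
    (hQ : Module.Projective (R ⧸ I) Q) (k : ℕ) : IsMultInvariant I (homFactor Q k) :=
  ((isMultInvariant_card_hom Q hQ).natCast.iterTensor hI k).smul
    ((isMultInvariant_of_moduleClass I).iterTensor hI k)

theorem isMultInvariant_bracketRes (hI : IsInvertibleIdeal I) {P : ℕ → ModuleCat.{u} (R ⧸ I)}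
    (hP : ∀ j, Module.Projective (R ⧸ I) (P j)) (j : ℕ) :
    IsMultInvariant I (bracketRes P j) :=
  (isMultInvariant_card_hom (P j) (hP j)).natCast.inv.smul
    (IsMultInvariant.prod fun k _ => isMultInvariant_homFactor hI (hP (j - k)) k)

theorem card_hom_resMod (Q B : ModuleCat.{u} (R ⧸ I)) :
    Nat.card (resMod I Q →ₗ[R] resMod I B) = Nat.card (Q →ₗ[R ⧸ I] B) :=
  Nat.card_congr ⟨unresMap, resMap, fun _ => rfl, fun _ => rfl⟩

theorem bracket_eq_bracketRes (hI : IsInvertibleIdeal I) (P : ℕ → ModuleCat.{u} (R ⧸ I)) (j : ℕ)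
    {B : ModuleCat.{u} (R ⧸ I)} (hB : IsFiniteLength (R ⧸ I) B) :
    bracket I P j B = bracketRes P j (resMod I B) := by
  rw [bracket, bracketRes, card_hom_resMod]
  congr 1
  refine Finset.prod_congr rfl fun k _ => ?_
  obtain ⟨e⟩ := nonempty_pow_tensor_equiv hI k (resMod I B)
  have hfl : IsFiniteLength R (IdealTensor (I ^ k) (resMod I B)) :=
    e.symm.isFiniteLength (isFiniteLength_iterTensor hI k (isFiniteLength_resMod.mpr hB))
  rw [homFactor, moduleClass_eq_of_equiv e hfl, card_linearMap_congr (LinearEquiv.refl R _) e]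

/-- Restriction of scalars of an isomorphism. -/
noncomputable def resEquiv {B C : ModuleCat.{u} (R ⧸ I)} (e : B ≃ₗ[R ⧸ I] C) :
    resMod I B ≃ₗ[R] resMod I C :=
  LinearEquiv.ofBijective (resMap e.toLinearMap) e.bijective

theorem homFactor_congr {Q Q' : ModuleCat.{u} (R ⧸ I)} (e : Q ≃ₗ[R ⧸ I] Q') (k : ℕ)
    (A : ModuleCat.{u} R) : homFactor Q k A = homFactor Q' k A := by
  rw [homFactor, homFactor, card_linearMap_congr (resEquiv e) (LinearEquiv.refl R _)]

theorem bracketRes_congr {P P' : ℕ → ModuleCat.{u} (R ⧸ I)}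
    (e : ∀ j, Nonempty (P j ≃ₗ[R ⧸ I] P' j)) (j : ℕ) (A : ModuleCat.{u} R) :
    bracketRes P j A = bracketRes P' j A := by
  rw [bracketRes, bracketRes,
    card_linearMap_congr (resEquiv (e j).some) (LinearEquiv.refl R A)]
  congr 1
  exact Finset.prod_congr rfl fun k _ => homFactor_congr (e (j - k)).some k A

/-- Separates the only factor involving `P 0`, namely `k = j + 1`; the others form the bracket of
the shifted sequence. It mirrors the passage from `X` to `(X : I)`. -/
theorem bracketRes_succ (P : ℕ → ModuleCat.{u} (R ⧸ I)) (j : ℕ) (A : ModuleCat.{u} R) :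
    bracketRes P (j + 1) A = bracketRes (fun i => P (i + 1)) j A * homFactor (P 0) (j + 1) A := by
  rw [bracketRes, bracketRes, Finset.prod_range_succ, Nat.sub_self, smul_mul_assoc]
  congr 2
  refine Finset.prod_congr rfl fun k hk => ?_
  rw [Nat.succ_sub (Nat.lt_succ_iff.mp (Finset.mem_range.mp hk))]

/-- The normalising inverse cancels the single Hom factor. -/
theorem bracketRes_zero (P : ℕ → ModuleCat.{u} (R ⧸ I)) (A : ModuleCat.{u} R)
    (h : Nat.card (resMod I (P 0) →ₗ[R] A) ≠ 0) :
    bracketRes P 0 A = Dir.of (moduleClass R A) := by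
  rw [bracketRes, Finset.prod_range_one]
  exact inv_smul_smul₀ (Nat.cast_ne_zero.mpr h) _

theorem bracketG_add (P : ℕ → ModuleCat.{u} (R ⧸ I)) (j : ℕ) (g h : GMonoid (R ⧸ I)) :
    bracketG I P j (g + h) = bracketG I P j g * bracketG I P j h :=
  Finsupp.prod_add_index' (fun _ => pow_zero _) fun _ _ _ => pow_add _ _ _

theorem bracketG_single (P : ℕ → ModuleCat.{u} (R ⧸ I)) (j : ℕ) (i : SimpleClass (R ⧸ I)) :
    bracketG I P j (Finsupp.single i 1) = bracket I P j (ModuleCat.of (R ⧸ I) i.Rep) := by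
  rw [bracketG, Finsupp.prod_single_index, pow_one]
  rw [pow_zero]

/-- The bracket is multiplicative in short exact sequences because the `P j` are projective, so the
value prescribed on simple classes propagates to all finite length modules. -/
theorem bracketG_moduleClass (hI : IsInvertibleIdeal I) {P : ℕ → ModuleCat.{u} (R ⧸ I)}
    (hP : ∀ j, Module.Projective (R ⧸ I) (P j)) (j : ℕ) {B : Type u} [AddCommGroup B]
    [Module (R ⧸ I) B] (hB : IsFiniteLength (R ⧸ I) B) :
    bracketG I P j (moduleClass (R ⧸ I) B) =
      bracketRes P j (resMod I (ModuleCat.of (R ⧸ I) B)) := by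
  have hF := isMultInvariant_bracketRes hI hP j
  induction hB with
  | @of_subsingleton B _ _ hs =>
    rw [moduleClass_of_subsingleton, hF.eq_one _ hs]
    exact Finsupp.prod_zero_index
  | @of_simple_quotient B _ _ N hS hN ih =>
    have hB : IsFiniteLength (R ⧸ I) B := .of_simple_quotient hN
    rw [moduleClass_of_simple_quotient N hN hS (LinearEquiv.refl _ _), bracketG_add, ih,
      hF.eq_mul (A := resMod I (ModuleCat.of (R ⧸ I) N)) (B := resMod I (ModuleCat.of (R ⧸ I) B))
        (D := resMod I (ModuleCat.of (R ⧸ I) (B ⧸ N))) (resMap N.subtype) (resMap N.mkQ)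
        N.injective_subtype N.mkQ_surjective (LinearMap.exact_subtype_mkQ N)
        (isFiniteLength_resMod.mpr hB) (fun i hi b => smul_resMod_eq_zero _ hi b)]
    congr 1
    obtain ⟨e⟩ := SimpleClass.exists_equiv_rep _ hS
    have hfl : IsFiniteLength (R ⧸ I) (ModuleCat.of (R ⧸ I) (SimpleClass.of _ hS).Rep) :=
      isFiniteLength_of_simple (M := (SimpleClass.of _ hS).Rep) inferInstance
    rw [bracketG_single, bracket_eq_bracketRes hI P j hfl]
    exact (hF.congr (resEquiv (B := ModuleCat.of (R ⧸ I) (B ⧸ N))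
      (C := ModuleCat.of (R ⧸ I) (SimpleClass.of _ hS).Rep) e)
      (isFiniteLength_resMod.mpr hfl) (fun i hi b => smul_resMod_eq_zero _ hi b)).symm

end Bracket

/-! ### Summing over the submodules with a given chain -/

section ChainFibre

variable {R : Type u} [Ring R] {I : Ideal R} [I.IsTwoSided] {M : Type u} [AddCommGroup M]
  [Module R M]

theorem Dir.summable_comp_injective {A : Type u} [Ring A] (hA : FiniteSimpleCounts A)
    {ι κ : Type*} {f : ι → Dir A} (hf : Summable f) {φ : κ → ι} (hφ : Function.Injective φ) :
    Summable fun k => f (φ k) :=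
  Dir.summable_of_finite hA fun g =>
    (Dir.finite_of_summable hA hf g).preimage hφ.injOn

theorem summable_zetaTerm (hR : IsLeftArithmetical R) (M : Type u) [AddCommGroup M] [Module R M]
    [Module.Finite R M] : Summable (zetaTerm R M) := by
  refine Dir.summable_of_finite hR.finiteSimpleCounts fun g => ?_
  refine ((hR.finite_submodules g.norm M).preimage Subtype.val_injective.injOn).subset ?_
  intro X hX
  have hg : g = moduleClass R (M ⧸ X.1) := by
    by_contra h
    refine hX ?_
    rw [zetaTerm, Dir.coeff_of, if_neg h]
  exact ⟨X.2, by rw [hg, norm_moduleClass X.2]⟩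

/-- The finite colength submodules of `M` with a given chain. -/
abbrev ChainFibre (Y : ℕ → Submodule (R ⧸ I) (ModI I M)) : Type u :=
  {X : {X : Submodule R M // IsFiniteLength R (M ⧸ X)} // chainOf I X.1 = Y}

theorem eq_of_chainOf_eq_iff {X : Submodule R M} {Y : ℕ → Submodule (R ⧸ I) (ModI I M)} :
    chainOf I X = Y ↔ chainOf I (colon I X) = (fun j => Y (j + 1)) ∧ redSub X = Y 0 := by
  constructor
  · rintro rfl
    exact ⟨rfl, rfl⟩
  · rintro ⟨h1, h2⟩
    funext j
    cases j with
    | zero => exact h2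
    | succ j => exact congrFun h1 j

/-- A submodule with chain `Y` amounts to a submodule `V` with the shifted chain and a submodule
`X` with `(X : I) = V` and image `Y 0` in `M/IM`. -/
def chainFibreEquiv [Module.Projective R M] (hI : IsInvertibleIdeal I)
    (Y : ℕ → Submodule (R ⧸ I) (ModI I M))
    (hY : IsFiniteLength (R ⧸ I) (ModI I M ⧸ Y 0)) :
    (Σ V : ChainFibre fun j => Y (j + 1),
      {X : Submodule R M // colon I X = V.1.1 ∧ redSub X = Y 0}) ≃ ChainFibre Y where
  toFun p := ⟨⟨p.2.1, isFiniteLength_quot_of_colon hI (p.2.2.1.symm ▸ p.1.1.2)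
    (p.2.2.2.symm ▸ hY)⟩, eq_of_chainOf_eq_iff.mpr ⟨p.2.2.1.symm ▸ p.1.2, p.2.2.2⟩⟩
  invFun X := ⟨⟨⟨colon I X.1.1, isFiniteLength_quot_of_le (le_colon _) X.1.2⟩,
    (eq_of_chainOf_eq_iff.mp X.2).1⟩, ⟨X.1.1, rfl, (eq_of_chainOf_eq_iff.mp X.2).2⟩⟩
  left_inv := by
    rintro ⟨⟨⟨V, hV⟩, hV'⟩, ⟨X, hX, hX'⟩⟩
    obtain rfl : V = colon I X := hX.symm
    rfl
  right_inv _ := rfl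

variable [Module.Finite R M] [Module.Projective R M]

omit [Module.Projective R M] in
theorem finite_of_isFiniteLength_quot (hR : IsLeftArithmetical R)
    {Y : Submodule (R ⧸ I) (ModI I M)} (hY : IsFiniteLength (R ⧸ I) (ModI I M ⧸ Y)) :
    Module.Finite (R ⧸ I) Y := by
  have hpre := hR.finite_of_finiteColength _ (isFiniteLength_quot_preSub.mpr hY)
  refine Module.Finite.of_surjective (M := preSub Y) (P := Y)
    (((redMap I).comp (preSub Y).subtype).codRestrict Y fun x => x.2) ?_
  rintro ⟨y, hy⟩
  obtain ⟨m, rfl⟩ := redMap_surjective y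
  exact ⟨⟨m, hy⟩, rfl⟩

/-- Induction on the stabilisation index. The submodules `X` with chain `Y` are grouped by `V = (X :
I)`, whose chain is the shift of `Y`. Each group has the same size `H`, and each `[M/X]` is the same
multiple `D` of `[M/V]`. -/
theorem hasSum_chainFibre (hR : IsLeftArithmetical R) (hI : IsInvertibleIdeal I)
    (hIJ : I ≤ Ring.jacobson R)
    (hproj : ∀ Y : Submodule (R ⧸ I) (ModI I M),
      IsFiniteLength (R ⧸ I) (ModI I M ⧸ Y) → Module.Projective (R ⧸ I) Y)
    (n : ℕ) (Y : ℕ → Submodule (R ⧸ I) (ModI I M)) (hY : IsStableChain I M Y)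
    (hn : ∀ j, n ≤ j → Y j = ⊤) :
    HasSum (fun X : ChainFibre Y => zetaTerm R M X.1)
      (∏ j ∈ Finset.range n, bracketRes (fun i => ModuleCat.of (R ⧸ I) (Y i)) j
        (ModuleCat.of R (subquot (preSub (Y j)) (preSub (Y (j + 1)))))) := by
  have := Dir.isTopologicalRing hR.finiteSimpleCounts
  have := Dir.t2Space hR.finiteSimpleCounts
  have hsum := summable_zetaTerm hR M
  induction n generalizing Y with
  | zero =>
    have hYtop : Y = fun _ => ⊤ := funext fun j => hn j (Nat.zero_le j)
    have htop : ∀ j, (colon I)^[j] (⊤ : Submodule R M) = ⊤ := fun j =>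
      top_le_iff.mp (le_iterate_colon ⊤ j)
    have hss : Subsingleton (M ⧸ (⊤ : Submodule R M)) := inferInstance
    let X₀ : ChainFibre Y := ⟨⟨⊤, .of_subsingleton⟩, by
      rw [hYtop]
      funext j
      rw [chainOf, htop, redSub_top]⟩
    have huniq : ∀ X : ChainFibre Y, X = X₀ := fun X => Subtype.ext (Subtype.ext
      (eq_top_of_redSub_eq_top hIJ ((congrFun X.2 0).trans (hn 0 le_rfl))))
    have hX₀ : zetaTerm R M X₀.1 = 1 := by
      change Dir.of (moduleClass R (M ⧸ (⊤ : Submodule R M))) = 1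
      rw [moduleClass_of_subsingleton, Dir.of_zero]
    rw [Finset.prod_range_zero, ← hX₀]
    exact hasSum_single X₀ fun X hX => absurd (huniq X) hX
  | succ n ih =>
    let B : ℕ → ModuleCat.{u} R := fun k =>
      ModuleCat.of R (subquot (preSub (Y k)) (preSub (Y (k + 1))))
    let Q : ModuleCat.{u} (R ⧸ I) := ModuleCat.of (R ⧸ I) (Y 0)
    have hQ : Module.Projective (R ⧸ I) Q := hproj _ (hY.finiteColength 0)
    have hQfin : Module.Finite R (resMod I Q) := by
      exact ((resSemilinear Q).finite_iff_of_bijective (resSemilinear_bijective Q)).mpr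
        (finite_of_isFiniteLength_quot hR (hY.finiteColength 0))
    have hY' : IsStableChain I M fun j => Y (j + 1) :=
      ⟨fun i j hij => hY.mono (Nat.succ_le_succ hij), fun j => hY.finiteColength (j + 1), by
        obtain ⟨N, hN⟩ := hY.eventually_top
        exact ⟨N, fun j hj => hN _ (hj.trans (Nat.le_succ j))⟩⟩
    have hY'n : ∀ j, n ≤ j → Y (j + 1) = ⊤ := fun j hj => hn _ (Nat.succ_le_succ hj)
    -- The shift in `k + 1` arises because the choices of `X` are counted by `Hom(Y 0, I ⊗ (V :
    -- I)/V)`, and `V` has the shifted chain.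
    let H : ℕ := ∏ k ∈ Finset.range n,
      Nat.card (resMod I Q →ₗ[R] iterTensor I (k + 1) (B (k + 1)))
    let D : Dir R := ∏ k ∈ Finset.range (n + 1), Dir.of (moduleClass R (iterTensor I k (B k)))
    have hterm : ∀ X : ChainFibre Y, zetaTerm R M X.1 =
        D * Dir.of (moduleClass R (M ⧸ colon I X.1.1)) := fun X => by
      have h1 := (isMultInvariant_of_moduleClass I).colon_quot_eq_prod hI hIJ X.1.2 (n + 1)
        (fun j hj => by rw [X.2, hn j hj])
      rw [X.2] at h1
      rw [zetaTerm, moduleClass_quot_eq_add (le_colon (I := I) X.1.1) X.1.2, Dir.of_add]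
      exact congrArg (· * _) h1
    have hcard : ∀ V : ChainFibre fun j => Y (j + 1),
        Nat.card {X : Submodule R M // colon I X = V.1.1 ∧ redSub X = Y 0} = H := fun V => by
      have h0 : Y 0 ≤ redSub V.1.1 := by
        have := congrFun V.2 0
        rw [chainOf_zero] at this
        rw [this]
        exact hY.mono (Nat.zero_le 1)
      have h1 := ((isMultInvariant_card_hom Q hQ).tensor hI).colon_quot_eq_prod hI hIJ V.1.2 n
        (fun j hj => by rw [V.2]; exact hY'n j hj)
      rw [V.2] at h1
      rw [card_fibre hI _ hQ _ h0]
      exact h1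
    have hfin : ∀ V : ChainFibre fun j => Y (j + 1),
        Finite {X : Submodule R M // colon I X = V.1.1 ∧ redSub X = Y 0} := fun V => by
      refine Nat.finite_of_card_ne_zero ?_
      rw [hcard, Finset.prod_ne_zero_iff]
      intro k _
      have := hR.finite_of_isFiniteLength (isFiniteLength_iterTensor hI (k + 1)
        (A := B (k + 1)) (isFiniteLength_subquot _
          (isFiniteLength_quot_preSub.mpr (hY.finiteColength (k + 1)))))
      have := finite_linearMap R (resMod I Q) (iterTensor I (k + 1) (B (k + 1)))
      exact Nat.card_pos.ne'
    have hB0 : Nat.card (resMod I Q →ₗ[R] B 0) ≠ 0 := by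
      have := hR.finite_of_isFiniteLength (B := B 0) (isFiniteLength_subquot _
          (isFiniteLength_quot_preSub.mpr (hY.finiteColength 0)))
      have := finite_linearMap R (resMod I Q) (B 0)
      exact Nat.card_pos.ne'
    have hih := ih (fun j => Y (j + 1)) hY' hY'n
    have hprod : ∏ j ∈ Finset.range (n + 1), bracketRes (fun i => ModuleCat.of (R ⧸ I) (Y i)) j
        (B j) = ((H : ℂ) • D) * ∏ j ∈ Finset.range n,
          bracketRes (fun i => ModuleCat.of (R ⧸ I) (Y (i + 1))) j (B (j + 1)) := by
      have h1 : ∏ k ∈ Finset.range n, homFactor Q (k + 1) (B (k + 1)) =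
          (H : ℂ) • ∏ k ∈ Finset.range n,
            Dir.of (moduleClass R (iterTensor I (k + 1) (B (k + 1)))) := by
        simp only [homFactor, H, Nat.cast_prod]
        exact Finset.prod_smul _ _ _
      -- The factor `j = 0` is just `[B 0]`; each later one splits off one `homFactor Q`, and these
      -- assemble to `H` and the rest of `D`.
      rw [Finset.prod_range_succ', bracketRes_zero _ _ hB0]
      simp only [bracketRes_succ, Finset.prod_mul_distrib]
      rw [h1]
      simp only [D, Finset.prod_range_succ']
      simp only [smul_mul_assoc, mul_smul_comm]
      congr 1
      rw [show iterTensor I 0 (B 0) = B 0 from rfl]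
      ring
    change HasSum _ (∏ j ∈ Finset.range (n + 1),
      bracketRes (fun i => ModuleCat.of (R ⧸ I) (Y i)) j (B j))
    rw [hprod, ← (chainFibreEquiv hI Y (hY.finiteColength 0)).hasSum_iff]
    refine HasSum.sigma_of_hasSum (hih.mul_left ((H : ℂ) • D)) (fun V => ?_) ?_
    · have := hfin V
      have := Fintype.ofFinite {X : Submodule R M // colon I X = V.1.1 ∧ redSub X = Y 0}
      have hconst : ∀ X : {X : Submodule R M // colon I X = V.1.1 ∧ redSub X = Y 0},
          zetaTerm R M (chainFibreEquiv hI Y (hY.finiteColength 0) ⟨V, X⟩).1 =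
            D * zetaTerm R M V.1 := fun X => by
        rw [hterm]
        change D * Dir.of (moduleClass R (M ⧸ colon I X.1)) = _
        rw [X.2.1]
        rfl
      have h2 := hasSum_fintype fun X : {X : Submodule R M // colon I X = V.1.1 ∧
        redSub X = Y 0} => zetaTerm R M (chainFibreEquiv hI Y (hY.finiteColength 0) ⟨V, X⟩).1
      rw [Finset.sum_congr rfl fun X _ => hconst X, Finset.sum_const, Finset.card_univ,
        ← Nat.card_eq_fintype_card, hcard, ← Nat.cast_smul_eq_nsmul ℂ, ← smul_mul_assoc] at h2
      exact h2
    · exact Dir.summable_comp_injective hR.finiteSimpleCounts hsum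
        (φ := fun p => (chainFibreEquiv hI Y (hY.finiteColength 0) p).1)
        (Subtype.val_injective.comp (Equiv.injective _))

end ChainFibre

/-! ### Products and sums in the Dirichlet algebra -/

namespace Dir

open Filter Topology

variable {A : Type u} [Ring A] (hA : FiniteSimpleCounts A)
include hA

theorem coeff_eq_sum {ι : Type*} {f : ι → Dir A} {a : Dir A} (hf : HasSum f a) (g : GMonoid A)
    (s : Finset ι) (hs : ∀ i, i ∉ s → coeff g (f i) = 0) :
    coeff g a = ∑ i ∈ s, coeff g (f i) := by
  classical
  obtain ⟨t, ht⟩ := eventually_atTop.mp ((hasSum_iff hA).mp hf g)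
  rw [← ht (t ∪ s) Finset.subset_union_left]
  exact (Finset.sum_subset Finset.subset_union_right fun i _ hi => hs i hi).symm

/-- For each `g` only finitely many indices contribute, and they all lie in `S n` for large `n`. -/
theorem tendsto_of_exhaustion {ι : Type*} {f : ι → Dir A} {a : Dir A} (hf : HasSum f a)
    {S : ℕ → Set ι} (hS : ∀ i, ∀ᶠ n in atTop, i ∈ S n) {p : ℕ → Dir A}
    (hp : ∀ᶠ n in atTop, HasSum (fun i : S n => f i) (p n)) : Tendsto p atTop (𝓝 a) := by
  classical
  rw [tendsto_iff_coeff hA]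
  intro g
  have hfin := finite_of_summable hA hf.summable g
  have hev : ∀ᶠ n in atTop, ∀ i ∈ hfin.toFinset, i ∈ S n :=
    (Filter.eventually_all_finset _).mpr fun i _ => hS i
  filter_upwards [hp, hev] with n hn hsub
  rw [coeff_eq_sum hA hf g hfin.toFinset fun i hi => by
      by_contra h; exact hi (hfin.mem_toFinset.mpr h),
    coeff_eq_sum hA hn g (hfin.toFinset.subtype (· ∈ S n)) fun i hi => by
      by_contra h
      exact hi (Finset.mem_subtype.mpr (hfin.mem_toFinset.mpr h))]
  exact Finset.sum_subtype_of_mem (fun i => coeff g (f i)) hsub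

/-- No uniformity in `i` is needed: for all but finitely many `i` the factor `a i` has no
coefficient of norm up to that of `g`, and then neither has any multiple of it. -/
theorem summable_sigma_mul {ι : Type*} {κ : ι → Type*} {a : ι → Dir A}
    {b : (Σ i, κ i) → Dir A} (ha : Summable a) (hb : ∀ i, Summable fun k => b ⟨i, k⟩) :
    Summable fun p : Σ i, κ i => a p.1 * b p := by
  have := isTopologicalRing hA
  refine summable_of_finite hA fun g => ?_
  have hfin : {i | ∃ g' : GMonoid A, g'.norm ≤ g.norm ∧ coeff g' (a i) ≠ 0}.Finite := by
    refine ((hA.finite_norm_le g.norm).biUnion fun g' _ => finite_of_summable hA ha g').subset ?_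
    rintro i ⟨g', h, h'⟩
    exact Set.mem_biUnion (show g' ∈ {g' : GMonoid A | g'.norm ≤ g.norm} from h) h'
  refine ((hfin.biUnion fun i _ => ((finite_of_summable hA
    ((hb i).mul_left (a i)) g).image (Sigma.mk i)))).subset ?_
  rintro ⟨i, k⟩ h
  refine Set.mem_biUnion (x := i) ?_ ⟨k, h, rfl⟩
  by_contra hc
  refine h ?_
  obtain ⟨F, hF⟩ := exists_ideal hA g.norm
  have hai : a i ∈ F := (hF _).mpr fun g' hg' => by
    by_contra h'
    exact hc ⟨g', hg', h'⟩
  exact (hF _).mp (F.mul_mem_right _ hai) g le_rfl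

theorem hasSum_sigma_mul {ι : Type*} {κ : ι → Type*} {a : ι → Dir A}
    {b : (Σ i, κ i) → Dir A} {s t : Dir A} (ha : HasSum a s)
    (hb : ∀ i, HasSum (fun k => b ⟨i, k⟩) t) :
    HasSum (fun p : Σ i, κ i => a p.1 * b p) (s * t) := by
  have := isTopologicalRing hA
  have := t2Space hA
  exact HasSum.sigma_of_hasSum (ha.mul_right t) (fun i => (hb i).mul_left (a i))
    (summable_sigma_mul hA ha.summable fun i => (hb i).summable)

end Dir

/-! ### Norm estimates for the change of variable -/

section NormBound

variable {R : Type u} [Ring R] {I : Ideal R} [I.IsTwoSided]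

/-- Each bracket is a scalar times one monomial, so its size can be read from the norm of that
monomial. -/
theorem exists_bracketRes_eq (P : ℕ → ModuleCat.{u} (R ⧸ I)) (j : ℕ) (A : ModuleCat.{u} R) :
    ∃ c : ℂ, bracketRes P j A =
      c • Dir.of (∑ k ∈ Finset.range (j + 1), moduleClass R (iterTensor I k A)) := by
  rw [bracketRes, Dir.of_sum]
  simp only [homFactor]
  rw [Finset.prod_smul, smul_smul]
  exact ⟨_, rfl⟩

theorem GMonoid.norm_sum {ι : Type*} (s : Finset ι) (g : ι → GMonoid R) :
    (∑ i ∈ s, g i).norm = ∏ i ∈ s, (g i).norm := by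
  classical
  induction s using Finset.induction_on with
  | empty => rw [Finset.sum_empty, Finset.prod_empty, GMonoid.norm_zero]
  | insert a s ha ih => rw [Finset.sum_insert ha, Finset.prod_insert ha, GMonoid.norm_add, ih]

theorem norm_sum_iterTensor (hI : IsInvertibleIdeal I) {A : ModuleCat.{u} R}
    (hA : IsFiniteLength R A) (n : ℕ) :
    (∑ k ∈ Finset.range n, moduleClass R (iterTensor I k A)).norm =
      ∏ k ∈ Finset.range n, Nat.card (iterTensor I k A) := by
  rw [GMonoid.norm_sum]
  exact Finset.prod_congr rfl fun k _ => norm_moduleClass (isFiniteLength_iterTensor hI k hA)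

theorem nontrivial_iterTensor (hI : IsInvertibleIdeal I) {A : ModuleCat.{u} R}
    (hA : Nontrivial A) (k : ℕ) : Nontrivial (iterTensor I k A) := by
  induction k with
  | zero => exact hA
  | succ k ih =>
    by_contra hc
    rw [not_nontrivial_iff_subsingleton] at hc
    have := hI.subsingleton hc
    exact not_subsingleton (iterTensor I k A) this

theorem card_le_prod_card_iterTensor (hR : IsLeftArithmetical R) (hI : IsInvertibleIdeal I)
    {A : ModuleCat.{u} R} (hA : IsFiniteLength R A) (j : ℕ) :
    Nat.card A ≤ ∏ k ∈ Finset.range (j + 1), Nat.card (iterTensor I k A) := by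
  rw [Finset.prod_range_succ']
  refine Nat.le_mul_of_pos_left _ (Finset.prod_pos fun k _ => ?_)
  have := hR.finite_of_isFiniteLength (isFiniteLength_iterTensor hI (k + 1) hA)
  exact Nat.card_pos

/-- Each of the `j + 1` tensor powers is nonzero, hence has at least two elements. This growth makes
the infinite products converge. -/
theorem two_pow_le_prod_card_iterTensor (hR : IsLeftArithmetical R) (hI : IsInvertibleIdeal I)
    {A : ModuleCat.{u} R} (hA : IsFiniteLength R A) (hA' : Nontrivial A) (j : ℕ) :
    2 ^ (j + 1) ≤ ∏ k ∈ Finset.range (j + 1), Nat.card (iterTensor I k A) := by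
  refine (Finset.pow_card_le_prod (Finset.range (j + 1)) _ 2 fun k _ => ?_).trans_eq' ?_
  · have := hR.finite_of_isFiniteLength (isFiniteLength_iterTensor hI k hA)
    have := nontrivial_iterTensor hI hA' k
    exact Finite.one_lt_card
  · rw [Finset.card_range]

/-- On a simple module the factor `k = 0` already contributes the norm of the module, and the other
factors have positive cardinality; multiplicativity extends the bound to all `g`. -/
theorem exists_bracketG_eq (hR : IsLeftArithmetical R) (hI : IsInvertibleIdeal I)
    (P : ℕ → ModuleCat.{u} (R ⧸ I)) (j : ℕ) (g : GMonoid (R ⧸ I)) :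
    ∃ (c : ℂ) (m : GMonoid R), bracketG I P j g = c • Dir.of m ∧ g.norm ≤ m.norm := by
  have hadd : ∀ g h : GMonoid (R ⧸ I),
      (∃ (c : ℂ) (m : GMonoid R), bracketG I P j g = c • Dir.of m ∧ g.norm ≤ m.norm) →
      (∃ (c : ℂ) (m : GMonoid R), bracketG I P j h = c • Dir.of m ∧ h.norm ≤ m.norm) →
      ∃ (c : ℂ) (m : GMonoid R), bracketG I P j (g + h) = c • Dir.of m ∧
        (g + h).norm ≤ m.norm := by
    rintro g h ⟨c, m, hc, hm⟩ ⟨c', m', hc', hm'⟩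
    refine ⟨c * c', m + m', ?_, ?_⟩
    · rw [bracketG_add, hc, hc', Dir.of_add, smul_mul_smul_comm]
    · rw [GMonoid.norm_add, GMonoid.norm_add]
      exact Nat.mul_le_mul hm hm'
  have hzero : ∃ (c : ℂ) (m : GMonoid R), bracketG I P j 0 = c • Dir.of m ∧
      (0 : GMonoid (R ⧸ I)).norm ≤ m.norm :=
    ⟨1, 0, by rw [one_smul, Dir.of_zero]; exact Finsupp.prod_zero_index,
      by rw [GMonoid.norm_zero, GMonoid.norm_zero]⟩
  induction g using Finsupp.induction_linear with
  | zero => exact hzero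
  | add g h hg hh => exact hadd g h hg hh
  | single i n =>
    induction n with
    | zero =>
      rw [Finsupp.single_zero]
      exact hzero
    | succ n ih =>
      rw [Finsupp.single_add]
      refine hadd _ _ ih ?_
      have hfl : IsFiniteLength (R ⧸ I) (ModuleCat.of (R ⧸ I) i.Rep) :=
        isFiniteLength_of_simple (M := i.Rep) inferInstance
      obtain ⟨c, hc⟩ := exists_bracketRes_eq P j (resMod I (ModuleCat.of (R ⧸ I) i.Rep))
      refine ⟨c, _, by rw [bracketG_single, bracket_eq_bracketRes hI P j hfl, hc], ?_⟩
      rw [norm_sum_iterTensor hI (isFiniteLength_resMod.mpr hfl), GMonoid.norm_single, pow_one,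
        SimpleClass.card_eq_natCard_rep]
      exact card_le_prod_card_iterTensor hR hI (isFiniteLength_resMod.mpr hfl) j

theorem norm_le_of_coeff_bracketG_ne_zero (hR : IsLeftArithmetical R) (hI : IsInvertibleIdeal I)
    (P : ℕ → ModuleCat.{u} (R ⧸ I)) (j : ℕ) (g : GMonoid (R ⧸ I)) (h : GMonoid R)
    (hne : Dir.coeff h (bracketG I P j g) ≠ 0) : g.norm ≤ h.norm := by
  classical
  obtain ⟨c, m, hc, hm⟩ := exists_bracketG_eq hR hI P j g
  rw [hc, Dir.coeff_smul, Dir.coeff_of] at hne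
  have : h = m := by
    by_contra hh
    rw [if_neg hh, mul_zero] at hne
    exact hne rfl
  rwa [this]

theorem summable_substTerm (hR : IsLeftArithmetical R) (hI : IsInvertibleIdeal I)
    (P : ℕ → ModuleCat.{u} (R ⧸ I)) (j : ℕ) (f : Dir (R ⧸ I)) :
    Summable (Dir.substTerm (bracketG I P j) f) := by
  refine Dir.summable_of_finite hR.finiteSimpleCounts fun h => ?_
  refine ((hR.finiteSimpleCounts_quotient I).finite_norm_le h.norm).subset fun g hg => ?_
  refine norm_le_of_coeff_bracketG_ne_zero hR hI P j g h fun h0 => hg ?_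
  rw [Dir.substTerm, Dir.coeff_smul, h0, mul_zero]

end NormBound

/-! ### Partial zeta functions under the change of variable -/

section PartialZeta

variable {R : Type u} [Ring R] {I : Ideal R} [I.IsTwoSided]

/-- The index set of the partial zeta function `Z(Q, Q')`. -/
abbrev PartialIndex (A : Type u) [Ring A] (Q Q' : ModuleCat.{u} A) : Type u :=
  {X : Submodule A Q // IsFiniteLength A (Q ⧸ X) ∧ Nonempty (X ≃ₗ[A] Q')}

/-- Pulled back along restriction of scalars to `R`, where `finite_submodules` applies;
cardinalities of quotients are unchanged. -/
theorem finite_partialIndex (hR : IsLeftArithmetical R) (Q Q' : ModuleCat.{u} (R ⧸ I))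
    (hQ : Module.Finite (R ⧸ I) Q) (n : ℕ) :
    {X : PartialIndex (R ⧸ I) Q Q' | (moduleClass (R ⧸ I) (Q ⧸ X.1)).norm ≤ n}.Finite := by
  have hfin : Module.Finite R (resMod I Q) :=
    ((resSemilinear Q).finite_iff_of_bijective (resSemilinear_bijective Q)).mpr hQ
  let φ : PartialIndex (R ⧸ I) Q Q' → Submodule R (resMod I Q) :=
    fun X => X.1.comap (resSemilinear Q)
  have hφ : Function.Injective φ := fun X X' h => Subtype.ext
    (Submodule.comap_injective_of_surjective (resSemilinear_bijective Q).2 h)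
  refine ((hR.finite_submodules n (resMod I Q)).preimage hφ.injOn).subset fun X hX => ?_
  have hb : Function.Bijective (Submodule.mapQ (φ X) X.1 (resSemilinear Q) le_rfl) := by
    constructor
    · rw [injective_iff_map_eq_zero]
      intro m h
      obtain ⟨m, rfl⟩ := Submodule.Quotient.mk_surjective _ m
      exact (Submodule.Quotient.mk_eq_zero _).mpr ((Submodule.Quotient.mk_eq_zero X.1).mp h)
    · intro y
      obtain ⟨y, rfl⟩ := Submodule.Quotient.mk_surjective _ y
      exact ⟨Submodule.Quotient.mk y, rfl⟩
  refine ⟨(isFiniteLength_iff_of_bijective _ hb).mpr X.2.1, ?_⟩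
  rw [Nat.card_congr (Equiv.ofBijective _ hb), ← norm_moduleClass X.2.1]
  exact hX

theorem finite_coeff_partialZetaTerm (hR : IsLeftArithmetical R) (Q Q' : ModuleCat.{u} (R ⧸ I))
    (hQ : Module.Finite (R ⧸ I) Q) (g : GMonoid (R ⧸ I)) :
    {X : PartialIndex (R ⧸ I) Q Q' | moduleClass (R ⧸ I) (Q ⧸ X.1) = g}.Finite :=
  (finite_partialIndex hR Q Q' hQ g.norm).subset fun X hX => by
    change (moduleClass (R ⧸ I) (Q ⧸ X.1)).norm ≤ g.norm
    rw [show moduleClass (R ⧸ I) (Q ⧸ X.1) = g from hX]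

theorem summable_partialZetaTerm (hR : IsLeftArithmetical R) (Q Q' : ModuleCat.{u} (R ⧸ I))
    (hQ : Module.Finite (R ⧸ I) Q) : Summable (partialZetaTerm (R ⧸ I) Q Q') := by
  classical
  refine Dir.summable_of_finite (hR.finiteSimpleCounts_quotient I) fun g => ?_
  refine (finite_coeff_partialZetaTerm hR Q Q' hQ g).subset fun X hX => ?_
  by_contra h
  refine hX ?_
  rw [partialZetaTerm, Dir.coeff_of, if_neg fun h' => h h'.symm]

theorem coeff_partialZeta (hR : IsLeftArithmetical R) (Q Q' : ModuleCat.{u} (R ⧸ I))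
    (hQ : Module.Finite (R ⧸ I) Q) (g : GMonoid (R ⧸ I)) :
    Dir.coeff g (partialZeta (R ⧸ I) Q Q') =
      Nat.card {X : PartialIndex (R ⧸ I) Q Q' // moduleClass (R ⧸ I) (Q ⧸ X.1) = g} := by
  classical
  have hfin := finite_coeff_partialZetaTerm hR Q Q' hQ g
  have hval : ∀ X : PartialIndex (R ⧸ I) Q Q', Dir.coeff g (partialZetaTerm (R ⧸ I) Q Q' X) =
      if moduleClass (R ⧸ I) (Q ⧸ X.1) = g then 1 else 0 := fun X => by
    rw [partialZetaTerm, Dir.coeff_of]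
    simp only [eq_comm]
  have h := Dir.coeff_eq_sum (hR.finiteSimpleCounts_quotient I)
    (summable_partialZetaTerm hR Q Q' hQ).hasSum g hfin.toFinset fun X hX => by
      rw [hval]
      exact if_neg fun h => hX (hfin.mem_toFinset.mpr h)
  rw [partialZeta, h, Finset.sum_congr rfl fun X hX => (hval X).trans
    (if_pos (hfin.mem_toFinset.mp hX)), Finset.sum_const, nsmul_eq_mul, mul_one,
    ← Nat.card_eq_card_finite_toFinset hfin]
  rfl

/-- Groups the submodules by the class of their quotient; the group sizes are the coefficients of
the partial zeta function. -/
theorem hasSum_subst_partialZeta (hR : IsLeftArithmetical R) (hI : IsInvertibleIdeal I)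
    (P : ℕ → ModuleCat.{u} (R ⧸ I)) (j : ℕ) (Q Q' : ModuleCat.{u} (R ⧸ I))
    (hQ : Module.Finite (R ⧸ I) Q) :
    HasSum (fun X : PartialIndex (R ⧸ I) Q Q' =>
        bracketG I P j (moduleClass (R ⧸ I) (Q ⧸ X.1)))
      (Dir.subst (bracketG I P j) (partialZeta (R ⧸ I) Q Q')) := by
  have := Dir.isTopologicalRing hR.finiteSimpleCounts
  have := Dir.t2Space hR.finiteSimpleCounts
  have hsum : Summable fun X : PartialIndex (R ⧸ I) Q Q' =>
      bracketG I P j (moduleClass (R ⧸ I) (Q ⧸ X.1)) :=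
    Dir.summable_of_finite hR.finiteSimpleCounts fun h =>
      (finite_partialIndex hR Q Q' hQ h.norm).subset fun X hX =>
        norm_le_of_coeff_bracketG_ne_zero hR hI P j _ h hX
  rw [← (Equiv.sigmaFiberEquiv fun X : PartialIndex (R ⧸ I) Q Q' =>
    moduleClass (R ⧸ I) (Q ⧸ X.1)).hasSum_iff]
  refine HasSum.sigma_of_hasSum (summable_substTerm hR hI P j _).hasSum (fun g => ?_)
    ((Equiv.summable_iff _).mpr hsum)
  have := (finite_coeff_partialZetaTerm hR Q Q' hQ g).to_subtype
  have : Finite {X : PartialIndex (R ⧸ I) Q Q' // moduleClass (R ⧸ I) (Q ⧸ X.1) = g} := this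
  have := Fintype.ofFinite
    {X : PartialIndex (R ⧸ I) Q Q' // moduleClass (R ⧸ I) (Q ⧸ X.1) = g}
  have h2 := hasSum_fintype fun X : {X : PartialIndex (R ⧸ I) Q Q' //
    moduleClass (R ⧸ I) (Q ⧸ X.1) = g} => bracketG I P j (moduleClass (R ⧸ I) (Q ⧸ X.1.1))
  rw [Finset.sum_congr rfl fun X _ => congrArg (bracketG I P j) X.2, Finset.sum_const,
    Finset.card_univ, ← Nat.card_eq_fintype_card, ← Nat.cast_smul_eq_nsmul ℂ,
    ← coeff_partialZeta hR Q Q' hQ] at h2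
  exact h2

end PartialZeta

/-! ### Products of partial zeta functions as sums over chains -/

section Chains

variable {R : Type u} [Ring R] {I : Ideal R} [I.IsTwoSided]
  {V₀ : Type u} [AddCommGroup V₀] [Module (R ⧸ I) V₀]

/-- The value of `⟨P, -⟩_j^I` at the subquotient `V / U`. -/
noncomputable def chainWeight (P : ℕ → ModuleCat.{u} (R ⧸ I)) (j : ℕ)
    (U V : Submodule (R ⧸ I) V₀) : Dir R :=
  bracketRes P j (resMod I (ModuleCat.of (R ⧸ I) (subquot U V)))

/-- The finite colength submodules `U ≤ V` isomorphic to `Q`. -/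
abbrev SubIndex (V : Submodule (R ⧸ I) V₀) (Q : ModuleCat.{u} (R ⧸ I)) : Type u :=
  {U : Submodule (R ⧸ I) V₀ // U ≤ V ∧ IsFiniteLength (R ⧸ I) (V₀ ⧸ U) ∧
    Nonempty (U ≃ₗ[R ⧸ I] Q)}

theorem nonempty_quot_equiv_subquot {A : Type u} [Ring A] {Q V : Type u} [AddCommGroup Q]
    [Module A Q] [AddCommGroup V] [Module A V] (i : Q →ₗ[A] V) (hi : Function.Injective i)
    (X : Submodule A Q) :
    Nonempty ((Q ⧸ X) ≃ₗ[A] subquot (X.map i) (LinearMap.range i)) := by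
  let f : Q →ₗ[A] subquot (X.map i) (LinearMap.range i) :=
    ((X.map i).mkQ.comp i).codRestrict _ fun q => ⟨i q, ⟨q, rfl⟩, rfl⟩
  have hker : LinearMap.ker f = X := by
    ext q
    rw [LinearMap.mem_ker, Subtype.ext_iff]
    refine (Submodule.Quotient.mk_eq_zero (X.map i)).trans ?_
    exact ⟨fun ⟨x, hx, h⟩ => hi h ▸ hx, fun h => ⟨q, h, rfl⟩⟩
  have hsurj : Function.Surjective f := by
    rintro ⟨_, _, ⟨q, rfl⟩, rfl⟩
    exact ⟨q, rfl⟩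
  exact ⟨(Submodule.quotEquivOfEq _ _ hker.symm).trans (f.quotKerEquivOfSurjective hsurj)⟩

/-- Transports the sum from the abstract module `Q` to an actual submodule `V ≃ Q`. The result
depends on `V` only through `Q`, which lets sums over chains factor. -/
theorem hasSum_chainWeight (hR : IsLeftArithmetical R) (hI : IsInvertibleIdeal I)
    {P : ℕ → ModuleCat.{u} (R ⧸ I)} (hP : ∀ j, Module.Projective (R ⧸ I) (P j)) (j : ℕ)
    {Q Q' : ModuleCat.{u} (R ⧸ I)} (hQ : Module.Finite (R ⧸ I) Q)
    (V : Submodule (R ⧸ I) V₀) (hV : IsFiniteLength (R ⧸ I) (V₀ ⧸ V)) (e : V ≃ₗ[R ⧸ I] Q) :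
    HasSum (fun U : SubIndex V Q' => chainWeight P j U.1 V)
      (Dir.subst (bracketG I P j) (partialZeta (R ⧸ I) Q Q')) := by
  let i : Q →ₗ[R ⧸ I] V₀ := V.subtype.comp e.symm.toLinearMap
  have hi : Function.Injective i := V.injective_subtype.comp e.symm.injective
  have hr : LinearMap.range i = V := by
    rw [LinearMap.range_comp, LinearEquiv.range, Submodule.map_subtype_top]
  have hle : ∀ X : Submodule (R ⧸ I) Q, X.map i ≤ V := fun X => by
    conv_rhs => rw [← hr]
    exact LinearMap.map_le_range
  have hequiv : ∀ X : Submodule (R ⧸ I) Q,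
      Nonempty ((Q ⧸ X) ≃ₗ[R ⧸ I] subquot (X.map i) V) := fun X => by
    have := nonempty_quot_equiv_subquot i hi X
    rwa [hr] at this
  let φ : PartialIndex (R ⧸ I) Q Q' → SubIndex V Q' := fun X =>
    ⟨X.1.map i, hle X.1, isFiniteLength_of_exact (exact_subquot_quot (hle X.1))
      ((hequiv X.1).some.isFiniteLength X.2.1) hV,
      ⟨(Submodule.equivMapOfInjective i hi X.1).symm.trans X.2.2.some⟩⟩
  have hφ : Function.Bijective φ := by
    constructor
    · intro X X' h
      exact Subtype.ext (Submodule.map_injective_of_injective hi (congrArg Subtype.val h))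
    · rintro ⟨U, hUV, hU, ⟨eU⟩⟩
      have hmap : (U.comap i).map i = U := by
        rw [Submodule.map_comap_eq, hr, inf_eq_right.mpr hUV]
      refine ⟨⟨U.comap i, ?_, ?_⟩, Subtype.ext hmap⟩
      · have h1 := hequiv (U.comap i)
        rw [hmap] at h1
        exact h1.some.symm.isFiniteLength (isFiniteLength_subquot V hU)
      · have e' := Submodule.equivMapOfInjective i hi (U.comap i)
        rw [hmap] at e'
        exact ⟨e'.trans eU⟩
  have h := hasSum_subst_partialZeta hR hI P j Q Q' hQ
  rw [← (Equiv.ofBijective φ hφ).hasSum_iff]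
  have hfun : (fun U : SubIndex V Q' => chainWeight P j U.1 V) ∘ Equiv.ofBijective φ hφ =
      fun X => bracketG I P j (moduleClass (R ⧸ I) (Q ⧸ X.1)) := funext fun X => by
    rw [bracketG_moduleClass hI hP j X.2.1]
    exact (isMultInvariant_bracketRes hI hP j).congr
      (resEquiv (B := ModuleCat.of (R ⧸ I) (subquot (X.1.map i) V))
        (C := ModuleCat.of (R ⧸ I) (Q ⧸ X.1)) (hequiv X.1).some.symm)
      (isFiniteLength_resMod.mpr X.2.1) fun r hr b => smul_resMod_eq_zero _ hr b
  rw [hfun]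
  exact h

/-- Chains of finite colength submodules with terms isomorphic to `P 0, …, P (n - 1)` and constant
value `V` from the index `n` on. -/
structure IsChainTo (P : ℕ → ModuleCat.{u} (R ⧸ I)) (n : ℕ) (V : Submodule (R ⧸ I) V₀)
    (Y : ℕ → Submodule (R ⧸ I) V₀) : Prop where
  mono : Monotone Y
  eq_of_le : ∀ j, n ≤ j → Y j = V
  finiteColength : ∀ j, IsFiniteLength (R ⧸ I) (V₀ ⧸ Y j)
  equiv : ∀ j, j < n → Nonempty (Y j ≃ₗ[R ⧸ I] P j)

variable {P : ℕ → ModuleCat.{u} (R ⧸ I)} {n : ℕ} {U V : Submodule (R ⧸ I) V₀}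
  {Y : ℕ → Submodule (R ⧸ I) V₀}

theorem IsChainTo.le (h : IsChainTo P n V Y) (j : ℕ) : Y j ≤ V :=
  (h.mono (le_max_left j n)).trans_eq (h.eq_of_le _ (le_max_right j n))

theorem IsChainTo.truncate (h : IsChainTo P (n + 1) V Y) :
    IsChainTo P n (Y n) fun j => Y (min j n) where
  mono _ _ hij := h.mono (min_le_min_right n hij)
  eq_of_le j hj := by rw [min_eq_right hj]
  finiteColength j := h.finiteColength _
  equiv j hj := by
    rw [min_eq_left hj.le]
    exact h.equiv j (hj.trans n.lt_succ_self)

theorem IsChainTo.extend (h : IsChainTo P n U Y) (hUV : U ≤ V)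
    (hV : IsFiniteLength (R ⧸ I) (V₀ ⧸ V)) (e : Nonempty (U ≃ₗ[R ⧸ I] P n)) :
    IsChainTo P (n + 1) V fun j => if j ≤ n then Y j else V where
  mono i j hij := by
    by_cases hj : j ≤ n
    · simp only [if_pos hj, if_pos (hij.trans hj)]
      exact h.mono hij
    · simp only [if_neg hj]
      split_ifs
      exacts [(h.le i).trans hUV, le_rfl]
  eq_of_le j hj := if_neg (Nat.not_le.mpr hj)
  finiteColength j := by
    by_cases hj : j ≤ n
    · rw [if_pos hj]
      exact h.finiteColength j
    · rw [if_neg hj]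
      exact hV
  equiv j hj := by
    rw [if_pos (Nat.lt_succ_iff.mp hj)]
    rcases (Nat.lt_succ_iff.mp hj).lt_or_eq with hj | rfl
    · exact h.equiv j hj
    · rw [h.eq_of_le j le_rfl]
      exact e

/-- Prolonging a chain by one step. -/
def extendChain (P : ℕ → ModuleCat.{u} (R ⧸ I)) (n : ℕ)
    (hV : IsFiniteLength (R ⧸ I) (V₀ ⧸ V))
    (p : Σ U : SubIndex V (P n), {Y : ℕ → Submodule (R ⧸ I) V₀ // IsChainTo P n U.1 Y}) :
    {Y : ℕ → Submodule (R ⧸ I) V₀ // IsChainTo P (n + 1) V Y} :=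
  ⟨_, p.2.2.extend p.1.2.1 hV p.1.2.2.2⟩

theorem extendChain_bijective (hV : IsFiniteLength (R ⧸ I) (V₀ ⧸ V)) :
    Function.Bijective (extendChain P n hV) := by
  constructor
  · rintro ⟨⟨U, hU⟩, ⟨Y, hY⟩⟩ ⟨⟨U', hU'⟩, ⟨Y', hY'⟩⟩ h
    have hle : ∀ j, j ≤ n → Y j = Y' j := fun j hj => by
      have := congrFun (congrArg Subtype.val h) j
      simpa only [extendChain, if_pos hj] using this
    have hUU' : U = U' :=
      (hY.eq_of_le n le_rfl).symm.trans ((hle n le_rfl).trans (hY'.eq_of_le n le_rfl))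
    subst hUU'
    have hYY' : Y = Y' := funext fun j => by
      rcases le_total j n with hj | hj
      · exact hle j hj
      · rw [hY.eq_of_le j hj, hY'.eq_of_le j hj]
    subst hYY'
    rfl
  · rintro ⟨Y, hY⟩
    refine ⟨⟨⟨Y n, hY.le n, hY.finiteColength n, hY.equiv n n.lt_succ_self⟩,
      ⟨_, hY.truncate⟩⟩, Subtype.ext (funext fun j => ?_)⟩
    by_cases hj : j ≤ n
    · simp only [extendChain, if_pos hj, min_eq_left hj]
    · simp only [extendChain, if_neg hj]
      exact (hY.eq_of_le j (Nat.not_le.mp hj)).symm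

/-- Induction from the top: first choose `Y n` inside `V`, then a chain ending at `Y n`. The inner
sum depends only on the isomorphism class of `Y n`, which is `P n`, so the double sum is a product.
-/
theorem hasSum_prod_chainWeight (hR : IsLeftArithmetical R) (hI : IsInvertibleIdeal I)
    (hP : ∀ j, Module.Projective (R ⧸ I) (P j)) (hPfin : ∀ j, Module.Finite (R ⧸ I) (P j))
    (n : ℕ) (V : Submodule (R ⧸ I) V₀) (hV : IsFiniteLength (R ⧸ I) (V₀ ⧸ V))
    (e : Nonempty (V ≃ₗ[R ⧸ I] P n)) :
    HasSum (fun Y : {Y : ℕ → Submodule (R ⧸ I) V₀ // IsChainTo P n V Y} =>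
        ∏ j ∈ Finset.range n, chainWeight P j (Y.1 j) (Y.1 (j + 1)))
      (∏ j ∈ Finset.range n,
        Dir.subst (bracketG I P j) (partialZeta (R ⧸ I) (P (j + 1)) (P j))) := by
  induction n generalizing V with
  | zero =>
    simp only [Finset.prod_range_zero]
    let Y₀ : {Y : ℕ → Submodule (R ⧸ I) V₀ // IsChainTo P 0 V Y} :=
      ⟨fun _ => V, monotone_const, fun _ _ => rfl, fun _ => hV, fun j hj => absurd hj j.not_lt_zero⟩
    exact hasSum_single (f := fun _ => (1 : Dir R)) Y₀ fun Y hY => absurd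
      (Subtype.ext (funext fun j => Y.2.eq_of_le j j.zero_le)) hY
  | succ n ih =>
    have h := Dir.hasSum_sigma_mul hR.finiteSimpleCounts
      (b := fun p : Σ U : SubIndex V (P n),
          {Y : ℕ → Submodule (R ⧸ I) V₀ // IsChainTo P n U.1 Y} =>
        ∏ j ∈ Finset.range n, chainWeight P j (p.2.1 j) (p.2.1 (j + 1)))
      (hasSum_chainWeight hR hI hP n (Q' := P n) (hPfin (n + 1)) V hV e.some)
      fun U => ih U.1 U.2.2.1 U.2.2.2
    rw [← (Equiv.ofBijective _ (extendChain_bijective hV)).hasSum_iff, Finset.prod_range_succ,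
      mul_comm]
    have hfun : (fun Y : {Y : ℕ → Submodule (R ⧸ I) V₀ // IsChainTo P (n + 1) V Y} =>
          ∏ j ∈ Finset.range (n + 1), chainWeight P j (Y.1 j) (Y.1 (j + 1))) ∘
            Equiv.ofBijective _ (extendChain_bijective hV) =
        fun p : Σ U : SubIndex V (P n),
          {Y : ℕ → Submodule (R ⧸ I) V₀ // IsChainTo P n U.1 Y} =>
          chainWeight P n p.1.1 V *
            ∏ j ∈ Finset.range n, chainWeight P j (p.2.1 j) (p.2.1 (j + 1)) := funext fun p => by
      simp only [Function.comp_apply, Equiv.ofBijective_apply, extendChain]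
      rw [Finset.prod_range_succ, mul_comm, if_pos le_rfl, if_neg (Nat.not_succ_le_self n),
        p.2.2.eq_of_le n le_rfl]
      congr 1
      refine Finset.prod_congr rfl fun j hj => ?_
      rw [if_pos (Finset.mem_range.mp hj).le, if_pos (Nat.succ_le_iff.mpr (Finset.mem_range.mp hj))]
    rw [hfun]
    exact h

end Chains

/-! ### The proliferation formula -/

section Proliferation

open Filter Topology

variable {R : Type u} [Ring R] {I : Ideal R} [I.IsTwoSided] {M : Type u} [AddCommGroup M]
  [Module R M]

variable (I M) in
/-- The stable chains of submodules of `M/IM`. -/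
abbrev StableChain : Type u :=
  {Y : ℕ → Submodule (R ⧸ I) (ModI I M) // IsStableChain I M Y}

/-- The sequence of isomorphism classes of a stable chain. -/
def StableChain.classes (Y : StableChain I M) : ChainClasses I M :=
  ⟨fun j => Quotient.mk _ (ModuleCat.of (R ⧸ I) (Y.1 j)), Y.1, Y.2, fun _ => rfl⟩

theorem reps_equiv_iff {P : ℕ → IsoClass (R ⧸ I)} {j : ℕ} {B : ModuleCat.{u} (R ⧸ I)} :
    P j = Quotient.mk _ B ↔ Nonempty (B ≃ₗ[R ⧸ I] reps P j) := by
  rw [← Quotient.out_eq (P j), eq_comm]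
  constructor
  · intro h
    obtain ⟨e⟩ := Quotient.exact h
    exact ⟨e.toLinearEquiv⟩
  · rintro ⟨e⟩
    exact Quotient.sound ⟨e.toModuleIso⟩

theorem StableChain.nonempty_equiv_reps {P : ChainClasses I M} {Y : StableChain I M}
    (h : Y.classes = P) (j : ℕ) : Nonempty (Y.1 j ≃ₗ[R ⧸ I] reps P.1 j) :=
  reps_equiv_iff.mp (congrFun (congrArg Subtype.val h) j).symm

variable [Module.Finite R M]

theorem finite_reps (hR : IsLeftArithmetical R) {P : ℕ → IsoClass (R ⧸ I)}
    (hP : P ∈ ChainClasses I M) (j : ℕ) : Module.Finite (R ⧸ I) (reps P j) := by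
  obtain ⟨Y, hY, h⟩ := hP
  obtain ⟨e⟩ := reps_equiv_iff.mp (h j)
  have := finite_of_isFiniteLength_quot hR (hY.finiteColength j)
  exact Module.Finite.equiv e

omit [Module.Finite R M] in
theorem projective_reps (hproj : ∀ Y : Submodule (R ⧸ I) (ModI I M),
      IsFiniteLength (R ⧸ I) (ModI I M ⧸ Y) → Module.Projective (R ⧸ I) Y)
    {P : ℕ → IsoClass (R ⧸ I)} (hP : P ∈ ChainClasses I M) (j : ℕ) :
    Module.Projective (R ⧸ I) (reps P j) := by
  obtain ⟨Y, hY, h⟩ := hP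
  obtain ⟨e⟩ := reps_equiv_iff.mp (h j)
  have := hproj _ (hY.finiteColength j)
  exact Module.Projective.of_equiv e

omit [Module.Finite R M] in
/-- The factor `Z(P_{j+1}, P_j; ⟨P, -⟩_j^I)` is congruent to `1` modulo terms of norm at least
`2 ^ (j + 1)` when `P_j ≅ P_{j+1}`. -/
theorem coeff_prolifFactor_sub_one (hR : IsLeftArithmetical R) (hI : IsInvertibleIdeal I)
    {P : ℕ → IsoClass (R ⧸ I)} (hP : ∀ j, Module.Projective (R ⧸ I) (reps P j)) {j : ℕ}
    (hfin : Module.Finite (R ⧸ I) (reps P (j + 1)))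
    (e : Nonempty (reps P (j + 1) ≃ₗ[R ⧸ I] reps P j)) {g : GMonoid R}
    (hg : g.norm < 2 ^ (j + 1)) : Dir.coeff g (prolifFactor I P j - 1) = 0 := by
  classical
  -- The whole module is an admissible submodule, contributing `1`; every other one has a nonzero
  -- quotient, whose monomial has norm at least `2 ^ (j + 1)`.
  let X₀ : PartialIndex (R ⧸ I) (reps P (j + 1)) (reps P j) :=
    ⟨⊤, .of_subsingleton, ⟨Submodule.topEquiv.trans e.some⟩⟩
  have h := hasSum_subst_partialZeta hR hI (reps P) j (reps P (j + 1)) (reps P j) hfin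
  have hterm : ∀ X : PartialIndex (R ⧸ I) (reps P (j + 1)) (reps P j), X ∉ ({X₀} : Finset _) →
      Dir.coeff g (bracketG I (reps P) j (moduleClass (R ⧸ I) (reps P (j + 1) ⧸ X.1))) = 0 := by
    intro X hX
    have hne : X.1 ≠ ⊤ := fun h => hX (Finset.mem_singleton.mpr (Subtype.ext h))
    have hnt : Nontrivial (reps P (j + 1) ⧸ X.1) := Submodule.Quotient.nontrivial_iff.mpr hne
    rw [bracketG_moduleClass hI hP j X.2.1]
    obtain ⟨c, hc⟩ := exists_bracketRes_eq (reps P) j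
      (resMod I (ModuleCat.of (R ⧸ I) (reps P (j + 1) ⧸ X.1)))
    have hfl : IsFiniteLength R (resMod I (ModuleCat.of (R ⧸ I) (reps P (j + 1) ⧸ X.1))) :=
      isFiniteLength_resMod.mpr X.2.1
    rw [hc, Dir.coeff_smul, Dir.coeff_of, if_neg, mul_zero]
    rintro rfl
    rw [norm_sum_iterTensor hI hfl] at hg
    exact (two_pow_le_prod_card_iterTensor hR hI hfl hnt j).not_gt hg
  have hX₀ : bracketG I (reps P) j (moduleClass (R ⧸ I) (reps P (j + 1) ⧸ X₀.1)) = 1 := by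
    have : Subsingleton (reps P (j + 1) ⧸ (⊤ : Submodule (R ⧸ I) (reps P (j + 1)))) :=
      inferInstance
    rw [bracketG_moduleClass hI hP j X₀.2.1]
    exact (isMultInvariant_bracketRes hI hP j).eq_one _ this
  rw [Dir.coeff_sub, prolifFactor, Dir.coeff_eq_sum hR.finiteSimpleCounts h g {X₀} hterm,
    Finset.sum_singleton, hX₀, sub_self]

/-- Past the stabilisation index both `P j` and `P (j + 1)` are the class of `M/IM`, so the factor
is `1` up to terms of norm at least `2 ^ (j + 1)`. -/
theorem multipliable_prolifFactor (hR : IsLeftArithmetical R) (hI : IsInvertibleIdeal I)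
    (hproj : ∀ Y : Submodule (R ⧸ I) (ModI I M),
      IsFiniteLength (R ⧸ I) (ModI I M ⧸ Y) → Module.Projective (R ⧸ I) Y)
    {P : ℕ → IsoClass (R ⧸ I)} (hP : P ∈ ChainClasses I M) :
    Multipliable fun j : ℕ => prolifFactor I P j := by
  obtain ⟨Y, hY, h⟩ := hP
  obtain ⟨m, hm⟩ := hY.eventually_top
  refine Dir.multipliable_of_coeff_sub_one hR.finiteSimpleCounts fun n => ⟨max m n, ?_⟩
  intro j hj g hg
  refine coeff_prolifFactor_sub_one hR hI (projective_reps hproj ⟨Y, hY, h⟩)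
    (finite_reps hR ⟨Y, hY, h⟩ _) ?_ ?_
  · obtain ⟨e⟩ := reps_equiv_iff.mp (h j)
    obtain ⟨e'⟩ := reps_equiv_iff.mp (h (j + 1))
    rw [hm j ((le_max_left m n).trans hj)] at e
    rw [hm (j + 1) (((le_max_left m n).trans hj).trans j.le_succ)] at e'
    exact ⟨e'.symm.trans e⟩
  · calc g.norm ≤ j := hg.trans ((le_max_right m n).trans hj)
      _ < j + 1 := j.lt_succ_self
      _ < 2 ^ (j + 1) := Nat.lt_two_pow_self

/-- The sum of the terms `[M/X]` over the submodules `X` with chain `Y`. -/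
noncomputable def chainSum (Y : StableChain I M) : Dir R :=
  ∑' X : ChainFibre Y.1, zetaTerm R M X.1

theorem hasSum_chainSum (hR : IsLeftArithmetical R) (hIJ : I ≤ Ring.jacobson R) :
    HasSum (chainSum : StableChain I M → Dir R) (zeta R M) := by
  have := Dir.isTopologicalRing hR.finiteSimpleCounts
  have := Dir.t2Space hR.finiteSimpleCounts
  let φ : {X : Submodule R M // IsFiniteLength R (M ⧸ X)} → StableChain I M :=
    fun X => ⟨chainOf I X.1, isStableChain_chainOf hIJ X.2⟩
  have hsum := summable_zetaTerm hR M
  refine HasSum.sigma ((Equiv.hasSum_iff (Equiv.sigmaFiberEquiv φ)).mpr hsum.hasSum) fun Y => ?_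
  let e : {X // φ X = Y} ≃ ChainFibre Y.1 := Equiv.subtypeEquivRight fun X => Subtype.ext_iff
  refine (Equiv.hasSum_iff e (f := fun X : ChainFibre Y.1 => zetaTerm R M X.1)).mpr ?_
  exact (Dir.summable_comp_injective hR.finiteSimpleCounts hsum Subtype.val_injective).hasSum

variable [Module.Projective R M]

theorem chainSum_eq_prod (hR : IsLeftArithmetical R) (hI : IsInvertibleIdeal I)
    (hIJ : I ≤ Ring.jacobson R)
    (hproj : ∀ Y : Submodule (R ⧸ I) (ModI I M),
      IsFiniteLength (R ⧸ I) (ModI I M ⧸ Y) → Module.Projective (R ⧸ I) Y)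
    {P : ChainClasses I M} {Y : StableChain I M} (hYP : Y.classes = P) {n : ℕ}
    (hn : ∀ j, n ≤ j → Y.1 j = ⊤) :
    chainSum Y = ∏ j ∈ Finset.range n, chainWeight (reps P.1) j (Y.1 j) (Y.1 (j + 1)) := by
  have := Dir.t2Space hR.finiteSimpleCounts
  rw [chainSum, (hasSum_chainFibre hR hI hIJ hproj n Y.1 Y.2 hn).tsum_eq]
  refine Finset.prod_congr rfl fun j _ => ?_
  rw [bracketRes_congr (P' := reps P.1) (StableChain.nonempty_equiv_reps hYP)]
  exact (isMultInvariant_bracketRes hI (projective_reps hproj P.2) j).congr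
    (A := ModuleCat.of R (subquot (preSub (Y.1 j)) (preSub (Y.1 (j + 1)))))
    (subquotResEquiv (Y.1 j) (Y.1 (j + 1)))
    (isFiniteLength_resMod.mpr (isFiniteLength_subquot _ (Y.2.finiteColength j)))
    fun r hr b => smul_resMod_eq_zero _ hr b

/-- The bound `n` serves for `Y₀`, which forces `P j` to be the class of `M/IM` for `j ≥ n`. Chains
ending at `⊤` with the right terms below `n` then automatically have type `P`. -/
theorem hasSum_chainSum_of_eventually_top (hR : IsLeftArithmetical R) (hI : IsInvertibleIdeal I)
    (hIJ : I ≤ Ring.jacobson R)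
    (hproj : ∀ Y : Submodule (R ⧸ I) (ModI I M),
      IsFiniteLength (R ⧸ I) (ModI I M ⧸ Y) → Module.Projective (R ⧸ I) Y)
    (P : ChainClasses I M) {Y₀ : StableChain I M} (hY₀ : Y₀.classes = P) {n : ℕ}
    (hn : ∀ j, n ≤ j → Y₀.1 j = ⊤) :
    HasSum (fun Y : {Y : {Y : StableChain I M // Y.classes = P} |
        ∀ j, n ≤ j → Y.1.1 j = ⊤} => chainSum Y.1.1)
      (∏ j ∈ Finset.range n, prolifFactor I P.1 j) := by
  have htop : ∀ j, n ≤ j →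
      Nonempty ((⊤ : Submodule (R ⧸ I) (ModI I M)) ≃ₗ[R ⧸ I] reps P.1 j) := fun j hj => by
    rw [← hn j hj]
    exact StableChain.nonempty_equiv_reps hY₀ j
  have h := hasSum_prod_chainWeight hR hI (projective_reps hproj P.2) (finite_reps hR P.2) n
    (⊤ : Submodule (R ⧸ I) (ModI I M)) .of_subsingleton (htop n le_rfl)
  let e : {Y : {Y : StableChain I M // Y.classes = P} | ∀ j, n ≤ j → Y.1.1 j = ⊤} ≃
      {Y : ℕ → Submodule (R ⧸ I) (ModI I M) // IsChainTo (reps P.1) n ⊤ Y} :=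
    { toFun := fun Y => ⟨Y.1.1.1, Y.1.1.2.mono, Y.2, Y.1.1.2.finiteColength,
        fun j _ => StableChain.nonempty_equiv_reps Y.1.2 j⟩
      invFun := fun Y => ⟨⟨⟨Y.1, Y.2.mono, Y.2.finiteColength, n, Y.2.eq_of_le⟩,
        Subtype.ext (funext fun j => (reps_equiv_iff.mpr (by
          rcases lt_or_ge j n with hj | hj
          · exact Y.2.equiv j hj
          · rw [Y.2.eq_of_le j hj]
            exact htop j hj)).symm)⟩, Y.2.eq_of_le⟩
      left_inv := fun _ => rfl
      right_inv := fun _ => rfl }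
  rw [← e.hasSum_iff] at h
  have hfun : (fun Y : {Y : {Y : StableChain I M // Y.classes = P} |
      ∀ j, n ≤ j → Y.1.1 j = ⊤} => chainSum Y.1.1) =
      (fun Y : {Y : ℕ → Submodule (R ⧸ I) (ModI I M) // IsChainTo (reps P.1) n ⊤ Y} =>
        ∏ j ∈ Finset.range n, chainWeight (reps P.1) j (Y.1 j) (Y.1 (j + 1))) ∘ e :=
    funext fun Y => chainSum_eq_prod hR hI hIJ hproj Y.1.2 Y.2
  rw [hfun]
  exact h

/-- A proper submodule of `M/IM` may be isomorphic to `M/IM`, so the chains of type `P` need not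
share a stabilisation index. They are exhausted by those stable from `n` on, and the `n`-th partial
sum is the `n`-th partial product. -/
theorem hasSum_chainSum_fibre (hR : IsLeftArithmetical R) (hI : IsInvertibleIdeal I)
    (hIJ : I ≤ Ring.jacobson R)
    (hproj : ∀ Y : Submodule (R ⧸ I) (ModI I M),
      IsFiniteLength (R ⧸ I) (ModI I M ⧸ Y) → Module.Projective (R ⧸ I) Y)
    (P : ChainClasses I M) :
    HasSum (fun Y : {Y : StableChain I M // Y.classes = P} => chainSum Y.1)
      (∏' j : ℕ, prolifFactor I P.1 j) := by
  have := Dir.t2Space hR.finiteSimpleCounts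
  have hsum : Summable fun Y : {Y : StableChain I M // Y.classes = P} => chainSum Y.1 :=
    Dir.summable_comp_injective hR.finiteSimpleCounts (hasSum_chainSum hR hIJ).summable
      Subtype.val_injective
  obtain ⟨Y₀, hY₀, hYP⟩ := P.2
  obtain ⟨m, hm⟩ := hY₀.eventually_top
  have hclasses : StableChain.classes ⟨Y₀, hY₀⟩ = P :=
    Subtype.ext (funext fun j => (hYP j).symm)
  have hlim := Dir.tendsto_of_exhaustion hR.finiteSimpleCounts hsum.hasSum
    (S := fun n => {Y | ∀ j, n ≤ j → Y.1.1 j = ⊤})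
    (p := fun n => ∏ j ∈ Finset.range n, prolifFactor I P.1 j)
    (fun Y => by
      obtain ⟨k, hk⟩ := Y.1.2.eventually_top
      filter_upwards [eventually_ge_atTop k] with n hn j hj using hk j (hn.trans hj))
    (by
      filter_upwards [eventually_ge_atTop m] with n hn
      exact hasSum_chainSum_of_eventually_top hR hI hIJ hproj P hclasses
        fun j hj => hm j (hn.trans hj))
  have hprod := (multipliable_prolifFactor hR hI hproj P.2).hasProd.tendsto_prod_nat
  rw [tendsto_nhds_unique hprod hlim]
  exact hsum.hasSum

theorem hasSum_prolif (hR : IsLeftArithmetical R) (hI : IsInvertibleIdeal I)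
    (hIJ : I ≤ Ring.jacobson R)
    (hproj : ∀ Y : Submodule (R ⧸ I) (ModI I M),
      IsFiniteLength (R ⧸ I) (ModI I M ⧸ Y) → Module.Projective (R ⧸ I) Y) :
    HasSum (fun P : ChainClasses I M => ∏' j : ℕ, prolifFactor I P.1 j) (zeta R M) := by
  have := Dir.isTopologicalRing hR.finiteSimpleCounts
  exact HasSum.sigma ((Equiv.hasSum_iff
    (Equiv.sigmaFiberEquiv (StableChain.classes (I := I) (M := M)))).mpr
      (hasSum_chainSum hR hIJ)) fun P => hasSum_chainSum_fibre hR hI hIJ hproj P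

end Proliferation

/-- The proliferation formula. Besides the formula, the conclusion records that all series and
products in it converge and that `⟨P, -⟩_j^I` descends to the monoid `G`. -/
theorem mainTheorem1 {R : Type u} [Ring R] (hR : IsLeftArithmetical R)
    (M : Type u) [AddCommGroup M] [Module R M] [Module.Finite R M] [Module.Projective R M]
    (I : Ideal R) [I.IsTwoSided] (hI : IsInvertibleIdeal I) (hIJ : I ≤ Ring.jacobson R)
    (hproj : ∀ Y : Submodule (R ⧸ I) (ModI I M),
      IsFiniteLength (R ⧸ I) (ModI I M ⧸ Y) → Module.Projective (R ⧸ I) Y) :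
    Summable (zetaTerm R M) ∧
    (∀ P ∈ ChainClasses I M, ∀ j : ℕ,
      Module.Finite (R ⧸ I) (reps P j) ∧ Module.Projective (R ⧸ I) (reps P j) ∧
      (∀ B : ModuleCat.{u} (R ⧸ I), IsFiniteLength (R ⧸ I) B →
        bracketG I (reps P) j (moduleClass (R ⧸ I) B) = bracket I (reps P) j B) ∧
      Summable (partialZetaTerm (R ⧸ I) (reps P (j + 1)) (reps P j)) ∧
      ∀ f : Dir (R ⧸ I), Summable (Dir.substTerm (bracketG I (reps P) j) f)) ∧
    (∀ P ∈ ChainClasses I M, Multipliable fun j : ℕ => prolifFactor I P j) ∧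
    (Summable fun P : ChainClasses I M => ∏' j : ℕ, prolifFactor I P.1 j) ∧
    zeta R M = prolif I M := by
  have := Dir.t2Space hR.finiteSimpleCounts
  have h := hasSum_prolif (M := M) hR hI hIJ hproj
  refine ⟨summable_zetaTerm hR M, fun P hP j => ⟨finite_reps hR hP j, projective_reps hproj hP j,
    fun B hB => ?_, summable_partialZetaTerm hR _ _ (finite_reps hR hP (j + 1)),
    summable_substTerm hR hI (reps P) j⟩, fun P hP => multipliable_prolifFactor hR hI hproj hP,
    h.summable, h.tsum_eq.symm⟩
  -- Both the multiplicative extension from simple modules and the bracket defined with `I ^ k`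
  -- agree with the version built on iterated tensor products.
  rw [bracketG_moduleClass hI (projective_reps hproj hP) j hB, bracket_eq_bracketRes hI _ j hB]
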